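/- **Conventions.** Let $\mathcal A$ be an abelian category and let $r\ge 0$ be an integer. A *filtered object* of $\mathcal A$ is an object $X$ with an increasing family of subobjects $W_pX\subseteq X$, $p\in\mathbb Z$; morphisms are the morphisms of $\mathcal A$ that respect the filtrations. A *filtered complex* is a cochain complex $K=(K^n)_{n\in\mathbb Z}$ of filtered objects. The page $E_r(K)$ of its spectral sequence has the terms $E_r^{p}(K)^n=Z_r^{p}/B_r^{p}$ (filtration degree $p$, total degree $n$), where $$Z_r^{p}=W_pK^n\cap d^{-1}(W_{p-r}K^{n+1}),\qquad B_r^{p}=Z_{r-1}^{p-1}K^n+d\big(Z_{r-1}^{p+r-1}K^{n-1}\big),$$ with the differential $d_r$ induced by $d$. A morphism $f$ of filtered complexes is an *$E_r$-quasi-isomorphism* if $E_r(f)$ is a quasi-isomorphism for $d_r$. Write $\mathcal E_r$ for the class of these morphisms. For a nonempty finite set $S$ let $\square_S$ be the poset of nonempty subsets of $S$. Let $\Pi$ be the category whose objects are the finite products $P=\prod_{i\in I}\square_{S_i}$ ($I$ a finite totally ordered set, possibly empty) and whose morphisms are the functors given, after an order-preserving identification of the index sets, by an injective map of sets in each component.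 For $\alpha\in P$ put $|\alpha|=\sum_i(\#\alpha_i-1)$. A *cubical codiagram* of a category $\mathcal D$ is a pair $(X,P)$ with $P\in\Pi$ and $X:P\to\mathcal D$ a functor; a morphism $(X,P)\to(Y,P')$ is a pair $(a,\delta)$ with $\delta:P'\to P$ in $\Pi$ and $a:X\circ\delta\to Y$ a natural transformation. Denote the resulting category by $CoDiag_\Pi\mathcal D$. For a functor $\mathbf s:CoDiag_\Pi\mathcal D\to\mathcal D$ write $\mathbf s_P(X)=\mathbf s(X,P)$. The *$r$-simple* $\mathbf s^r(K)$ of a codiagram $K:P\to\{\text{filtered complexes}\}$ is the total complex $\mathbf s(K)^n=\bigoplus_{\alpha\in P}(K^\alpha)^{n-|\alpha|}$, whose differential is $(-1)^{|\alpha|}d_{K^\alpha}$ on the summand of $\alpha$, plus the structure maps $K^\alpha\to K^\beta$ for $\alpha\subset\beta$, $|\beta|=|\alpha|+1$, with the incidence signs of the cellular cochain complex of the product of the simplices with vertex sets $S_i$, with the filtration $$W(r)_p\,\mathbf s(K)^n=\bigoplus_{\alpha} W_{p+r|\alpha|}(K^\alpha)^{n-|\alpha|}.$$ It is a functor on cubical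 codiagrams (a morphism $(a,\delta)$ acts on the summand of $\delta(\beta)$ by $a_\beta$ up to the sign by which $\delta$ changes the orientation of $\beta$). **Definition.** Let $\mathcal D$ be a category, $\mathcal E$ a class of morphisms of $\mathcal D$ and $\mathbf s:CoDiag_\Pi\mathcal D\to\mathcal D$ a functor. The triple $(\mathcal D,\mathcal E,\mathbf s)$ is a *cohomological descent category* if there are natural transformations $$\mu_{P,Q}:\mathbf s_P\mathbf s_QX\to\mathbf s_{P\times Q}X\quad (X:P\times Q\to\mathcal D),\qquad \lambda_P:X\to\mathbf s_P(\mathrm{const}_X)\quad(X\in\mathcal D),$$ natural in $X$ and in $P,Q\in\Pi$, such that: 1. $\mathcal D$ has finite products and an initial object $1$. 2. $\mathcal E$ is saturated (every morphism that becomes invertible in $\mathcal D[\mathcal E^{-1}]$ lies in $\mathcal E$) and stable by products ($f,g\in\mathcal E$ implies $f\times g\in\mathcal E$). 3. Each $\mathbf s_P$ commutes with finite products. 4. (Exactness) If $a:X\to Y$ is a morphism of diagrams of shape $P$ with all $a_\alpha\in\mathcal E$, then $\mathbf s_P(a)\in\mathcal E$. 5. All $\mu_{P,Q}$ and $\lambda_P$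 lie in $\mathcal E$; $\mu$ is associative, $\lambda_{*}$ for the empty product $*$ is a left and right unit for $\mu$, and $\lambda_{P\times Q}$ is the composite $X\to\mathbf s_P(\mathrm{const}_X)\to\mathbf s_P\mathbf s_Q(\mathrm{const}_X)\to\mathbf s_{P\times Q}(\mathrm{const}_X)$ of $\lambda_P$, $\mathbf s_P(\lambda_Q)$ and $\mu_{P,Q}$. 6. (Acyclicity criterion) Let $S$ be a nonempty finite set and let $X^+$ be a functor from the poset of all subsets of $S$ (the empty one included) to $\mathcal D$; regard it as a diagram $Z$ of shape $\square_{S\sqcup\{*\}}$ with $Z(\beta\cup\{*\})=X^+(\beta)$ and $Z(\alpha)$ initial if $*\notin\alpha$. Then the morphism $X^+(\emptyset)\xrightarrow{\lambda}\mathbf s_{\square_S}(\mathrm{const}_{X^+(\emptyset)})\to\mathbf s_{\square_S}(X^+|_{\square_S})$ lies in $\mathcal E$ if and only if $\mathbf s_{\square_{S\sqcup\{*\}}}(Z)$ is acyclic, that is, the morphism $1\to\mathbf s_{\square_{S\sqcup\{*\}}}(Z)$ lies in $\mathcal E$. **Theorem.** For every abelian category $\mathcal A$ and every $r\ge0$,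 the triple (filtered complexes of $\mathcal A$, $\mathcal E_r$, $\mathbf s^r$) is a cohomological descent category. The same holds for the full subcategory of bounded below filtered complexes, with the restrictions of $\mathcal E_r$ and $\mathbf s^r$. -/

import Mathlib

open CategoryTheory Limits

universe v u

noncomputable section

namespace CubicalDescent

/-! ### The category of cubes -/

/-- A nonempty finite set. It is presented with a total order, which serves only to fix signs:
morphisms need not respect it. -/
structure CubeSet where
  carrier : Type
  [linearOrder : LinearOrder carrier]
  [fintype : Fintype carrier]
  [nonempty : Nonempty carrier]

attribute [instance] CubeSet.linearOrder CubeSet.fintype CubeSet.nonempty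

/-- The nonempty subsets of `S`, ordered by inclusion: the category `□_S`. -/
abbrev CubeSet.Face (S : CubeSet) : Type := {a : Finset S.carrier // a.Nonempty}

/-- A finite product `∏ i, □_(S i)`, with factors indexed by a finite totally ordered set. -/
structure Cube where
  ι : Type
  [linearOrder : LinearOrder ι]
  [fintype : Fintype ι]
  S : ι → CubeSet

attribute [instance] Cube.linearOrder Cube.fintype

namespace Cube

/-- The poset `∏ i, □_(S i)`, viewed as a category. -/
def Idx (P : Cube) : Type := ∀ i : P.ι, (P.S i).Face

instance (P : Cube) : PartialOrder P.Idx := inferInstanceAs (PartialOrder (∀ i, (P.S i).Face))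

instance (P : Cube) : Fintype P.Idx := inferInstanceAs (Fintype (∀ i, (P.S i).Face))

instance (P : Cube) : DecidableEq P.Idx := Classical.decEq _

variable {P Q R : Cube}

/-- The elements of the `i`-th component of `α`. -/
def Idx.set (α : P.Idx) (i : P.ι) : Finset (P.S i).carrier := (α i).1

lemma Idx.set_nonempty (α : P.Idx) (i : P.ι) : (α.set i).Nonempty := (α i).2

lemma Idx.ext {α β : P.Idx} (h : ∀ i, α.set i = β.set i) : α = β :=
  funext fun i => Subtype.ext (h i)

lemma Idx.le_iff {α β : P.Idx} : α ≤ β ↔ ∀ i, α.set i ⊆ β.set i := Iff.rfl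

/-- The dimension `|α|` of the product of simplices with vertex sets `α i`. -/
def Idx.dim (α : P.Idx) : ℕ := ∑ i, ((α.set i).card - 1)

/-- A morphism of cubes: a family of injective maps between corresponding factors. -/
@[ext] structure Hom (P Q : Cube) where
  σ : Q.ι ≃o P.ι
  u : ∀ j : Q.ι, (P.S (σ j)).carrier ↪ (Q.S j).carrier

instance : Category Cube where
  Hom := Hom
  id P := ⟨OrderIso.refl _, fun _ => Function.Embedding.refl _⟩
  comp f g := ⟨g.σ.trans f.σ, fun k => (f.u (g.σ k)).trans (g.u k)⟩

/-- The map of posets given by a morphism of cubes: take the image in each component. -/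
def Hom.map (f : P ⟶ Q) (α : P.Idx) : Q.Idx :=
  fun j => ⟨(α.set (f.σ j)).map (f.u j), (α.set_nonempty _).map⟩

lemma Hom.map_set (f : P ⟶ Q) (α : P.Idx) (j : Q.ι) :
    (f.map α).set j = (α.set (f.σ j)).map (f.u j) := rfl

lemma Hom.map_mono (f : P ⟶ Q) : Monotone f.map :=
  fun _ _ h j => Finset.map_subset_map.2 (h (f.σ j))

/-- The functor between the categories of faces given by a morphism of cubes. -/
abbrev Hom.functor (f : P ⟶ Q) : P.Idx ⥤ Q.Idx := f.map_mono.functor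

lemma Hom.map_id (α : P.Idx) : Hom.map (𝟙 P) α = α :=
  Idx.ext fun _ => Finset.map_refl

lemma Hom.map_comp (f : P ⟶ Q) (g : Q ⟶ R) (α : P.Idx) :
    Hom.map (f ≫ g) α = g.map (f.map α) :=
  Idx.ext fun k => (Finset.map_map (f.u (g.σ k)) (g.u k) _).symm

lemma Hom.map_injective (f : P ⟶ Q) : Function.Injective f.map := by
  intro α β h
  refine Idx.ext fun i => ?_
  obtain ⟨j, rfl⟩ := f.σ.surjective i
  have := congrArg (fun γ => Idx.set γ j) h
  exact Finset.map_injective _ this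

lemma Hom.dim_map (f : P ⟶ Q) (α : P.Idx) : (f.map α).dim = α.dim := by
  unfold Idx.dim
  refine Fintype.sum_equiv f.σ.toEquiv _ _ fun j => ?_
  rw [Hom.map_set, Finset.card_map]; rfl

lemma Hom.exists_of_le_map (f : P ⟶ Q) {α : Q.Idx} {γ : P.Idx} (h : α ≤ f.map γ) :
    ∃ β ≤ γ, f.map β = α := by
  have hj : ∀ i, ∃ b : (P.S i).Face, b.1 ⊆ γ.set i ∧ ∀ j (e : f.σ j = i),
      α.set j = (e ▸ b).1.map (f.u j) := by
    intro i
    obtain ⟨j, rfl⟩ := f.σ.surjective i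
    obtain ⟨b, hb, hb'⟩ := Finset.subset_map_iff.1 (h j)
    refine ⟨⟨b, ?_⟩, hb, ?_⟩
    · have := α.set_nonempty j
      rw [Idx.set, hb'] at this
      simpa using this
    · intro j' e
      obtain rfl := f.σ.injective e
      exact hb'
  choose b hb hb' using hj
  exact ⟨b, hb, Idx.ext fun j => (hb' (f.σ j) j rfl).symm⟩

lemma Idx.dim_mono {α β : P.Idx} (h : α ≤ β) : α.dim ≤ β.dim :=
  Finset.sum_le_sum fun i _ => Nat.sub_le_sub_right (Finset.card_le_card (h i)) 1

lemma Idx.eq_of_le_of_dim_le {α β : P.Idx} (h : α ≤ β) (hd : β.dim ≤ α.dim) : α = β := by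
  have h1 : ∀ i ∈ Finset.univ, (α.set i).card - 1 ≤ (β.set i).card - 1 :=
    fun i _ => Nat.sub_le_sub_right (Finset.card_le_card (h i)) 1
  have h2 := (Finset.sum_eq_sum_iff_of_le h1).1 (le_antisymm (Finset.sum_le_sum h1) hd)
  refine Idx.ext fun i => Finset.eq_of_subset_of_card_le (h i) ?_
  have h3 := h2 i (Finset.mem_univ i)
  have h4 := (α.set_nonempty i).card_pos
  have h5 := (β.set_nonempty i).card_pos
  change (β.set i).card ≤ (α.set i).card
  omega

/-! ### Signs -/

/-- The number of vertices preceding the vertex `s` of the `i`-th factor, with the usual sign rule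
for a tensor product: each earlier factor contributes its dimension. -/
def Idx.weight (α : P.Idx) (i : P.ι) (s : (P.S i).carrier) : ℕ :=
  (∑ k with k < i, ((α.set k).card - 1)) + ((α.set i).filter (· < s)).card

/-- The incidence sign of the face `α` of codimension one in `β`. -/
def Idx.incidence (α β : P.Idx) : ℤ :=
  (-1) ^ (∑ i, ∑ s ∈ β.set i \ α.set i, α.weight i s)

/-- The sign of the permutations by which the injections `f.u j` change the orders of the sets
`α.set (f.σ j)`, computed by counting inversions. -/
def Hom.sign (f : P ⟶ Q) (α : P.Idx) : ℤ :=
  ∏ j, ∏ s ∈ α.set (f.σ j), ∏ t ∈ α.set (f.σ j),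
    if s < t ∧ f.u j t < f.u j s then -1 else 1

/-- The face obtained by adding one vertex. -/
def Idx.add (α : P.Idx) (i : P.ι) (s : (P.S i).carrier) : P.Idx :=
  Function.update α i ⟨insert s (α.set i), Finset.insert_nonempty _ _⟩

lemma Idx.add_set_self (α : P.Idx) (i : P.ι) (s : (P.S i).carrier) :
    (α.add i s).set i = insert s (α.set i) :=
  congrArg Subtype.val (Function.update_self i _ α)

lemma Idx.add_set_ne (α : P.Idx) {i j : P.ι} (s : (P.S i).carrier) (h : j ≠ i) :
    (α.add i s).set j = α.set j :=
  congrArg Subtype.val (Function.update_of_ne h _ α)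

lemma Idx.le_add (α : P.Idx) (i : P.ι) (s : (P.S i).carrier) : α ≤ α.add i s := by
  intro j
  change α.set j ⊆ (α.add i s).set j
  by_cases h : j = i
  · subst h; rw [add_set_self]; exact Finset.subset_insert _ _
  · rw [add_set_ne _ _ h]

lemma Idx.add_le {α β : P.Idx} (h : α ≤ β) {i : P.ι} {s : (P.S i).carrier}
    (hs : s ∈ β.set i) : α.add i s ≤ β := by
  intro j
  change (α.add i s).set j ⊆ β.set j
  by_cases e : j = i
  · subst e; rw [add_set_self]; exact Finset.insert_subset hs (h j)
  · rw [add_set_ne _ _ e]; exact h j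

lemma Idx.mem_add (α : P.Idx) (i : P.ι) (s : (P.S i).carrier) : s ∈ (α.add i s).set i := by
  rw [add_set_self]; exact Finset.mem_insert_self _ _

lemma Idx.dim_add (α : P.Idx) {i : P.ι} {s : (P.S i).carrier} (hs : s ∉ α.set i) :
    (α.add i s).dim = α.dim + 1 := by
  unfold Idx.dim
  rw [← Finset.add_sum_erase _ _ (Finset.mem_univ i),
    ← Finset.add_sum_erase Finset.univ (fun j => (α.set j).card - 1) (Finset.mem_univ i)]
  have h1 : ∑ j ∈ Finset.univ.erase i, (((α.add i s).set j).card - 1) =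
      ∑ j ∈ Finset.univ.erase i, ((α.set j).card - 1) :=
    Finset.sum_congr rfl fun j hj => by rw [add_set_ne _ _ (Finset.ne_of_mem_erase hj)]
  have := (α.set_nonempty i).card_pos
  rw [h1, add_set_self, Finset.card_insert_of_notMem hs]
  omega

lemma Idx.exists_add {α β : P.Idx} (h : α ≤ β) (hd : α.dim < β.dim) :
    ∃ i, ∃ s ∉ α.set i, α.add i s ≤ β := by
  by_contra! hc
  have : β ≤ α := fun i s hs => by
    by_contra hs'
    exact hc i s hs' (Idx.add_le h hs)
  exact absurd (Idx.dim_mono this) (by omega)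

lemma Idx.exists_eq_add {α β : P.Idx} (h : α ≤ β) (hd : β.dim = α.dim + 1) :
    ∃ i, ∃ s ∉ α.set i, β = α.add i s := by
  obtain ⟨i, s, hs, hle⟩ := Idx.exists_add h (by omega)
  exact ⟨i, s, hs, (Idx.eq_of_le_of_dim_le hle (by rw [Idx.dim_add _ hs]; omega)).symm⟩

lemma Idx.incidence_add (α : P.Idx) {i : P.ι} {s : (P.S i).carrier} (hs : s ∉ α.set i) :
    α.incidence (α.add i s) = (-1) ^ α.weight i s := by
  unfold Idx.incidence
  congr 1
  rw [Finset.sum_eq_single i]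
  · rw [add_set_self, Finset.insert_sdiff_of_notMem _ hs]; simp
  · intro j _ hj
    rw [add_set_ne _ _ hj]; simp
  · simp

lemma Idx.weight_add_self (α : P.Idx) {i : P.ι} {s t : (P.S i).carrier} (hs : s ∉ α.set i) :
    (α.add i s).weight i t = α.weight i t + if s < t then 1 else 0 := by
  unfold Idx.weight
  have h1 : ∑ k with k < i, (((α.add i s).set k).card - 1) =
      ∑ k with k < i, ((α.set k).card - 1) :=
    Finset.sum_congr rfl fun k hk => by rw [add_set_ne _ _ (Finset.mem_filter.1 hk).2.ne]
  rw [h1, add_set_self, Finset.filter_insert]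
  split_ifs with h
  · rw [Finset.card_insert_of_notMem (by simp [hs])]; omega
  · omega

lemma Idx.weight_add_ne (α : P.Idx) {i j : P.ι} (hij : i ≠ j) {s : (P.S i).carrier}
    (t : (P.S j).carrier) (hs : s ∉ α.set i) :
    (α.add i s).weight j t = α.weight j t + if i < j then 1 else 0 := by
  unfold Idx.weight
  rw [add_set_ne _ _ hij.symm]
  split_ifs with h
  · have hi : i ∈ Finset.univ.filter (· < j) := by simp [h]
    rw [← Finset.add_sum_erase _ _ hi,
      ← Finset.add_sum_erase _ (fun k => (α.set k).card - 1) hi]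
    have h1 : ∑ k ∈ (Finset.univ.filter (· < j)).erase i, (((α.add i s).set k).card - 1) =
        ∑ k ∈ (Finset.univ.filter (· < j)).erase i, ((α.set k).card - 1) :=
      Finset.sum_congr rfl fun k hk => by rw [add_set_ne _ _ (Finset.ne_of_mem_erase hk)]
    have := (α.set_nonempty i).card_pos
    rw [h1, add_set_self, Finset.card_insert_of_notMem hs]
    omega
  · have h1 : ∑ k with k < j, (((α.add i s).set k).card - 1) =
        ∑ k with k < j, ((α.set k).card - 1) :=
      Finset.sum_congr rfl fun k hk => by
        rw [add_set_ne]
        rintro rfl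
        exact h (Finset.mem_filter.1 hk).2
    rw [h1]; omega

lemma Idx.incidence_anticomm (α : P.Idx) {i j : P.ι} {s : (P.S i).carrier} {t : (P.S j).carrier}
    (hs : s ∉ α.set i) (ht : t ∉ (α.add i s).set j) (ht' : t ∉ α.set j)
    (hs' : s ∉ (α.add j t).set i) :
    α.incidence (α.add i s) * (α.add i s).incidence ((α.add i s).add j t) +
      α.incidence (α.add j t) * (α.add j t).incidence ((α.add j t).add i s) = 0 := by
  rw [incidence_add _ hs, incidence_add _ ht, incidence_add _ ht', incidence_add _ hs']
  by_cases hij : i = j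
  · subst hij
    rw [weight_add_self _ hs, weight_add_self _ ht']
    rw [add_set_self, Finset.mem_insert, not_or] at ht
    rcases lt_or_gt_of_ne ht.1 with h | h
    · simp [h, h.not_gt, pow_add]; ring
    · simp [h, h.not_gt, pow_add]; ring
  · rw [weight_add_ne _ hij _ hs, weight_add_ne _ (Ne.symm hij) _ ht']
    rcases lt_or_gt_of_ne hij with h | h
    · simp [h, h.not_gt, pow_add]; ring
    · simp [h, h.not_gt, pow_add]; ring

lemma Idx.add_comm (α : P.Idx) (i j : P.ι) (s : (P.S i).carrier) (t : (P.S j).carrier) :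
    (α.add i s).add j t = (α.add j t).add i s := by
  refine Idx.ext fun k => ?_
  by_cases hi : k = i
  · subst hi
    by_cases hj : k = j
    · subst hj; simp only [add_set_self]; exact Finset.insert_comm _ _ _
    · rw [add_set_ne _ _ hj, add_set_self, add_set_self, add_set_ne _ _ hj]
  · by_cases hj : k = j
    · subst hj; rw [add_set_self, add_set_ne _ _ hi, add_set_ne _ _ hi, add_set_self]
    · rw [add_set_ne _ _ hj, add_set_ne _ _ hi, add_set_ne _ _ hi, add_set_ne _ _ hj]

open Classical in
/-- The incidence signs make the cubical differential square to zero. -/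
lemma Idx.sum_incidence {α γ : P.Idx} (h : α ≤ γ) (hd : γ.dim = α.dim + 2) :
    ∑ β : P.Idx with (α ≤ β ∧ β ≤ γ) ∧ β.dim = α.dim + 1,
      α.incidence β * β.incidence γ = 0 := by
  obtain ⟨i, s, hs, hle⟩ := Idx.exists_add h (by omega)
  obtain ⟨j, t, ht, rfl⟩ := Idx.exists_eq_add hle (by rw [Idx.dim_add _ hs]; omega)
  have ht' : t ∉ α.set j := fun hh => ht (Idx.le_add α i s j hh)
  have hne : α.add i s ≠ α.add j t := fun e => ht (e ▸ Idx.mem_add _ _ _)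
  have hs' : s ∉ (α.add j t).set i := by
    intro hh
    have h1 := Idx.add_le (Idx.le_add α j t) hh
    exact hne (Idx.eq_of_le_of_dim_le h1 (by rw [Idx.dim_add _ hs, Idx.dim_add _ ht']))
  have hset : (Finset.univ.filter fun β : P.Idx =>
      (α ≤ β ∧ β ≤ (α.add i s).add j t) ∧ β.dim = α.dim + 1) = {α.add i s, α.add j t} := by
    ext β
    simp only [Finset.mem_filter, Finset.mem_univ, true_and, Finset.mem_insert,
      Finset.mem_singleton]
    constructor
    · rintro ⟨⟨h1, h2⟩, h3⟩
      obtain ⟨k, w, hw, rfl⟩ := Idx.exists_eq_add h1 h3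
      have hm := h2 k (Idx.mem_add _ _ _)
      change w ∈ ((α.add i s).add j t).set k at hm
      by_cases hk : w ∈ (α.add i s).set k
      · left
        exact Idx.eq_of_le_of_dim_le (Idx.add_le (Idx.le_add _ _ _) hk)
          (by rw [Idx.dim_add _ hs, Idx.dim_add _ hw])
      · right
        by_cases hkj : k = j
        · subst hkj
          rw [add_set_self, Finset.mem_insert] at hm
          rcases hm with rfl | hm
          · rfl
          · exact absurd hm hk
        · rw [add_set_ne _ _ hkj] at hm
          exact absurd hm hk
    · rintro (rfl | rfl)
      · exact ⟨⟨Idx.le_add _ _ _, Idx.le_add _ _ _⟩, Idx.dim_add _ hs⟩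
      · refine ⟨⟨Idx.le_add _ _ _, ?_⟩, Idx.dim_add _ ht'⟩
        rw [Idx.add_comm]
        exact Idx.le_add _ _ _
  rw [hset, Finset.sum_pair hne]
  have := Idx.incidence_anticomm α hs ht ht' hs'
  rw [← Idx.add_comm α i j s t] at this
  exact this

lemma Hom.map_add (f : P ⟶ Q) (α : P.Idx) (j : Q.ι) (s : (P.S (f.σ j)).carrier) :
    f.map (α.add (f.σ j) s) = (f.map α).add j (f.u j s) := by
  refine Idx.ext fun k => ?_
  by_cases h : k = j
  · subst h
    rw [Hom.map_set, Idx.add_set_self, Idx.add_set_self, Finset.map_insert, Hom.map_set]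
  · rw [Hom.map_set, Idx.add_set_ne _ _ h, Idx.add_set_ne _ _ (by simpa using h), Hom.map_set]

lemma Hom.sign_id (α : P.Idx) : Hom.sign (𝟙 P) α = 1 := by
  unfold Hom.sign
  refine Finset.prod_eq_one fun j _ => Finset.prod_eq_one fun s _ =>
    Finset.prod_eq_one fun t _ => if_neg ?_
  rintro ⟨h1, h2⟩
  exact lt_asymm h1 h2

lemma prod_prod_eq_of_symm {X : Type} [DecidableEq X] (F G : X → X → ℤ)
    (h1 : ∀ s, F s s = G s s) (h2 : ∀ s t, s ≠ t → F s t * F t s = G s t * G t s)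
    (a : Finset X) : ∏ s ∈ a, ∏ t ∈ a, F s t = ∏ s ∈ a, ∏ t ∈ a, G s t := by
  induction a using Finset.induction_on with
  | empty => simp
  | insert x a hx ih =>
    have key : ∀ H : X → X → ℤ, ∏ s ∈ insert x a, ∏ t ∈ insert x a, H s t =
        H x x * (∏ t ∈ a, H x t * H t x) * ∏ s ∈ a, ∏ t ∈ a, H s t := by
      intro H
      simp only [Finset.prod_insert hx, Finset.prod_mul_distrib]
      ring
    rw [key, key, ih, h1]
    congr 2
    exact Finset.prod_congr rfl fun t ht => h2 _ _ (by rintro rfl; exact hx ht)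

lemma Hom.sign_comp (f : P ⟶ Q) (g : Q ⟶ R) (α : P.Idx) :
    Hom.sign (f ≫ g) α = f.sign α * g.sign (f.map α) := by
  unfold Hom.sign
  rw [← Equiv.prod_comp g.σ.toEquiv, ← Finset.prod_mul_distrib]
  refine Finset.prod_congr rfl fun k _ => ?_
  change ∏ s ∈ α.set (f.σ (g.σ k)), ∏ t ∈ α.set (f.σ (g.σ k)),
      (if s < t ∧ g.u k (f.u _ t) < g.u k (f.u _ s) then (-1 : ℤ) else 1) =
    (∏ s ∈ α.set (f.σ (g.σ k)), ∏ t ∈ α.set (f.σ (g.σ k)),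
      (if s < t ∧ f.u (g.σ k) t < f.u (g.σ k) s then (-1 : ℤ) else 1)) * _
  rw [Hom.map_set]
  simp only [Finset.prod_map, ← Finset.prod_mul_distrib]
  refine prod_prod_eq_of_symm _ _ (fun s => by simp) (fun s t hst => ?_) _
  have h1 : f.u (g.σ k) s ≠ f.u (g.σ k) t := fun h => hst ((f.u (g.σ k)).injective h)
  have h2 : g.u k (f.u (g.σ k) s) ≠ g.u k (f.u (g.σ k) t) := fun h => h1 ((g.u k).injective h)
  rcases lt_or_gt_of_ne hst with a | a <;> rcases lt_or_gt_of_ne h1 with b | b <;>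
    rcases lt_or_gt_of_ne h2 with c | c <;>
    simp [a, b, c, a.not_gt, b.not_gt, c.not_gt]

lemma Hom.weight_map (f : P ⟶ Q) (α : P.Idx) (j : Q.ι) (s : (P.S (f.σ j)).carrier) :
    (f.map α).weight j (f.u j s) = (∑ k with k < f.σ j, ((α.set k).card - 1)) +
      ((α.set (f.σ j)).filter (fun t => f.u j t < f.u j s)).card := by
  unfold Idx.weight
  congr 1
  · refine Finset.sum_equiv f.σ.toEquiv (by simp) fun k _ => ?_
    rw [Hom.map_set, Finset.card_map]; rfl
  · rw [Hom.map_set, Finset.filter_map, Finset.card_map]; rfl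

lemma neg_one_pow_card_filter {X : Type} (a : Finset X) (p : X → Prop) [DecidablePred p] :
    (-1 : ℤ) ^ (a.filter p).card = ∏ t ∈ a, if p t then -1 else 1 := by
  rw [Finset.prod_ite]; simp

/-- The signs attached to a morphism of cubes are compatible with the incidence signs. -/
lemma Hom.incidence_map_add (f : P ⟶ Q) (α : P.Idx) {j : Q.ι} {s : (P.S (f.σ j)).carrier}
    (hs : s ∉ α.set (f.σ j)) :
    (f.map α).incidence (f.map (α.add (f.σ j) s)) * f.sign (α.add (f.σ j) s) =
      f.sign α * α.incidence (α.add (f.σ j) s) := by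
  have hs' : f.u j s ∉ (f.map α).set j := by
    rw [Hom.map_set, Finset.mem_map']; exact hs
  rw [Hom.map_add, Idx.incidence_add _ hs', Idx.incidence_add _ hs, Hom.weight_map, Idx.weight,
    pow_add, pow_add, neg_one_pow_card_filter, neg_one_pow_card_filter]
  have h1 : f.sign (α.add (f.σ j) s) = f.sign α *
      ∏ t ∈ α.set (f.σ j), ((if s < t ∧ f.u j t < f.u j s then (-1 : ℤ) else 1) *
        (if t < s ∧ f.u j s < f.u j t then (-1 : ℤ) else 1)) := by
    unfold Hom.sign
    rw [← Finset.mul_prod_erase _ _ (Finset.mem_univ j),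
      ← Finset.mul_prod_erase Finset.univ
        (fun j => ∏ s ∈ α.set (f.σ j), ∏ t ∈ α.set (f.σ j),
          if s < t ∧ f.u j t < f.u j s then (-1 : ℤ) else 1) (Finset.mem_univ j)]
    have h2 : ∀ k ∈ Finset.univ.erase j, (α.add (f.σ j) s).set (f.σ k) = α.set (f.σ k) :=
      fun k hk => Idx.add_set_ne _ _ (by simpa using Finset.ne_of_mem_erase hk)
    have h3 : ∏ k ∈ Finset.univ.erase j, (∏ x ∈ (α.add (f.σ j) s).set (f.σ k),
          ∏ t ∈ (α.add (f.σ j) s).set (f.σ k), if x < t ∧ f.u k t < f.u k x then (-1 : ℤ) else 1) =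
        ∏ k ∈ Finset.univ.erase j, (∏ x ∈ α.set (f.σ k),
          ∏ t ∈ α.set (f.σ k), if x < t ∧ f.u k t < f.u k x then (-1 : ℤ) else 1) :=
      Finset.prod_congr rfl fun k hk => by rw [h2 k hk]
    rw [h3, Idx.add_set_self]
    simp only [Finset.prod_insert hs, Finset.prod_mul_distrib, lt_self_iff_false, false_and,
      if_false]
    ring
  rw [h1]
  have h4 : (∏ t ∈ α.set (f.σ j), if f.u j t < f.u j s then (-1 : ℤ) else 1) *
      ∏ t ∈ α.set (f.σ j), ((if s < t ∧ f.u j t < f.u j s then (-1 : ℤ) else 1) *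
        (if t < s ∧ f.u j s < f.u j t then (-1 : ℤ) else 1)) =
      ∏ t ∈ α.set (f.σ j), if t < s then (-1 : ℤ) else 1 := by
    rw [← Finset.prod_mul_distrib]
    refine Finset.prod_congr rfl fun t ht => ?_
    have hst : s ≠ t := by rintro rfl; exact hs ht
    have h1 : f.u j s ≠ f.u j t := fun h => hst ((f.u j).injective h)
    rcases lt_or_gt_of_ne hst with a | a <;> rcases lt_or_gt_of_ne h1 with b | b <;>
      simp [a, b, a.not_gt, b.not_gt]
  rw [← h4]
  ring

lemma Hom.incidence_map (f : P ⟶ Q) {α β : P.Idx} (h : α ≤ β) (hd : β.dim = α.dim + 1) :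
    (f.map α).incidence (f.map β) * f.sign β = f.sign α * α.incidence β := by
  obtain ⟨i, s, hs, rfl⟩ := Idx.exists_eq_add h hd
  obtain ⟨j, rfl⟩ := f.σ.surjective i
  exact f.incidence_map_add α hs

end Cube
/-! ### Cubical codiagrams -/

section

variable {D : Type u} [Category.{v} D]

lemma map_le_comp {I : Type*} [Preorder I] (X : I ⥤ D) {α β γ : I} (h : α ≤ β) (h' : β ≤ γ) :
    X.map (homOfLE h) ≫ X.map (homOfLE h') = X.map (homOfLE (h.trans h')) := by
  rw [← X.map_comp]; rfl

lemma map_le_comp_assoc {I : Type*} [Preorder I] (X : I ⥤ D) {α β γ : I} (h : α ≤ β)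
    (h' : β ≤ γ) {Z : D} (g : X.obj γ ⟶ Z) :
    X.map (homOfLE h) ≫ X.map (homOfLE h') ≫ g = X.map (homOfLE (h.trans h')) ≫ g := by
  rw [← Category.assoc, map_le_comp]

lemma map_le_comp' {I : Type*} [Preorder I] (X : I ⥤ D) {α β γ : I} (h : α ≤ β) (h' : β ≤ γ)
    (h'' : α ≤ γ) : X.map (homOfLE h) ≫ X.map (homOfLE h') = X.map (homOfLE h'') :=
  map_le_comp X h h'

lemma map_le_comp'_assoc {I : Type*} [Preorder I] (X : I ⥤ D) {α β γ : I} (h : α ≤ β)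
    (h' : β ≤ γ) (h'' : α ≤ γ) {Z : D} (g : X.obj γ ⟶ Z) :
    X.map (homOfLE h) ≫ X.map (homOfLE h') ≫ g = X.map (homOfLE h'') ≫ g :=
  map_le_comp_assoc X h h' g

lemma map_le_cancel {I : Type*} [Preorder I] (X : I ⥤ D) {α β : I} (h : α ≤ β) (h' : β ≤ α)
    {Z : D} (g : X.obj α ⟶ Z) : X.map (homOfLE h) ≫ X.map (homOfLE h') ≫ g = g := by
  rw [← Category.assoc, map_le_comp]
  exact (congrArg (· ≫ g) (X.map_id α)).trans (Category.id_comp g)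

lemma map_le_refl {I : Type*} [Preorder I] (X : I ⥤ D) {α : I} (h : α ≤ α) :
    X.map (homOfLE h) = 𝟙 _ := X.map_id α

end

/-- A cubical codiagram of `D`: a functor `X : □ ⥤ D` on an object `□` of `Cube`. -/
structure CoDiag (D : Type u) [Category.{v} D] where
  P : Cube
  X : P.Idx ⥤ D

namespace CoDiag

variable {D : Type u} [Category.{v} D]

/-- A morphism `(X, □) ⟶ (Y, □')`: a morphism `δ : □' ⟶ □` together with a natural transformation
`δ^* X ⟶ Y`. -/
structure Hom (K L : CoDiag D) where
  δ : L.P ⟶ K.P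
  a : δ.functor ⋙ K.X ⟶ L.X

/-- The components of a morphism of codiagrams. -/
def Hom.app {K L : CoDiag D} (f : Hom K L) (β : L.P.Idx) :
    K.X.obj (f.δ.map β) ⟶ L.X.obj β := f.a.app β

lemma Hom.naturality {K L : CoDiag D} (f : Hom K L) {α β : L.P.Idx} (h : α ≤ β) :
    K.X.map (homOfLE (f.δ.map_mono h)) ≫ f.app β = f.app α ≫ L.X.map (homOfLE h) :=
  f.a.naturality (homOfLE h)

lemma Hom.naturality_assoc {K L : CoDiag D} (f : Hom K L) {α β : L.P.Idx} (h : α ≤ β) {Z : D}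
    (g : L.X.obj β ⟶ Z) : K.X.map (homOfLE (f.δ.map_mono h)) ≫ f.app β ≫ g =
      f.app α ≫ L.X.map (homOfLE h) ≫ g := by
  rw [← Category.assoc, f.naturality h, Category.assoc]

/-- Constructor for morphisms of codiagrams in terms of their components. -/
abbrev Hom.mk' {K L : CoDiag D} (δ : L.P ⟶ K.P) (app : ∀ β, K.X.obj (δ.map β) ⟶ L.X.obj β)
    (h : ∀ {α β : L.P.Idx} (h : α ≤ β),
      K.X.map (homOfLE (δ.map_mono h)) ≫ app β = app α ≫ L.X.map (homOfLE h)) : Hom K L :=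
  ⟨δ, { app := app, naturality := fun _ _ g => h (leOfHom g) }⟩

lemma Hom.ext' {K L : CoDiag D} {f g : Hom K L} (h : f.δ = g.δ)
    (h' : ∀ β, K.X.map (homOfLE (congrArg (fun d => Cube.Hom.map d β) h).le) ≫ g.app β =
      f.app β) : f = g := by
  obtain ⟨δ, a⟩ := f
  obtain ⟨δ', b⟩ := g
  obtain rfl : δ = δ' := h
  congr 1
  refine NatTrans.ext (funext fun β => ?_)
  have := h' β
  rw [map_le_refl, Category.id_comp] at this
  exact this.symm

lemma Hom.ext_heq {K L : CoDiag D} {f g : Hom K L} (h : f.δ = g.δ)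
    (h' : ∀ β, HEq (f.app β) (g.app β)) : f = g := by
  obtain ⟨δ, a⟩ := f
  obtain ⟨δ', b⟩ := g
  obtain rfl : δ = δ' := h
  congr 1
  exact NatTrans.ext (funext fun β => eq_of_heq (h' β))

/-- The identity of a codiagram. -/
abbrev Hom.id (K : CoDiag D) : Hom K K :=
  Hom.mk' (𝟙 K.P) (fun α => K.X.map (homOfLE (Cube.Hom.map_id α).le))
    (fun _ => by rw [map_le_comp, map_le_comp])

/-- The composition of morphisms of codiagrams. -/
abbrev Hom.comp {K L M : CoDiag D} (f : Hom K L) (g : Hom L M) : Hom K M :=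
  Hom.mk' (g.δ ≫ f.δ)
    (fun γ => K.X.map (homOfLE (Cube.Hom.map_comp g.δ f.δ γ).le) ≫ f.app (g.δ.map γ) ≫ g.app γ)
    (fun h => by
      rw [Category.assoc, Category.assoc, ← g.naturality h,
        ← f.naturality_assoc (g.δ.map_mono h), ← Category.assoc, ← Category.assoc (K.X.map _),
        map_le_comp, map_le_comp])

instance : Category (CoDiag D) where
  Hom := Hom
  id := Hom.id
  comp := Hom.comp
  id_comp {K L} f := Hom.ext_heq rfl fun β => heq_of_eq <| by
    change K.X.map _ ≫ K.X.map _ ≫ f.app β = f.app β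
    exact map_le_cancel K.X _ _ _
  comp_id {K L} f := Hom.ext_heq rfl fun β => heq_of_eq <| by
    change K.X.map _ ≫ f.app _ ≫ L.X.map _ = f.app β
    rw [← f.naturality]
    exact map_le_cancel K.X _ _ _
  assoc {K L M N} f g h := Hom.ext_heq rfl fun β => heq_of_eq <| by
    change K.X.map _ ≫ (K.X.map _ ≫ f.app _ ≫ g.app _) ≫ h.app _ =
      K.X.map _ ≫ f.app _ ≫ L.X.map _ ≫ g.app _ ≫ h.app _
    rw [← f.naturality_assoc, Category.assoc, Category.assoc]
    exact (map_le_comp_assoc K.X _ _ _).trans (map_le_comp_assoc K.X _ _ _).symm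

lemma hom_ext {K L : CoDiag D} {f g : K ⟶ L} (h : Hom.δ f = Hom.δ g)
    (h' : ∀ β, K.X.map (homOfLE (congrArg (fun d => Cube.Hom.map d β) h).le) ≫ Hom.app g β =
      Hom.app f β) : f = g := Hom.ext' h h'

lemma id_app (K : CoDiag D) (α : K.P.Idx) :
    Hom.app (𝟙 K) α = K.X.map (homOfLE (Cube.Hom.map_id α).le) := rfl

lemma comp_app {K L M : CoDiag D} (f : K ⟶ L) (g : L ⟶ M) (γ : M.P.Idx) :
    Hom.app (f ≫ g) γ = K.X.map (homOfLE (Cube.Hom.map_comp g.δ f.δ γ).le) ≫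
        Hom.app f (g.δ.map γ) ≫ Hom.app g γ := rfl

/-- The inclusion of the diagrams of shape `P` into the category of codiagrams. -/
def incl (P : Cube) : (P.Idx ⥤ D) ⥤ CoDiag D where
  obj X := ⟨P, X⟩
  map {X Y} a := Hom.mk' (𝟙 P) (fun α => X.map (homOfLE (Cube.Hom.map_id α).le) ≫ a.app α)
    (fun h => by
      change X.map _ ≫ X.map _ ≫ a.app _ = (X.map _ ≫ a.app _) ≫ Y.map _
      rw [Category.assoc, ← a.naturality, map_le_comp'_assoc X _ _
        ((Cube.Hom.map_id _).le.trans h), map_le_comp'_assoc X _ _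
        ((Cube.Hom.map_id _).le.trans h)])
  map_id X := Hom.ext_heq rfl fun β => heq_of_eq <| by
    exact Category.comp_id _
  map_comp {X Y Z} a b := Hom.ext_heq rfl fun β => heq_of_eq <| by
    change X.map _ ≫ a.app _ ≫ b.app _ = X.map _ ≫ (X.map _ ≫ a.app _) ≫ Y.map _ ≫ b.app _
    rw [Category.assoc, ← a.naturality_assoc]
    exact (map_le_cancel X _ _ _).symm

/-- Restriction along a morphism `δ : □' ⟶ □`, as a morphism `(X, □) ⟶ (δ^* X, □')`. -/
def restrict {P Q : Cube} (δ : Q ⟶ P) (X : P.Idx ⥤ D) :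
    (⟨P, X⟩ : CoDiag D) ⟶ ⟨Q, δ.functor ⋙ X⟩ :=
  Hom.mk (K := ⟨P, X⟩) (L := ⟨Q, δ.functor ⋙ X⟩) δ (𝟙 _)

/-- Composition with a functor. -/
def mapFunctor {D' : Type*} [Category* D'] (F : D ⥤ D') : CoDiag D ⥤ CoDiag D' where
  obj K := ⟨K.P, K.X ⋙ F⟩
  map {K L} f := Hom.mk (K := ⟨K.P, K.X ⋙ F⟩) (L := ⟨L.P, L.X ⋙ F⟩) f.δ
    (Functor.whiskerRight f.a F)
  map_id K := Hom.ext_heq rfl fun β => heq_of_eq <| by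
    rfl
  map_comp {K L M} f g := Hom.ext_heq rfl fun β => heq_of_eq <| by
    change F.map (_ ≫ f.app _ ≫ g.app _) = F.map _ ≫ F.map (f.app _) ≫ F.map (g.app _)
    exact (F.map_comp _ _).trans (congrArg (F.map _ ≫ ·) (F.map_comp _ _))

end CoDiag

/-! ### The simple complex of a codiagram of complexes -/

section Simple

variable {B : Type u} [Category.{v} B] [Preadditive B]

/-- The canonical isomorphism `L^i ⟶ L^j` if `i = j`, and zero otherwise. -/
def degCast (L : CochainComplex B ℤ) (i j : ℤ) : L.X i ⟶ L.X j :=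
  if h : i = j then (L.XIsoOfEq h).hom else 0

lemma degCast_self (L : CochainComplex B ℤ) (i : ℤ) : degCast L i i = 𝟙 _ := by
  simp [degCast]

lemma degCast_eq_zero (L : CochainComplex B ℤ) {i j : ℤ} (h : i ≠ j) : degCast L i j = 0 := by
  simp [degCast, h]

lemma degCast_comm {K L : CochainComplex B ℤ} (f : K ⟶ L) (i j : ℤ) :
    f.f i ≫ degCast L i j = degCast K i j ≫ f.f j := by
  by_cases h : i = j
  · subst h; simp [degCast_self]
  · simp [degCast_eq_zero _ h]

lemma degCast_trans (L : CochainComplex B ℤ) {i j : ℤ} (h : i = j) (k : ℤ) :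
    degCast L i j ≫ degCast L j k = degCast L i k := by
  subst h; simp [degCast_self]

/-- The part of the differential of the simple complex that acts in the complex `L`, from
the summand of `α` to the summand of `β`. -/
def cubeDiff {P : Cube} (L : CochainComplex B ℤ) (α β : P.Idx) (i j : ℤ) : L.X i ⟶ L.X j :=
  ((-1 : ℤ) ^ α.dim) • L.d i j + α.incidence β • degCast L i j

lemma cubeDiff_comm {P : Cube} {K L : CochainComplex B ℤ} (f : K ⟶ L) (α β : P.Idx) (i j : ℤ) :
    f.f i ≫ cubeDiff L α β i j = cubeDiff K α β i j ≫ f.f j := by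
  simp only [cubeDiff, Preadditive.comp_add, Preadditive.add_comp, Preadditive.comp_zsmul,
    Preadditive.zsmul_comp, HomologicalComplex.Hom.comm, degCast_comm]

lemma cubeDiff_comp {P : Cube} (L : CochainComplex B ℤ) (α β γ : P.Idx) (i j k : ℤ) :
    cubeDiff L α β i j ≫ cubeDiff L β γ j k =
      (if j = k then ((-1 : ℤ) ^ α.dim * β.incidence γ) • L.d i k else 0) +
      (if i = j then ((-1 : ℤ) ^ β.dim * α.incidence β) • L.d i k else 0) +
      (if i = j then (α.incidence β * β.incidence γ) • degCast L i k else 0) := by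
  have h1 : L.d i j ≫ degCast L j k = if j = k then L.d i k else 0 := by
    split_ifs with h
    · subst h; simp [degCast_self]
    · simp [degCast_eq_zero _ h]
  have h2 : degCast L i j ≫ L.d j k = if i = j then L.d i k else 0 := by
    split_ifs with h
    · subst h; simp [degCast_self]
    · simp [degCast_eq_zero _ h]
  have h3 : degCast L i j ≫ degCast L j k = if i = j then degCast L i k else 0 := by
    split_ifs with h
    · subst h; simp [degCast_self]
    · simp [degCast_eq_zero _ h]
  simp only [cubeDiff, Preadditive.comp_add, Preadditive.add_comp, Preadditive.comp_zsmul,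
    Preadditive.zsmul_comp, HomologicalComplex.d_comp_d, smul_zero, zero_add, smul_smul, h1, h2,
    h3]
  split_ifs <;> module

open Classical in
lemma sum_cubeDiff {P : Cube} (L : CochainComplex B ℤ) {α γ : P.Idx} (h : α ≤ γ) (n : ℤ) :
    ∑ β : P.Idx with α ≤ β ∧ β ≤ γ,
      cubeDiff L α β (n - α.dim) (n + 1 - β.dim) ≫
        cubeDiff L β γ (n + 1 - β.dim) (n + 1 + 1 - γ.dim) = 0 := by
  simp only [cubeDiff_comp]
  by_cases h1 : γ.dim = α.dim + 1
  · have hne : α ≠ γ := by rintro rfl; omega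
    have hs : (Finset.univ.filter fun β : P.Idx => α ≤ β ∧ β ≤ γ) = {α, γ} := by
      ext β
      simp only [Finset.mem_filter, Finset.mem_univ, true_and, Finset.mem_insert,
        Finset.mem_singleton]
      constructor
      · rintro ⟨ha, hb⟩
        have d1 := Cube.Idx.dim_mono ha
        have d2 := Cube.Idx.dim_mono hb
        by_cases hd : β.dim = α.dim
        · exact Or.inl (Cube.Idx.eq_of_le_of_dim_le ha hd.le).symm
        · exact Or.inr (Cube.Idx.eq_of_le_of_dim_le hb (by omega))
      · rintro (rfl | rfl)
        · exact ⟨le_rfl, h⟩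
        · exact ⟨h, le_rfl⟩
    rw [hs, Finset.sum_pair hne, if_pos (by omega), if_neg (by omega), if_neg (by omega),
      if_neg (by omega), if_pos (by omega), if_pos (by omega),
      degCast_eq_zero L (i := n - (α.dim : ℤ)) (j := n + 1 + 1 - (γ.dim : ℤ)) (by omega), h1,
      pow_succ]
    simp
  by_cases h2 : γ.dim = α.dim + 2
  · have hd : L.d (n - (α.dim : ℤ)) (n + 1 + 1 - (γ.dim : ℤ)) = 0 :=
      L.shape _ _ (by simp; omega)
    simp only [hd, smul_zero, ite_self, zero_add]
    rw [← Finset.sum_filter, Finset.filter_filter, ← Finset.sum_smul]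
    have := Cube.Idx.sum_incidence h h2
    convert zero_smul ℤ _ using 2
    rw [← this]
    refine Finset.sum_congr ?_ fun _ _ => rfl
    ext β
    simp only [Finset.mem_filter, Finset.mem_univ, true_and]
    constructor
    · rintro ⟨ha, hb⟩; exact ⟨ha, by omega⟩
    · rintro ⟨ha, hb⟩; exact ⟨ha, by omega⟩
  · refine Finset.sum_eq_zero fun β _ => ?_
    have hd : L.d (n - (α.dim : ℤ)) (n + 1 + 1 - (γ.dim : ℤ)) = 0 :=
      L.shape _ _ (by simp; omega)
    rw [hd, degCast_eq_zero L (by omega)]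
    simp

lemma cubeDiff_map {P Q : Cube} (δ : Q ⟶ P) (L : CochainComplex B ℤ) {β γ : Q.Idx} (h : β ≤ γ)
    (n : ℤ) :
    δ.sign β • (degCast L (n - (δ.map β).dim) (n - β.dim) ≫
      cubeDiff L β γ (n - β.dim) (n + 1 - γ.dim)) =
    δ.sign γ • (cubeDiff L (δ.map β) (δ.map γ) (n - (δ.map β).dim) (n + 1 - (δ.map γ).dim) ≫
      degCast L (n + 1 - (δ.map γ).dim) (n + 1 - γ.dim)) := by
  have hi : n - ((δ.map β).dim : ℤ) = n - β.dim := by rw [Cube.Hom.dim_map]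
  have hj : n + 1 - ((δ.map γ).dim : ℤ) = n + 1 - γ.dim := by rw [Cube.Hom.dim_map]
  unfold cubeDiff
  rw [Cube.Hom.dim_map]
  generalize n - ((δ.map β).dim : ℤ) = i at hi ⊢
  generalize n + 1 - ((δ.map γ).dim : ℤ) = j at hj ⊢
  subst hi hj
  simp only [degCast_self, Category.id_comp, Category.comp_id, smul_add, smul_smul]
  congr 1
  · by_cases hd : γ.dim = β.dim
    · obtain rfl := Cube.Idx.eq_of_le_of_dim_le h hd.le
      rfl
    · have d1 := Cube.Idx.dim_mono h
      rw [L.shape _ _ (by simp; omega), smul_zero, smul_zero]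
  · by_cases hd : γ.dim = β.dim + 1
    · rw [← δ.incidence_map h hd, mul_comm]
    · rw [degCast_eq_zero _ (by omega), smul_zero, smul_zero]

open Classical in
/-- The component from the summand of `α` in degree `n` to the summand of `β` in degree `m = n + 1`
of the differential of the simple complex. It is `(-1)^|α|` times the differential of `X α` if
`β = α`, it is the structure map `X α ⟶ X β` with the incidence sign if `α ≤ β` has codimension one,
and it vanishes for degree reasons in all other cases. -/
def simpleEntry {P : Cube} (X : P.Idx ⥤ CochainComplex B ℤ) (n m : ℤ) (α β : P.Idx) :
    (X.obj α).X (n - α.dim) ⟶ (X.obj β).X (m - β.dim) :=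
  if h : α ≤ β then
    (X.map (homOfLE h)).f (n - α.dim) ≫ cubeDiff (X.obj β) α β (n - α.dim) (m - β.dim)
  else 0

open Classical in
lemma simpleEntry_sq {P : Cube} (X : P.Idx ⥤ CochainComplex B ℤ) (n : ℤ) (α γ : P.Idx) :
    ∑ β, simpleEntry X n (n + 1) α β ≫ simpleEntry X (n + 1) (n + 1 + 1) β γ = 0 := by
  by_cases hαγ : α ≤ γ
  swap
  · refine Finset.sum_eq_zero fun β _ => ?_
    unfold simpleEntry
    by_cases h1 : α ≤ β
    · rw [dif_neg fun h2 : β ≤ γ => hαγ (h1.trans h2), comp_zero]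
    · rw [dif_neg h1, zero_comp]
  have key : ∀ β, simpleEntry X n (n + 1) α β ≫ simpleEntry X (n + 1) (n + 1 + 1) β γ =
      (X.map (homOfLE hαγ)).f (n - α.dim) ≫ (if α ≤ β ∧ β ≤ γ then
        cubeDiff (X.obj γ) α β (n - α.dim) (n + 1 - β.dim) ≫
        cubeDiff (X.obj γ) β γ (n + 1 - β.dim) (n + 1 + 1 - γ.dim) else 0) := by
    intro β
    unfold simpleEntry
    by_cases h1 : α ≤ β
    · by_cases h2 : β ≤ γ
      · rw [dif_pos h1, dif_pos h2, if_pos ⟨h1, h2⟩, ← map_le_comp X h1 h2,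
          HomologicalComplex.comp_f, Category.assoc, Category.assoc,
          reassoc_of% (cubeDiff_comm (X.map (homOfLE h2)))]
      · rw [dif_neg h2, if_neg (by tauto)]; simp
    · rw [dif_neg h1, if_neg (by tauto)]; simp
  simp only [key]
  rw [← Preadditive.comp_sum, ← Finset.sum_filter, sum_cubeDiff _ hαγ, comp_zero]

open Classical in
/-- The component, from the summand of `α` to the summand of `β`, of the morphism of simple
complexes induced by a morphism of codiagrams. -/
def simpleMapEntry {K L : CoDiag (CochainComplex B ℤ)} (f : K ⟶ L) (n : ℤ) (α : K.P.Idx)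
    (β : L.P.Idx) : (K.X.obj α).X (n - α.dim) ⟶ (L.X.obj β).X (n - β.dim) :=
  if h : α = (CoDiag.Hom.δ f).map β then
    (CoDiag.Hom.δ f).sign β • ((K.X.map (homOfLE h.le) ≫ CoDiag.Hom.app f β).f (n - α.dim) ≫
      degCast (L.X.obj β) (n - α.dim) (n - β.dim))
  else 0

lemma simpleMapEntry_comm {K L : CoDiag (CochainComplex B ℤ)} (f : K ⟶ L) (n : ℤ) (α : K.P.Idx)
    (γ : L.P.Idx) :
    ∑ β, simpleMapEntry f n α β ≫ simpleEntry L.X n (n + 1) β γ =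
      ∑ α', simpleEntry K.X n (n + 1) α α' ≫ simpleMapEntry f (n + 1) α' γ := by
  obtain ⟨δ, a⟩ := f
  set f : CoDiag.Hom K L := ⟨δ, a⟩ with hf
  have hR : ∀ α' ∈ Finset.univ, α' ≠ δ.map γ →
      simpleEntry K.X n (n + 1) α α' ≫ simpleMapEntry f (n + 1) α' γ = 0 := by
    intro α' _ h
    rw [simpleMapEntry, dif_neg h, comp_zero]
  rw [Finset.sum_eq_single (δ.map γ) hR (by simp)]
  by_cases h : α ≤ δ.map γ
  · obtain ⟨β, hβ, rfl⟩ := δ.exists_of_le_map h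
    rw [Finset.sum_eq_single β]
    · unfold simpleMapEntry simpleEntry
      rw [dif_pos rfl, dif_pos h, dif_pos hβ, dif_pos rfl]
      have e1 : (K.X.map (homOfLE le_rfl) ≫ f.app β) ≫ L.X.map (homOfLE hβ) =
          K.X.map (homOfLE h) ≫ f.app γ := by
        rw [map_le_refl, Category.id_comp]
        exact (f.naturality hβ).symm
      have e2 : K.X.map (homOfLE (le_refl (δ.map γ))) ≫ f.app γ = f.app γ := by
        rw [map_le_refl]; exact Category.id_comp _
      have e3 := cubeDiff_map δ (L.X.obj γ) hβ n
      have l1 : (δ.sign β • ((K.X.map (homOfLE le_rfl) ≫ f.app β).f (n - (δ.map β).dim) ≫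
          degCast (L.X.obj β) (n - (δ.map β).dim) (n - β.dim))) ≫
          (L.X.map (homOfLE hβ)).f (n - β.dim) ≫
            cubeDiff (L.X.obj γ) β γ (n - β.dim) (n + 1 - γ.dim) =
          (K.X.map (homOfLE h) ≫ f.app γ).f (n - (δ.map β).dim) ≫
            (δ.sign β • (degCast (L.X.obj γ) (n - (δ.map β).dim) (n - β.dim) ≫
              cubeDiff (L.X.obj γ) β γ (n - β.dim) (n + 1 - γ.dim))) := by
        rw [← e1, HomologicalComplex.comp_f _ (L.X.map (homOfLE hβ)), Preadditive.zsmul_comp,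
          Preadditive.comp_zsmul, Category.assoc, Category.assoc,
          reassoc_of% (degCast_comm (L.X.map (homOfLE hβ)))]
      have l2 : ((K.X.map (homOfLE h)).f (n - (δ.map β).dim) ≫
          cubeDiff (K.X.obj (δ.map γ)) (δ.map β) (δ.map γ) (n - (δ.map β).dim)
            (n + 1 - (δ.map γ).dim)) ≫
          (δ.sign γ • ((K.X.map (homOfLE le_rfl) ≫ f.app γ).f (n + 1 - (δ.map γ).dim) ≫
            degCast (L.X.obj γ) (n + 1 - (δ.map γ).dim) (n + 1 - γ.dim))) =
          (K.X.map (homOfLE h) ≫ f.app γ).f (n - (δ.map β).dim) ≫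
            (δ.sign γ • (cubeDiff (L.X.obj γ) (δ.map β) (δ.map γ) (n - (δ.map β).dim)
              (n + 1 - (δ.map γ).dim) ≫
                degCast (L.X.obj γ) (n + 1 - (δ.map γ).dim) (n + 1 - γ.dim))) := by
        rw [e2, HomologicalComplex.comp_f, Preadditive.comp_zsmul, Preadditive.comp_zsmul,
          Category.assoc, Category.assoc, reassoc_of% (cubeDiff_comm (f.app γ))]
      exact l1.trans ((congrArg _ e3).trans l2.symm)
    · intro β' _ hne
      rw [simpleMapEntry, dif_neg fun e => hne (δ.map_injective e).symm, zero_comp]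
    · simp
  · rw [simpleEntry, dif_neg h, zero_comp]
    refine Finset.sum_eq_zero fun β _ => ?_
    by_cases h1 : α = δ.map β
    · rw [simpleEntry, dif_neg, comp_zero]
      rintro h2
      exact h (h1 ▸ δ.map_mono h2)
    · rw [simpleMapEntry, dif_neg h1, zero_comp]

lemma simpleMapEntry_id (K : CoDiag (CochainComplex B ℤ)) (n : ℤ) (α : K.P.Idx) :
    simpleMapEntry (𝟙 K) n α α = 𝟙 _ := by
  have e : K.X.map (homOfLE (Cube.Hom.map_id α).ge) ≫
      K.X.map (homOfLE (Cube.Hom.map_id α).le) = 𝟙 _ :=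
    (map_le_comp _ _ _).trans (map_le_refl _ _)
  refine (dif_pos (Cube.Hom.map_id α).symm).trans ?_
  change Cube.Hom.sign (𝟙 K.P) α • ((K.X.map (homOfLE (Cube.Hom.map_id α).ge) ≫
      K.X.map (homOfLE (Cube.Hom.map_id α).le)).f _ ≫ _) = _
  rw [e, Cube.Hom.sign_id, degCast_self, one_smul, Category.comp_id]
  rfl

lemma simpleMapEntry_comp {K L M : CoDiag (CochainComplex B ℤ)} (f : K ⟶ L) (g : L ⟶ M) (n : ℤ)
    (α : K.P.Idx) (γ : M.P.Idx) :
    simpleMapEntry (f ≫ g) n α γ = ∑ β, simpleMapEntry f n α β ≫ simpleMapEntry g n β γ := by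
  rw [Finset.sum_eq_single ((CoDiag.Hom.δ g).map γ)]
  rotate_left
  · intro β _ h
    rw [simpleMapEntry, simpleMapEntry, dif_neg h, comp_zero]
  · simp
  by_cases h : α = (CoDiag.Hom.δ f).map ((CoDiag.Hom.δ g).map γ)
  · subst h
    refine (dif_pos (Cube.Hom.map_comp _ _ γ).symm).trans ?_
    rw [simpleMapEntry, simpleMapEntry, dif_pos rfl, dif_pos rfl]
    have e1 : K.X.map (homOfLE (Cube.Hom.map_comp (CoDiag.Hom.δ g) (CoDiag.Hom.δ f) γ).ge) ≫
        CoDiag.Hom.app (f ≫ g) γ = CoDiag.Hom.app f _ ≫ CoDiag.Hom.app g γ :=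
      map_le_cancel K.X _ _ _
    have e2 : Cube.Hom.sign (CoDiag.Hom.δ (f ≫ g)) γ =
        (CoDiag.Hom.δ f).sign ((CoDiag.Hom.δ g).map γ) * (CoDiag.Hom.δ g).sign γ :=
      (Cube.Hom.sign_comp _ _ _).trans (mul_comm _ _)
    rw [map_le_refl, Category.id_comp, map_le_refl, Category.id_comp]
    refine (congrArg₂ (fun (x : ℤ) (y : K.X.obj _ ⟶ M.X.obj _) => x • (y.f _ ≫ degCast _ _ _))
      e2 e1).trans ?_
    rw [Preadditive.zsmul_comp, Preadditive.comp_zsmul, smul_smul, Category.assoc,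
      ← reassoc_of% (degCast_comm (CoDiag.Hom.app g γ)), HomologicalComplex.comp_f,
      Category.assoc, degCast_trans _ (by rw [Cube.Hom.dim_map])]
  · rw [simpleMapEntry, simpleMapEntry, dif_neg h, zero_comp, dif_neg]
    exact fun e => h (e.trans (Cube.Hom.map_comp _ _ γ))

variable [HasFiniteBiproducts B]

lemma matrix_comp {I J K : Type} [Fintype I] [Fintype J] [Fintype K] {f : I → B} {g : J → B}
    {h : K → B} (m : ∀ i j, f i ⟶ g j) (m' : ∀ j k, g j ⟶ h k) :
    biproduct.matrix m ≫ biproduct.matrix m' =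
      biproduct.matrix fun i k => ∑ j, m i j ≫ m' j k := by
  ext k i
  simp [biproduct.lift_desc]

lemma matrix_id {I : Type} [Fintype I] [DecidableEq I] {f : I → B} (m : ∀ i j, f i ⟶ f j)
    (h1 : ∀ i, m i i = 𝟙 _) (h2 : ∀ i j, i ≠ j → m i j = 0) :
    biproduct.matrix m = 𝟙 (⨁ f) := by
  ext i j
  by_cases h : i = j
  · subst h; simp [h1]
  · simp [h2 _ _ (Ne.symm h), biproduct.ι_π_ne _ (Ne.symm h)]

/-- The simple complex of a functor `X : □ ⥤ C(B)`: in degree `n` it is `⨁ α, X(α)^(n - |α|)`. -/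
def simpleComplex {P : Cube} (X : P.Idx ⥤ CochainComplex B ℤ) : CochainComplex B ℤ where
  X n := ⨁ fun α : P.Idx => (X.obj α).X (n - α.dim)
  d n m := if n + 1 = m then biproduct.matrix (simpleEntry X n m) else 0
  shape n m h := if_neg h
  d_comp_d' n m l h h' := by
    obtain rfl : n + 1 = m := h
    obtain rfl : n + 1 + 1 = l := h'
    rw [if_pos rfl, if_pos rfl, matrix_comp]
    ext
    simp [simpleEntry_sq]

/-- The morphism of simple complexes induced by a morphism of codiagrams. -/
def simpleMap {K L : CoDiag (CochainComplex B ℤ)} (f : K ⟶ L) :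
    simpleComplex K.X ⟶ simpleComplex L.X where
  f n := biproduct.matrix (simpleMapEntry f n)
  comm' n m h := by
    obtain rfl : n + 1 = m := h
    simp only [simpleComplex, if_true]
    rw [matrix_comp, matrix_comp]
    congr 1
    funext α γ
    exact simpleMapEntry_comm f n α γ

/-- The simple functor on cubical codiagrams of complexes. -/
def simpleFunctor (B : Type u) [Category.{v} B] [Preadditive B] [HasFiniteBiproducts B] :
    CoDiag (CochainComplex B ℤ) ⥤ CochainComplex B ℤ where
  obj K := simpleComplex K.X
  map f := simpleMap f
  map_id K := by
    ext n : 1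
    refine matrix_id _ (simpleMapEntry_id K n) (fun α β h => ?_)
    exact dif_neg fun e => h (e.trans (Cube.Hom.map_id β))
  map_comp f g := by
    ext n : 1
    refine Eq.trans ?_ (matrix_comp _ _).symm
    exact congrArg (biproduct.matrix ·)
      (funext fun α => funext fun γ => simpleMapEntry_comp f g n α γ)

end Simple

set_option linter.unusedSectionVars false

/-! ### Filtered complexes -/

/-- The morphism `f : X ⟶ Y` sends the subobject `S` of `X` into the subobject `T` of `Y`. -/
def MapsTo {A : Type u} [Category.{v} A] {X Y : A} (S : Subobject X) (f : X ⟶ Y)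
    (T : Subobject Y) : Prop :=
  T.Factors (S.arrow ≫ f)

namespace MapsTo

section

variable {A : Type u} [Category.{v} A] {X Y Z : A}

lemma comp {S : Subobject X} {f : X ⟶ Y} {T : Subobject Y} {g : Y ⟶ Z} {U : Subobject Z}
    (h : MapsTo S f T) (h' : MapsTo T g U) : MapsTo S (f ≫ g) U := by
  unfold MapsTo at *
  rw [← Category.assoc, ← T.factorThru_arrow _ h, Category.assoc]
  exact Subobject.factors_of_factors_right _ h'

lemma of_le {S T : Subobject X} (h : S ≤ T) : MapsTo S (𝟙 X) T := by
  unfold MapsTo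
  rw [Category.comp_id]
  exact Subobject.factors_of_le _ h (Subobject.factors_self _)

lemma le_right {S : Subobject X} {f : X ⟶ Y} {T T' : Subobject Y} (h : MapsTo S f T)
    (h' : T ≤ T') : MapsTo S f T' :=
  Subobject.factors_of_le _ h' h

lemma le_left {S S' : Subobject X} {f : X ⟶ Y} {T : Subobject Y} (h : MapsTo S f T)
    (h' : S' ≤ S) : MapsTo S' f T := by
  have := (of_le h').comp h
  rwa [Category.id_comp] at this

end

section

variable {A : Type u} [Category.{v} A] [Preadditive A] {X Y : A} {S : Subobject X}
  {T : Subobject Y}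

lemma zero : MapsTo S (0 : X ⟶ Y) T := by
  unfold MapsTo
  rw [comp_zero]
  exact Subobject.factors_zero

lemma add {f g : X ⟶ Y} (hf : MapsTo S f T) (hg : MapsTo S g T) : MapsTo S (f + g) T := by
  unfold MapsTo
  rw [Preadditive.comp_add]
  exact Subobject.factors_add _ _ hf hg

lemma zsmul {f : X ⟶ Y} (n : ℤ) (hf : MapsTo S f T) : MapsTo S (n • f) T := by
  unfold MapsTo
  have : S.arrow ≫ (n • f) = (n • 𝟙 _) ≫ S.arrow ≫ f := by simp
  rw [this]
  exact Subobject.factors_of_factors_right _ hf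

lemma neg {f : X ⟶ Y} (hf : MapsTo S f T) : MapsTo S (-f) T := by
  have := hf.zsmul (-1)
  rwa [neg_one_zsmul] at this

lemma sum {I : Type*} (s : Finset I) (f : I → (X ⟶ Y)) (h : ∀ i ∈ s, MapsTo S (f i) T) :
    MapsTo S (∑ i ∈ s, f i) T := by
  classical
  induction s using Finset.induction_on with
  | empty => simpa using zero
  | insert i s hi ih =>
    rw [Finset.sum_insert hi]
    exact (h i (Finset.mem_insert_self _ _)).add (ih fun j hj => h j (Finset.mem_insert_of_mem hj))

end

end MapsTo

/-- A filtered object of `A`: an object with an increasing filtration indexed by `ℤ`. -/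
structure FiltObj (A : Type u) [Category.{v} A] where
  X : A
  W : ℤ → Subobject X
  mono : Monotone W

namespace FiltObj

variable {A : Type u} [Category.{v} A]

/-- A morphism of filtered objects. -/
@[ext] structure Hom (X Y : FiltObj A) where
  f : X.X ⟶ Y.X
  mapsTo : ∀ p, MapsTo (X.W p) f (Y.W p)

instance : Category (FiltObj A) where
  Hom := Hom
  id X := ⟨𝟙 _, fun _ => MapsTo.of_le le_rfl⟩
  comp {X Y Z} f g := ⟨f.f ≫ g.f, fun p => (f.mapsTo p).comp (g.mapsTo p)⟩

@[ext] lemma hom_ext {X Y : FiltObj A} {f g : X ⟶ Y} (h : Hom.f f = Hom.f g) : f = g :=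
  Hom.ext h

@[simp] lemma id_f (X : FiltObj A) : Hom.f (𝟙 X) = 𝟙 X.X := rfl

@[simp] lemma comp_f {X Y Z : FiltObj A} (f : X ⟶ Y) (g : Y ⟶ Z) :
    Hom.f (f ≫ g) = Hom.f f ≫ Hom.f g := rfl

section Preadditive

variable [Preadditive A]

instance (X Y : FiltObj A) : Zero (X ⟶ Y) := ⟨⟨0, fun _ => MapsTo.zero⟩⟩

instance (X Y : FiltObj A) : Add (X ⟶ Y) :=
  ⟨fun f g => ⟨Hom.f f + Hom.f g, fun p => (Hom.mapsTo f p).add (Hom.mapsTo g p)⟩⟩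

instance (X Y : FiltObj A) : Neg (X ⟶ Y) := ⟨fun f => ⟨-Hom.f f, fun p => (Hom.mapsTo f p).neg⟩⟩

@[simp] lemma zero_f (X Y : FiltObj A) : Hom.f (0 : X ⟶ Y) = 0 := rfl

@[simp] lemma add_f {X Y : FiltObj A} (f g : X ⟶ Y) : Hom.f (f + g) = Hom.f f + Hom.f g := rfl

@[simp] lemma neg_f {X Y : FiltObj A} (f : X ⟶ Y) : Hom.f (-f) = -Hom.f f := rfl

instance (X Y : FiltObj A) : AddCommGroup (X ⟶ Y) where
  add_assoc f g h := hom_ext (add_assoc _ _ _)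
  zero_add f := hom_ext (zero_add _)
  add_zero f := hom_ext (add_zero _)
  add_comm f g := hom_ext (add_comm _ _)
  neg_add_cancel f := hom_ext (neg_add_cancel _)
  nsmul := nsmulRec
  zsmul := zsmulRec

instance : Preadditive (FiltObj A) where
  add_comp _ _ _ f g h := hom_ext (Preadditive.add_comp _ _ _ _ _ _)
  comp_add _ _ _ f g h := hom_ext (Preadditive.comp_add _ _ _ _ _ _)

/-- The functor that forgets the filtration. -/
@[simps] def forget (A : Type u) [Category.{v} A] : FiltObj A ⥤ A where
  obj X := X.X
  map f := Hom.f f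

instance : (forget A).Additive where

end Preadditive

end FiltObj

section Filtered

attribute [local instance] Abelian.hasFiniteBiproducts

variable (A : Type u) [Category.{v} A] [Abelian A]

/-- The category of filtered complexes of `A`. -/
abbrev FiltComplex : Type (max u v) := CochainComplex (FiltObj A) ℤ

variable {A}

/-- The functor that forgets the filtrations of filtered complexes. -/
abbrev forgetComplex : FiltComplex A ⥤ CochainComplex A ℤ :=
  (FiltObj.forget A).mapHomologicalComplex (ComplexShape.up ℤ)

/-- The direct sum `⨁ i, V i` of subobjects `V i` of `f i`, as a subobject of `⨁ i, f i`: it consists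
of the elements whose components lie in the `V i`. -/
def directSum {I : Type} [Fintype I] {f : I → A} (V : ∀ i, Subobject (f i)) : Subobject (⨁ f) :=
  Finset.univ.inf fun i => (Subobject.pullback (biproduct.π f i)).obj (V i)

lemma directSum_factors {I : Type} [Fintype I] {f : I → A} (V : ∀ i, Subobject (f i)) {T : A}
    (g : T ⟶ ⨁ f) : (directSum V).Factors g ↔ ∀ i, (V i).Factors (g ≫ biproduct.π f i) := by
  unfold directSum
  rw [Subobject.finset_inf_factors]
  simp only [pullback_factors_iff, Finset.mem_univ, true_imp_iff]

lemma directSum_mono {I : Type} [Fintype I] {f : I → A} {V V' : ∀ i, Subobject (f i)}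
    (h : ∀ i, V i ≤ V' i) : directSum V ≤ directSum V' := by
  refine Subobject.le_of_factors ((directSum_factors _ _).2 fun i => ?_)
  exact Subobject.factors_of_le _ (h i)
    ((directSum_factors V _).1 (Subobject.factors_self _) i)

lemma mapsTo_directSum {I J : Type} [Fintype I] [Fintype J] {f : I → A} {g : J → A}
    {V : ∀ i, Subobject (f i)} {V' : ∀ j, Subobject (g j)} (M : ∀ i j, f i ⟶ g j)
    (hM : ∀ i j, MapsTo (V i) (M i j) (V' j)) :
    MapsTo (directSum V) (biproduct.matrix M) (directSum V') := by
  refine (directSum_factors _ _).2 fun j => ?_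
  have h : biproduct.matrix M ≫ biproduct.π g j = ∑ i, biproduct.π f i ≫ M i j := by
    classical
    rw [biproduct.matrix_π]
    ext i
    rw [Preadditive.comp_sum, biproduct.ι_desc, Finset.sum_eq_single i]
    · rw [biproduct.ι_π_self_assoc]
    · intro b _ hb
      rw [biproduct.ι_π_ne_assoc _ (Ne.symm hb), zero_comp]
    · simp
  rw [Category.assoc, h]
  refine MapsTo.sum Finset.univ _ fun i _ => MapsTo.comp ?_ (hM i j)
  exact (directSum_factors V _).1 (Subobject.factors_self _) i

lemma mapsTo_degCast (K : FiltComplex A) (i j p : ℤ) :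
    MapsTo ((K.X i).W p) (degCast (forgetComplex.obj K) i j) ((K.X j).W p) := by
  by_cases h : i = j
  · subst h
    rw [degCast_self]
    exact MapsTo.of_le le_rfl
  · rw [degCast_eq_zero _ h]
    exact MapsTo.zero

/-- The filtration of the `r`-simple: `W(r)_p = ⨁ α, W_(p + r|α|) X(α)^(n - |α|)`. -/
def simpleW (r : ℕ) {P : Cube} (X : P.Idx ⥤ FiltComplex A) (n p : ℤ) :
    Subobject ((simpleComplex (X ⋙ forgetComplex)).X n) :=
  directSum (f := fun α : P.Idx => ((X ⋙ forgetComplex).obj α).X (n - α.dim))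
    fun α => ((X.obj α).X (n - α.dim)).W (p + r * α.dim)

lemma simpleW_mono (r : ℕ) {P : Cube} (X : P.Idx ⥤ FiltComplex A) (n : ℤ) :
    Monotone (simpleW r X n) :=
  fun p q h => directSum_mono fun α => ((X.obj α).X (n - α.dim)).mono
    (show p + r * α.dim ≤ q + r * α.dim by omega)

lemma mapsTo_simpleEntry (r : ℕ) {P : Cube} (X : P.Idx ⥤ FiltComplex A) (n m p : ℤ)
    (α β : P.Idx) :
    MapsTo (((X.obj α).X (n - α.dim)).W (p + r * α.dim))
      (simpleEntry (X ⋙ forgetComplex) n m α β)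
      (((X.obj β).X (m - β.dim)).W (p + r * β.dim)) := by
  unfold simpleEntry
  split_ifs with h
  · have h1 : (r : ℤ) * α.dim ≤ r * β.dim :=
      mul_le_mul_of_nonneg_left (by exact_mod_cast Cube.Idx.dim_mono h) (by positivity)
    refine MapsTo.le_right (T := ((X.obj β).X (m - β.dim)).W (p + r * α.dim)) ?_
      (((X.obj β).X (m - β.dim)).mono (by omega))
    exact MapsTo.comp (((X.map (homOfLE h)).f (n - α.dim)).mapsTo _)
      (MapsTo.add (MapsTo.zsmul _ (((X.obj β).d _ _).mapsTo _))
        (MapsTo.zsmul _ (mapsTo_degCast _ _ _ _)))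
  · exact MapsTo.zero

lemma mapsTo_simpleMapEntry (r : ℕ) {K L : CoDiag (FiltComplex A)} (f : K ⟶ L) (n p : ℤ)
    (α : K.P.Idx) (β : L.P.Idx) :
    MapsTo (((K.X.obj α).X (n - α.dim)).W (p + r * α.dim))
      (simpleMapEntry ((CoDiag.mapFunctor forgetComplex).map f) n α β)
      (((L.X.obj β).X (n - β.dim)).W (p + r * β.dim)) := by
  unfold simpleMapEntry
  split_ifs with h
  · have h0 : α.dim = β.dim := (congrArg _ h).trans (Cube.Hom.dim_map _ _)
    refine MapsTo.zsmul _ (MapsTo.comp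
      ((((K.X.map (homOfLE (le_of_eq h)) ≫ CoDiag.Hom.app f β).f (n - α.dim)).mapsTo _)) ?_)
    exact MapsTo.le_right (mapsTo_degCast _ _ _ _)
      (((L.X.obj β).X (n - β.dim)).mono (by rw [h0]))
  · exact MapsTo.zero

/-- The `r`-simple of a functor `X : □ ⥤ C(FA)`: the simple complex with the filtration `W(r)`. -/
def rSimpleComplex (r : ℕ) {P : Cube} (X : P.Idx ⥤ FiltComplex A) : FiltComplex A where
  X n := ⟨(simpleComplex (X ⋙ forgetComplex)).X n, simpleW r X n, simpleW_mono r X n⟩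
  d n m := ⟨(simpleComplex (X ⋙ forgetComplex)).d n m, fun p => by
    by_cases h : n + 1 = m
    · simp only [simpleComplex, if_pos h]
      exact mapsTo_directSum _ (mapsTo_simpleEntry r X n m p)
    · rw [(simpleComplex (X ⋙ forgetComplex)).shape _ _ h]
      exact MapsTo.zero⟩
  shape n m h := FiltObj.hom_ext ((simpleComplex (X ⋙ forgetComplex)).shape n m h)
  d_comp_d' n m l _ _ := FiltObj.hom_ext ((simpleComplex (X ⋙ forgetComplex)).d_comp_d n m l)

/-- The `r`-simple functor `s^r` on cubical codiagrams of filtered complexes. -/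
def rSimple (A : Type u) [Category.{v} A] [Abelian A] (r : ℕ) :
    CoDiag (FiltComplex A) ⥤ FiltComplex A where
  obj K := rSimpleComplex r K.X
  map {K L} f :=
    { f n := ⟨(simpleMap ((CoDiag.mapFunctor forgetComplex).map f)).f n, fun p =>
        mapsTo_directSum _ (mapsTo_simpleMapEntry r f n p)⟩
      comm' n m _ := FiltObj.hom_ext
        ((simpleMap ((CoDiag.mapFunctor forgetComplex).map f)).comm n m) }
  map_id K := by
    ext n : 2
    exact congrArg (fun (φ : simpleComplex (K.X ⋙ forgetComplex) ⟶ _) => φ.f n)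
      ((CoDiag.mapFunctor forgetComplex ⋙ simpleFunctor A).map_id K)
  map_comp {K L M} f g := by
    ext n : 2
    exact congrArg (fun (φ : simpleComplex (K.X ⋙ forgetComplex) ⟶
        simpleComplex (M.X ⋙ forgetComplex)) => φ.f n)
      ((CoDiag.mapFunctor forgetComplex ⋙ simpleFunctor A).map_comp f g)

/-! ### The spectral sequence of a filtered complex -/

/-- The morphism between subobjects induced by a morphism. -/
def MapsTo.lift {X Y : A} {S : Subobject X} {f : X ⟶ Y} {T : Subobject Y} (h : MapsTo S f T) :
    (S : A) ⟶ (T : A) := T.factorThru (S.arrow ≫ f) h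

lemma MapsTo.lift_arrow {X Y : A} {S : Subobject X} {f : X ⟶ Y} {T : Subobject Y}
    (h : MapsTo S f T) : h.lift ≫ T.arrow = S.arrow ≫ f := Subobject.factorThru_arrow _ _ h

lemma MapsTo.lift_arrow_assoc {X Y Z : A} {S : Subobject X} {f : X ⟶ Y} {T : Subobject Y}
    (h : MapsTo S f T) (g : Y ⟶ Z) : h.lift ≫ T.arrow ≫ g = S.arrow ≫ f ≫ g := by
  rw [← Category.assoc, h.lift_arrow, Category.assoc]

/-- The object `Z / B` for subobjects `B ≤ Z` of an object. -/
def subquotient {X : A} {B Z : Subobject X} (h : B ≤ Z) : A := cokernel (Subobject.ofLE B Z h)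

/-- The projection onto a subquotient. -/
def subquotientπ {X : A} {B Z : Subobject X} (h : B ≤ Z) : (Z : A) ⟶ subquotient h :=
  cokernel.π (Subobject.ofLE B Z h)

lemma subquotient_hom_ext {X : A} {B Z : Subobject X} (h : B ≤ Z) {T : A}
    {f g : subquotient h ⟶ T} (e : subquotientπ h ≫ f = subquotientπ h ≫ g) : f = g :=
  (cancel_epi (cokernel.π (Subobject.ofLE B Z h))).1 e

/-- The morphism of subquotients induced by a morphism. -/
def subquotientMap {X Y : A} {B Z : Subobject X} {B' Z' : Subobject Y} (h : B ≤ Z) (h' : B' ≤ Z')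
    (f : X ⟶ Y) (hB : MapsTo B f B') (hZ : MapsTo Z f Z') : subquotient h ⟶ subquotient h' :=
  cokernel.map _ _ hB.lift hZ.lift (by
    rw [← cancel_mono Z'.arrow, Category.assoc, Category.assoc, hZ.lift_arrow,
      Subobject.ofLE_arrow, hB.lift_arrow, Subobject.ofLE_arrow_assoc])

lemma π_subquotientMap {X Y : A} {B Z : Subobject X} {B' Z' : Subobject Y} (h : B ≤ Z)
    (h' : B' ≤ Z') (f : X ⟶ Y) (hB : MapsTo B f B') (hZ : MapsTo Z f Z') :
    subquotientπ h ≫ subquotientMap h h' f hB hZ = hZ.lift ≫ subquotientπ h' :=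
  cokernel.π_desc _ _ _

lemma π_subquotientMap_assoc {X Y T : A} {B Z : Subobject X} {B' Z' : Subobject Y} (h : B ≤ Z)
    (h' : B' ≤ Z') (f : X ⟶ Y) (hB : MapsTo B f B') (hZ : MapsTo Z f Z')
    (g : subquotient h' ⟶ T) :
    subquotientπ h ≫ subquotientMap h h' f hB hZ ≫ g = hZ.lift ≫ subquotientπ h' ≫ g := by
  rw [← Category.assoc, π_subquotientMap, Category.assoc]

lemma subquotientMap_id {X : A} {B Z : Subobject X} (h : B ≤ Z) (f : X ⟶ X) (hf : f = 𝟙 X)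
    (hB : MapsTo B f B) (hZ : MapsTo Z f Z) : subquotientMap h h f hB hZ = 𝟙 _ := by
  subst hf
  refine subquotient_hom_ext h ?_
  have : hZ.lift = 𝟙 _ := by
    rw [← cancel_mono Z.arrow, hZ.lift_arrow, Category.comp_id, Category.id_comp]
  rw [π_subquotientMap, this, Category.id_comp, Category.comp_id]

lemma subquotientMap_comp {X Y T : A} {B Z : Subobject X} {B' Z' : Subobject Y}
    {B'' Z'' : Subobject T} (h : B ≤ Z) (h' : B' ≤ Z') (h'' : B'' ≤ Z'') (f : X ⟶ Y) (g : Y ⟶ T)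
    (k : X ⟶ T) (hk : f ≫ g = k) (hB : MapsTo B f B') (hZ : MapsTo Z f Z') (hB' : MapsTo B' g B'')
    (hZ' : MapsTo Z' g Z'') (hB'' : MapsTo B k B'') (hZ'' : MapsTo Z k Z'') :
    subquotientMap h h' f hB hZ ≫ subquotientMap h' h'' g hB' hZ' =
      subquotientMap h h'' k hB'' hZ'' := by
  subst hk
  refine subquotient_hom_ext h ?_
  rw [π_subquotientMap_assoc, π_subquotientMap, π_subquotientMap, ← Category.assoc]
  congr 1
  rw [← cancel_mono Z''.arrow, Category.assoc, hZ'.lift_arrow, hZ''.lift_arrow,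
    hZ.lift_arrow_assoc]

lemma subquotientMap_zero {X Y : A} {B Z : Subobject X} {B' Z' : Subobject Y} (h : B ≤ Z)
    (h' : B' ≤ Z') (f : X ⟶ Y) (hf : f = 0) (hB : MapsTo B f B') (hZ : MapsTo Z f Z') :
    subquotientMap h h' f hB hZ = 0 := by
  subst hf
  refine subquotient_hom_ext h ?_
  have : hZ.lift = 0 := by
    rw [← cancel_mono Z'.arrow, hZ.lift_arrow, comp_zero, zero_comp]
  rw [π_subquotientMap, comp_zero, this, zero_comp]

/-- `Z_r^p = W_p K^n ∩ d⁻¹ (W_(p - r) K^(n + 1))`. -/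
def cyclesZ (K : FiltComplex A) (r p n : ℤ) : Subobject (K.X n).X :=
  (K.X n).W p ⊓ (Subobject.pullback (K.d n (n + 1)).f).obj ((K.X (n + 1)).W (p - r))

/-- The image of a subobject under a morphism. -/
def imageOf {X Y : A} (f : X ⟶ Y) (S : Subobject X) : Subobject Y := imageSubobject (S.arrow ≫ f)

/-- `B_r^p = Z_(r - 1)^(p - 1) + d (Z_(r - 1)^(p + r - 1))`. -/
def boundariesB (K : FiltComplex A) (r p n : ℤ) : Subobject (K.X n).X :=
  cyclesZ K (r - 1) (p - 1) n ⊔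
    imageOf (K.d (n - 1) n).f (cyclesZ K (r - 1) (p + r - 1) (n - 1))

lemma mapsTo_iff_le_pullback {X Y : A} (S : Subobject X) (f : X ⟶ Y) (T : Subobject Y) :
    MapsTo S f T ↔ S ≤ (Subobject.pullback f).obj T := by
  refine ⟨fun h => Subobject.le_of_factors ((pullback_factors_iff _ _ _).2 h), fun h => ?_⟩
  exact (pullback_factors_iff _ _ _).1
    (Subobject.factors_of_le _ h (Subobject.factors_self S))

lemma imageOf_le_iff {X Y : A} (f : X ⟶ Y) (S : Subobject X) (T : Subobject Y) :
    imageOf f S ≤ T ↔ MapsTo S f T := by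
  constructor
  · intro h
    have : (imageOf f S).Factors (S.arrow ≫ f) := by
      rw [← imageSubobject_arrow_comp (S.arrow ≫ f)]
      exact Subobject.factors_comp_arrow _
    exact Subobject.factors_of_le _ h this
  · intro h
    exact imageSubobject_le _ (T.factorThru _ h) (Subobject.factorThru_arrow _ _ h)

lemma mapsTo_cyclesZ {K : FiltComplex A} {n : ℤ} {r p : ℤ} {X : A} {S : Subobject X}
    {f : X ⟶ (K.X n).X} : MapsTo S f (cyclesZ K r p n) ↔
      MapsTo S f ((K.X n).W p) ∧ MapsTo S (f ≫ (K.d n (n + 1)).f) ((K.X (n + 1)).W (p - r)) := by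
  unfold MapsTo cyclesZ
  rw [Subobject.inf_factors, pullback_factors_iff, Category.assoc]

lemma mapsTo_sup {X Y : A} {S S' : Subobject X} {f : X ⟶ Y} {T : Subobject Y}
    (h : MapsTo S f T) (h' : MapsTo S' f T) : MapsTo (S ⊔ S') f T := by
  rw [mapsTo_iff_le_pullback] at *
  exact sup_le h h'

lemma mapsTo_imageOf {X Y T : A} {S : Subobject X} {f : X ⟶ Y} {g : Y ⟶ T} {U : Subobject T}
    (h : MapsTo S (f ≫ g) U) : MapsTo (imageOf f S) g U := by
  rw [mapsTo_iff_le_pullback, imageOf_le_iff]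
  refine (pullback_factors_iff _ _ _).2 ?_
  rw [Category.assoc]
  exact h

lemma mapsTo_imageOf_self {X Y : A} (f : X ⟶ Y) (S : Subobject X) : MapsTo S f (imageOf f S) :=
  (imageOf_le_iff _ _ _).1 le_rfl

lemma d_comp_d_f (K : FiltComplex A) (i j k : ℤ) : (K.d i j).f ≫ (K.d j k).f = 0 :=
  congrArg FiltObj.Hom.f (K.d_comp_d i j k)

lemma cyclesZ_mapsTo_W (K : FiltComplex A) (r p n : ℤ) :
    MapsTo (cyclesZ K r p n) (𝟙 _) ((K.X n).W p) :=
  (mapsTo_cyclesZ.1 (MapsTo.of_le le_rfl)).1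

lemma cyclesZ_mapsTo_d (K : FiltComplex A) (r p n : ℤ) :
    MapsTo (cyclesZ K r p n) (K.d n (n + 1)).f ((K.X (n + 1)).W (p - r)) := by
  have := (mapsTo_cyclesZ.1 (MapsTo.of_le (le_refl (cyclesZ K r p n)))).2
  rwa [Category.id_comp] at this

/-- The differential sends `Z_r^p` into `Z_s^q` if `p - r ≤ q`. -/
lemma cyclesZ_mapsTo_cyclesZ (K : FiltComplex A) (r p s q i j : ℤ) (h : i + 1 = j → p - r ≤ q) :
    MapsTo (cyclesZ K r p i) (K.d i j).f (cyclesZ K s q j) := by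
  by_cases hij : i + 1 = j
  · subst hij
    refine mapsTo_cyclesZ.2 ⟨(cyclesZ_mapsTo_d K r p i).le_right ((K.X _).mono (h rfl)), ?_⟩
    rw [d_comp_d_f]
    exact MapsTo.zero
  · rw [K.shape i j hij]
    exact MapsTo.zero

lemma boundariesB_le (K : FiltComplex A) (r p n : ℤ) : boundariesB K r p n ≤ cyclesZ K r p n := by
  refine sup_le ?_ ((imageOf_le_iff _ _ _).2 (cyclesZ_mapsTo_cyclesZ K _ _ _ _ _ _ (by omega)))
  refine Subobject.le_of_factors ?_
  have h1 := cyclesZ_mapsTo_W K (r - 1) (p - 1) n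
  have h2 := cyclesZ_mapsTo_d K (r - 1) (p - 1) n
  have : MapsTo (cyclesZ K (r - 1) (p - 1) n) (𝟙 _) (cyclesZ K r p n) := by
    refine mapsTo_cyclesZ.2 ⟨h1.le_right ((K.X n).mono (by omega)), ?_⟩
    rw [Category.id_comp]
    exact h2.le_right ((K.X _).mono (by omega))
  unfold MapsTo at this
  rwa [Category.comp_id] at this

/-- The term in filtration degree `p` and total degree `n` of the page `E_r = Z_r / B_r` of the
spectral sequence of a filtered complex. -/
def pageX (K : FiltComplex A) (r p n : ℤ) : A := subquotient (boundariesB_le K r p n)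

lemma boundariesB_mapsTo (K : FiltComplex A) (r p q i j : ℤ) (h : i + 1 = j → q = p - r) :
    MapsTo (boundariesB K r p i) (K.d i j).f (boundariesB K r q j) := by
  by_cases hij : i + 1 = j
  · obtain rfl := h hij
    subst hij
    refine mapsTo_sup ?_ (mapsTo_imageOf (by rw [d_comp_d_f]; exact MapsTo.zero))
    refine MapsTo.le_right ?_ (le_sup_right (a := cyclesZ K (r - 1) (p - r - 1) (i + 1)))
    have : MapsTo (cyclesZ K (r - 1) (p - r + r - 1) (i + 1 - 1)) (K.d (i + 1 - 1) (i + 1)).f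
      (imageOf (K.d (i + 1 - 1) (i + 1)).f (cyclesZ K (r - 1) (p - r + r - 1) (i + 1 - 1))) :=
        mapsTo_imageOf_self _ _
    have e1 : i + 1 - 1 = i := by omega
    have e2 : p - r + r - 1 = p - 1 := by omega
    rw [e2] at this ⊢
    generalize i + 1 - 1 = i' at *
    subst e1
    exact this
  · rw [K.shape i j hij]
    exact MapsTo.zero

/-- The complex `(E_r, d_r)`. The differential `d_r` lowers the filtration degree by `r`, so `E_r`
is the direct sum over all `p` of the complexes with terms `E_r` in filtration degree `p - r n` and
total degree `n`. -/
def pageComplex (K : FiltComplex A) (r p : ℤ) : CochainComplex A ℤ where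
  X n := pageX K r (p - r * n) n
  d i j := subquotientMap _ _ (K.d i j).f
    (boundariesB_mapsTo K r _ _ i j (by rintro rfl; ring))
    (cyclesZ_mapsTo_cyclesZ K r _ r _ i j (by rintro rfl; exact le_of_eq (by ring)))
  shape i j h := subquotientMap_zero _ _ _ (by rw [K.shape i j h]; rfl) _ _
  d_comp_d' i j k _ _ := by
    exact (subquotientMap_comp _ _ _ _ _ 0 (d_comp_d_f K i j k) _ _ _ _ MapsTo.zero
      MapsTo.zero).trans (subquotientMap_zero _ _ _ rfl _ _)

lemma hom_mapsTo_cyclesZ {K L : FiltComplex A} (f : K ⟶ L) (r p n : ℤ) :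
    MapsTo (cyclesZ K r p n) (f.f n).f (cyclesZ L r p n) := by
  refine mapsTo_cyclesZ.2 ⟨?_, ?_⟩
  · have := (cyclesZ_mapsTo_W K r p n).comp ((f.f n).mapsTo p)
    rwa [Category.id_comp] at this
  · have e : (f.f n).f ≫ (L.d n (n + 1)).f = (K.d n (n + 1)).f ≫ (f.f (n + 1)).f :=
      congrArg FiltObj.Hom.f (f.comm n (n + 1))
    rw [e]
    exact (cyclesZ_mapsTo_d K r p n).comp ((f.f (n + 1)).mapsTo _)

lemma hom_mapsTo_boundariesB {K L : FiltComplex A} (f : K ⟶ L) (r p n : ℤ) :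
    MapsTo (boundariesB K r p n) (f.f n).f (boundariesB L r p n) := by
  refine mapsTo_sup ((hom_mapsTo_cyclesZ f _ _ _).le_right le_sup_left) (mapsTo_imageOf ?_)
  have e : (K.d (n - 1) n).f ≫ (f.f n).f = (f.f (n - 1)).f ≫ (L.d (n - 1) n).f :=
    (congrArg FiltObj.Hom.f (f.comm (n - 1) n)).symm
  rw [e]
  exact ((hom_mapsTo_cyclesZ f _ _ _).comp (mapsTo_imageOf_self _ _)).le_right le_sup_right

/-- The functor `E_r` from filtered complexes to complexes, in the summand indexed by `p`. -/
def pageFunctor (A : Type u) [Category.{v} A] [Abelian A] (r p : ℤ) :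
    FiltComplex A ⥤ CochainComplex A ℤ where
  obj K := pageComplex K r p
  map {K L} f :=
    { f n := subquotientMap _ _ (f.f n).f (hom_mapsTo_boundariesB f r _ n)
        (hom_mapsTo_cyclesZ f r _ n)
      comm' i j _ := by
        have e : (f.f i).f ≫ (L.d i j).f = (K.d i j).f ≫ (f.f j).f :=
          congrArg FiltObj.Hom.f (f.comm i j)
        have hBK := boundariesB_mapsTo K r (p - r * i) (p - r * j) i j (by rintro rfl; ring)
        have hBL := boundariesB_mapsTo L r (p - r * i) (p - r * j) i j (by rintro rfl; ring)
        have hZK := cyclesZ_mapsTo_cyclesZ K r (p - r * i) r (p - r * j) i j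
          (by rintro rfl; exact le_of_eq (by ring))
        have hZL := cyclesZ_mapsTo_cyclesZ L r (p - r * i) r (p - r * j) i j
          (by rintro rfl; exact le_of_eq (by ring))
        have hB := hBK.comp (hom_mapsTo_boundariesB f r _ j)
        have hZ := hZK.comp (hom_mapsTo_cyclesZ f r _ j)
        exact (subquotientMap_comp _ _ _ _ _ _ e (hom_mapsTo_boundariesB f r _ i)
          (hom_mapsTo_cyclesZ f r _ i) hBL hZL hB hZ).trans
          (subquotientMap_comp _ _ _ _ _ _ rfl hBK hZK (hom_mapsTo_boundariesB f r _ j)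
          (hom_mapsTo_cyclesZ f r _ j) hB hZ).symm }
  map_id K := by
    ext n : 1
    exact subquotientMap_id (boundariesB_le K r (p - r * n) n) _ rfl
      (hom_mapsTo_boundariesB (𝟙 K) r _ n) (hom_mapsTo_cyclesZ (𝟙 K) r _ n)
  map_comp {K L M} f g := by
    ext n : 1
    exact (subquotientMap_comp _ _ _ _ _ _ rfl (hom_mapsTo_boundariesB f r _ n)
      (hom_mapsTo_cyclesZ f r _ n) (hom_mapsTo_boundariesB g r _ n)
      (hom_mapsTo_cyclesZ g r _ n) (hom_mapsTo_boundariesB (f ≫ g) r _ n)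
      (hom_mapsTo_cyclesZ (f ≫ g) r _ n)).symm

/-- The class of `E_r`-quasi-isomorphisms: the morphisms `f` of filtered complexes such that `E_r(f)`
is a quasi-isomorphism. -/
def pageQuasiIso (A : Type u) [Category.{v} A] [Abelian A] (r : ℕ) :
    MorphismProperty (FiltComplex A) :=
  fun _ _ f => ∀ p : ℤ, QuasiIso ((pageFunctor A r p).map f)

end Filtered

/-! ### Products of cubes -/

/-- The set `S ⊔ {*}`, where the added point `*` is written `⊥`. -/
def CubeSet.star (S : CubeSet) : CubeSet where
  carrier := WithBot S.carrier
  fintype := inferInstanceAs (Fintype (Option S.carrier))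

namespace Cube

/-- The product of two cubes: the factors of `P`, followed by the factors of `Q`. -/
def prod (P Q : Cube) : Cube where
  ι := P.ι ⊕ₗ Q.ι
  S x := Sum.elim P.S Q.S (ofLex x)

/-- The empty product, whose category of faces is a point. -/
def unit : Cube where
  ι := Empty
  S x := x.elim

instance : IsEmpty unit.ι := inferInstanceAs (IsEmpty Empty)

/-- The category `□_S`, as a product with one factor. -/
def single (S : CubeSet) : Cube where
  ι := Unit
  S _ := S

variable {P Q R P' Q' : Cube}

/-- The face of `P × Q` given by a face of `P` and a face of `Q`. -/
def Idx.pair (α : P.Idx) (β : Q.Idx) : (P.prod Q).Idx := fun x =>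
  Sum.rec (motive := fun x => ((P.prod Q).S (toLex x)).Face) (fun i => α i) (fun j => β j) (ofLex x)

/-- The first component of a face of `P × Q`. -/
def Idx.fst (γ : (P.prod Q).Idx) : P.Idx := fun i => γ (toLex (Sum.inl i))

/-- The second component of a face of `P × Q`. -/
def Idx.snd (γ : (P.prod Q).Idx) : Q.Idx := fun j => γ (toLex (Sum.inr j))

lemma Idx.fst_mono {γ γ' : (P.prod Q).Idx} (h : γ ≤ γ') : γ.fst ≤ γ'.fst := fun _ => h _

lemma Idx.snd_mono {γ γ' : (P.prod Q).Idx} (h : γ ≤ γ') : γ.snd ≤ γ'.snd := fun _ => h _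

lemma Idx.prod_ext {γ γ' : (P.prod Q).Idx} (h : γ.fst = γ'.fst) (h' : γ.snd = γ'.snd) :
    γ = γ' := by
  funext x
  rcases x with i | j
  · exact congrFun h i
  · exact congrFun h' j

/-- The identification of the category `P × Q` with the product of the categories `P` and `Q`. -/
def unpair (P Q : Cube) : (P.prod Q).Idx ⥤ P.Idx × Q.Idx where
  obj γ := (γ.fst, γ.snd)
  map f := (homOfLE (Idx.fst_mono (leOfHom f)), homOfLE (Idx.snd_mono (leOfHom f)))

/-- The product of two morphisms of cubes. -/
def prodMap (f : P' ⟶ P) (g : Q' ⟶ Q) : P'.prod Q' ⟶ P.prod Q where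
  σ := OrderIso.sumLexCongr f.σ g.σ
  u x := Sum.rec
    (motive := fun x => ((P'.prod Q').S (OrderIso.sumLexCongr f.σ g.σ (toLex x))).carrier ↪
      ((P.prod Q).S (toLex x)).carrier)
    (fun i => f.u i) (fun j => g.u j) (ofLex x)

/-- The associativity of products of cubes. -/
def assoc (P Q R : Cube) : (P.prod Q).prod R ⟶ P.prod (Q.prod R) where
  σ := (OrderIso.sumLexAssoc P.ι Q.ι R.ι).symm
  u x := Sum.rec
    (motive := fun x => (((P.prod Q).prod R).S
      ((OrderIso.sumLexAssoc P.ι Q.ι R.ι).symm (toLex x))).carrier ↪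
      ((P.prod (Q.prod R)).S (toLex x)).carrier)
    (fun _ => Function.Embedding.refl _)
    (fun y => Sum.rec
      (motive := fun y => (((P.prod Q).prod R).S
        ((OrderIso.sumLexAssoc P.ι Q.ι R.ι).symm (toLex (Sum.inr (toLex y))))).carrier ↪
        ((Q.prod R).S (toLex y)).carrier)
      (fun _ => Function.Embedding.refl _) (fun _ => Function.Embedding.refl _) (ofLex y))
    (ofLex x)

lemma assoc_map (γ : ((P.prod Q).prod R).Idx) :
    Hom.map (assoc P Q R) γ = γ.fst.fst.pair (γ.fst.snd.pair γ.snd) := by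
  refine Idx.prod_ext ?_ (Idx.prod_ext ?_ ?_)
  · exact Idx.ext fun _ => Finset.map_refl
  · exact Idx.ext fun _ => Finset.map_refl
  · exact Idx.ext fun _ => Finset.map_refl

/-- The identification of `P` with `1 × P`. -/
def leftUnit (P : Cube) : P ⟶ unit.prod P where
  σ := OrderIso.emptySumLex
  u x := Sum.rec
    (motive := fun x => (P.S ((OrderIso.emptySumLex (β := Empty)) (toLex x))).carrier ↪
      ((unit.prod P).S (toLex x)).carrier)
    (fun i => i.elim) (fun _ => Function.Embedding.refl _) (ofLex x)

/-- The identification of `P` with `P × 1`. -/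
def rightUnit (P : Cube) : P ⟶ P.prod unit where
  σ := OrderIso.sumLexEmpty
  u x := Sum.rec
    (motive := fun x => (P.S ((OrderIso.sumLexEmpty (β := Empty)) (toLex x))).carrier ↪
      ((P.prod unit).S (toLex x)).carrier)
    (fun _ => Function.Embedding.refl _) (fun i => i.elim) (ofLex x)

lemma leftUnit_map (α : P.Idx) : (Hom.map (leftUnit P) α).snd = α :=
  Idx.ext fun _ => Finset.map_refl

lemma rightUnit_map (α : P.Idx) : (Hom.map (rightUnit P) α).fst = α :=
  Idx.ext fun _ => Finset.map_refl

/-- The face `β ∪ {*}` of `S ⊔ {*}`, for a possibly empty subset `β` of `S`. -/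
def starFace (S : CubeSet) (β : Finset S.carrier) : (single S.star).Idx := fun _ =>
  (⟨insert (⊥ : WithBot S.carrier) (β.map ⟨WithBot.some, WithBot.coe_injective⟩),
    Finset.insert_nonempty _ _⟩ : S.star.Face)

lemma starFace_mono (S : CubeSet) : Monotone (starFace S) := fun _ _ h _ =>
  Finset.insert_subset_insert (⊥ : WithBot S.carrier) (Finset.map_subset_map.2 h)

/-- The functor `β ↦ β ∪ {*}` from `□_S` to `□_(S ⊔ {*})`. -/
def starFunctor (S : CubeSet) : (single S).Idx ⥤ (single S.star).Idx :=
  Monotone.functor (f := fun β => starFace S (β.set ()))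
    fun _ _ h => starFace_mono S (h ())

end Cube

/-! ### Cohomological descent categories -/

section Descent

variable {D : Type u} [Category.{v} D] (s : CoDiag D ⥤ D)

open CubicalDescent.Cube

/-- The restriction `s_P` of a functor `s` to the diagrams of shape `P`. -/
def simpleAt (P : Cube) : (P.Idx ⥤ D) ⥤ D := CoDiag.incl P ⋙ s

/-- The morphism `s_P X ⟶ s_P' (u^* X)` given by a morphism `u : P' ⟶ P`. -/
def simpleRestrict {P P' : Cube} (u : P' ⟶ P) (X : P.Idx ⥤ D) :
    (simpleAt s P).obj X ⟶ (simpleAt s P').obj (u.functor ⋙ X) :=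
  s.map (CoDiag.restrict u X)

lemma simpleRestrict_naturality {P P' : Cube} (u : P' ⟶ P) {X Y : P.Idx ⥤ D} (a : X ⟶ Y) :
    (simpleAt s P).map a ≫ simpleRestrict s u Y =
      simpleRestrict s u X ≫ (simpleAt s P').map (u.functor.whiskerLeft a) := by
  refine (s.map_comp _ _).symm.trans (Eq.trans (congrArg (fun φ => s.map φ) ?_) (s.map_comp _ _))
  refine CoDiag.Hom.ext_heq rfl fun β => heq_of_eq ?_
  change X.map (homOfLE _) ≫ (X.map (homOfLE _) ≫ a.app _) ≫ 𝟙 _ =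
    X.map (homOfLE _) ≫ 𝟙 _ ≫ X.map (homOfLE _) ≫ a.app _
  rw [Category.comp_id, Category.id_comp]
  exact (map_le_comp_assoc X _ _ _).trans (map_le_comp_assoc X _ _ _).symm

/-- A functor `P ⥤ Q ⥤ C`, regarded as a functor on the cube `P × Q`. -/
def uncurryCube (C : Type*) [Category* C] (P Q : Cube) :
    (P.Idx ⥤ Q.Idx ⥤ C) ⥤ ((P.prod Q).Idx ⥤ C) :=
  Functor.uncurry ⋙ (Functor.whiskeringLeft _ _ C).obj (unpair P Q)

/-- The functor `α ↦ s_Q (X(α, -))` on `P`. -/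
abbrev innerSimple (P Q : Cube) : (P.Idx ⥤ Q.Idx ⥤ D) ⥤ (P.Idx ⥤ D) :=
  (Functor.whiskeringRight P.Idx _ _).obj (simpleAt s Q)

/-- The restriction of `X : P ⥤ Q ⥤ C` along `u : P' ⟶ P` and `w : Q' ⟶ Q`. -/
abbrev restrict₂ {C : Type*} [Category* C] {P P' Q Q' : Cube} (u : P' ⟶ P) (w : Q' ⟶ Q)
    (X : P.Idx ⥤ Q.Idx ⥤ C) : P'.Idx ⥤ Q'.Idx ⥤ C :=
  u.functor ⋙ X ⋙ (Functor.whiskeringLeft _ _ C).obj w.functor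

/-- The morphism `s_P s_Q X ⟶ s_P' s_Q' (u × w)^* X` induced by `u` and `w`. -/
def iterRestrict {P P' Q Q' : Cube} (u : P' ⟶ P) (w : Q' ⟶ Q) (X : P.Idx ⥤ Q.Idx ⥤ D) :
    (simpleAt s P).obj ((innerSimple s P Q).obj X) ⟶
      (simpleAt s P').obj ((innerSimple s P' Q').obj (restrict₂ u w X)) :=
  simpleRestrict s u _ ≫ (simpleAt s P').map
    { app := fun α => simpleRestrict s w (X.obj (u.map α))
      naturality := by
        intro α β f
        exact simpleRestrict_naturality s w (X.map (homOfLE (u.map_mono (leOfHom f)))) }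

/-- The morphism `s_(P × Q) X ⟶ s_(P' × Q') (u × w)^* X` induced by `u` and `w`. -/
def prodRestrict {P P' Q Q' : Cube} (u : P' ⟶ P) (w : Q' ⟶ Q) (X : P.Idx ⥤ Q.Idx ⥤ D) :
    (simpleAt s (P.prod Q)).obj ((uncurryCube D P Q).obj X) ⟶
      (simpleAt s (P'.prod Q')).obj ((uncurryCube D P' Q').obj (restrict₂ u w X)) :=
  simpleRestrict s (prodMap u w) _ ≫ (simpleAt s (P'.prod Q')).map
    { app := fun γ => 𝟙 ((X.obj (u.map γ.fst)).obj (w.map γ.snd))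
      naturality := by
        intro α β f
        exact (Category.comp_id _).trans (Category.id_comp _).symm }

/-- The canonical isomorphism between the two ways to apply `s_R` to a functor on `P × Q`. -/
def uncurryInner (P Q R : Cube) (X : P.Idx ⥤ Q.Idx ⥤ R.Idx ⥤ D) :
    (uncurryCube D P Q).obj (X ⋙ innerSimple s Q R) ≅
      (uncurryCube (R.Idx ⥤ D) P Q).obj X ⋙ simpleAt s R :=
  NatIso.ofComponents (fun γ => Iso.refl _) (by
    intro α β f
    refine (Category.comp_id _).trans (Eq.trans ?_ (Category.id_comp _).symm)
    exact ((simpleAt s R).map_comp _ _).symm)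

/-- The canonical isomorphism from the restriction to `(P × Q) × R` of a functor on `P × (Q × R)`. -/
def uncurryAssoc (P Q R : Cube) (X : P.Idx ⥤ Q.Idx ⥤ R.Idx ⥤ D) :
    (assoc P Q R).functor ⋙ (uncurryCube D P (Q.prod R)).obj (X ⋙ uncurryCube D Q R) ⟶
      (uncurryCube D (P.prod Q) R).obj ((uncurryCube (R.Idx ⥤ D) P Q).obj X) where
  app γ := ((uncurryCube D P (Q.prod R)).obj (X ⋙ uncurryCube D Q R)).map
    (homOfLE (assoc_map γ).le)
  naturality := by
    intro α β f
    let Y := (uncurryCube D P (Q.prod R)).obj (X ⋙ uncurryCube D Q R)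
    have h1 := leOfHom f
    have h2 : α.fst.fst.pair (α.fst.snd.pair α.snd) ≤ β.fst.fst.pair (β.fst.snd.pair β.snd) := by
      rw [← assoc_map, ← assoc_map]
      exact (assoc P Q R).map_mono h1
    refine (map_le_comp' Y ((assoc P Q R).map_mono h1) (assoc_map β).le
      ((assoc_map α).le.trans h2)).trans ((map_le_comp Y (assoc_map α).le h2).symm.trans ?_)
    exact congrArg (Y.map (homOfLE (assoc_map α).le) ≫ ·) (Category.assoc _ _ _).symm

/-- The canonical isomorphism between the restriction to `Q` of the functor `X` on `1 × Q`,
and `X`. -/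
def uncurryLeftUnit (Q : Cube) (X : Q.Idx ⥤ D) :
    (leftUnit Q).functor ⋙ (uncurryCube D unit Q).obj ((Functor.const _).obj X) ⟶ X where
  app α := X.map (homOfLE (leftUnit_map α).le)
  naturality α β f := by
    refine (congrArg (· ≫ _) (Category.id_comp _)).trans ?_
    exact (map_le_comp' X (Idx.snd_mono ((leftUnit Q).map_mono (leOfHom f))) _
      ((leftUnit_map α).le.trans (leOfHom f))).trans (map_le_comp X _ _).symm

/-- The canonical isomorphism between the restriction to `P` of the functor `X` on `P × 1`,
and `X`. -/
def uncurryRightUnit (P : Cube) (X : P.Idx ⥤ D) :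
    (rightUnit P).functor ⋙ (uncurryCube D P unit).obj (X ⋙ Functor.const _) ⟶ X where
  app α := X.map (homOfLE (rightUnit_map α).le)
  naturality α β f := by
    refine (congrArg (· ≫ _) (Category.comp_id _)).trans ?_
    exact (map_le_comp' X (Idx.fst_mono ((rightUnit P).map_mono (leOfHom f))) _
      ((rightUnit_map α).le.trans (leOfHom f))).trans (map_le_comp X _ _).symm

/-- The canonical isomorphism between a constant functor on `P × Q` and the iterated constant
functor. -/
def uncurryConst (P Q : Cube) (X : D) :
    (uncurryCube D P Q).obj ((Functor.const _).obj ((Functor.const _).obj X)) ⟶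
      (Functor.const _).obj X where
  app _ := 𝟙 X
  naturality _ _ _ := (Category.comp_id _).trans ((Category.comp_id _).trans (Category.comp_id _).symm)

/-- For a functor `Z` on `□_(S ⊔ {*})`, viewed as the augmented diagram `β ↦ Z (β ∪ {*})` of shape
`S`, the morphism from the constant diagram with value `Z {*}`. -/
def starAugmentation (S : CubeSet) (Z : (single S.star).Idx ⥤ D) :
    (Functor.const _).obj (Z.obj (starFace S ∅)) ⟶ starFunctor S ⋙ Z where
  app β := Z.map (homOfLE (starFace_mono S (Finset.empty_subset (β.set ()))))
  naturality _ _ _ := (Category.id_comp _).trans (map_le_comp Z _ _).symm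

/-- A structure of cohomological descent category on `D`, with class of weak equivalences `E` and
simple functor `s`. -/
structure CohomologicalDescentStructure (E : MorphismProperty D) where
  /-- The category is cartesian. -/
  [hasFiniteProducts : HasFiniteProducts D]
  /-- There is an initial object. -/
  [hasInitial : HasInitial D]
  /-- The class `E` is saturated. -/
  saturated : ∀ {X Y : D} (f : X ⟶ Y), IsIso (E.Q.map f) → E f
  /-- The class `E` is stable by products. -/
  prod_map : ∀ {X X' Y Y' : D} (f : X ⟶ Y) (g : X' ⟶ Y'), E f → E g → E (prod.map f g)
  /-- The simple functor commutes with finite products. -/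
  preservesFiniteProducts : ∀ P : Cube, PreservesFiniteProducts (simpleAt s P)
  /-- Exactness. -/
  exact : ∀ {P : Cube} {X Y : P.Idx ⥤ D} (a : X ⟶ Y), (∀ α, E (a.app α)) → E ((simpleAt s P).map a)
  /-- The natural transformation `s_P s_Q ⟶ s_(P × Q)`. -/
  μ : ∀ P Q : Cube, innerSimple s P Q ⋙ simpleAt s P ⟶ uncurryCube D P Q ⋙ simpleAt s (P.prod Q)
  /-- The morphisms `μ` are weak equivalences. -/
  μ_mem : ∀ (P Q : Cube) (X : P.Idx ⥤ Q.Idx ⥤ D), E ((μ P Q).app X)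
  /-- The morphisms `μ` are natural with respect to morphisms of cubes. -/
  μ_restrict : ∀ {P P' Q Q' : Cube} (u : P' ⟶ P) (w : Q' ⟶ Q) (X : P.Idx ⥤ Q.Idx ⥤ D),
    iterRestrict s u w X ≫ (μ P' Q').app (restrict₂ u w X) = (μ P Q).app X ≫ prodRestrict s u w X
  /-- The natural transformation from `X` to the simple of the constant diagram `X`. -/
  lam : ∀ P : Cube, 𝟭 D ⟶ Functor.const P.Idx ⋙ simpleAt s P
  /-- The morphisms `lam` are weak equivalences. -/
  lam_mem : ∀ (P : Cube) (X : D), E ((lam P).app X)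
  /-- The morphisms `lam` are natural with respect to morphisms of cubes. -/
  lam_restrict : ∀ {P P' : Cube} (u : P' ⟶ P) (X : D),
    (lam P).app X ≫ simpleRestrict s u ((Functor.const P.Idx).obj X) = (lam P').app X
  /-- Associativity: the two morphisms `s_P s_Q s_R X ⟶ s_((P × Q) × R) X` agree. -/
  μ_assoc : ∀ (P Q R : Cube) (X : P.Idx ⥤ Q.Idx ⥤ R.Idx ⥤ D),
    (μ P Q).app (X ⋙ innerSimple s Q R) ≫
        (simpleAt s (P.prod Q)).map (uncurryInner s P Q R X).hom ≫
        (μ (P.prod Q) R).app ((uncurryCube (R.Idx ⥤ D) P Q).obj X) =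
      (simpleAt s P).map (X.whiskerLeft (μ Q R)) ≫ (μ P (Q.prod R)).app (X ⋙ uncurryCube D Q R) ≫
        simpleRestrict s (assoc P Q R) _ ≫
        (simpleAt s ((P.prod Q).prod R)).map (uncurryAssoc P Q R X)
  /-- Left unitality. -/
  lam_μ : ∀ (Q : Cube) (X : Q.Idx ⥤ D),
    (lam unit).app ((simpleAt s Q).obj X) ≫
        (simpleAt s unit).map (Functor.constComp _ X (simpleAt s Q)).inv ≫
        (μ unit Q).app ((Functor.const _).obj X) ≫ simpleRestrict s (leftUnit Q) _ ≫
        (simpleAt s Q).map (uncurryLeftUnit Q X) = 𝟙 _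
  /-- Right unitality. -/
  μ_lam : ∀ (P : Cube) (X : P.Idx ⥤ D),
    (simpleAt s P).map (X.whiskerLeft (lam unit)) ≫ (μ P unit).app (X ⋙ Functor.const _) ≫
        simpleRestrict s (rightUnit P) _ ≫ (simpleAt s P).map (uncurryRightUnit P X) = 𝟙 _
  /-- The morphism `lam` of a product is obtained from those of the factors. -/
  lam_prod : ∀ (P Q : Cube) (X : D),
    (lam P).app X ≫ (simpleAt s P).map ((Functor.const P.Idx).map ((lam Q).app X) ≫
        (Functor.constComp _ ((Functor.const Q.Idx).obj X) (simpleAt s Q)).inv) ≫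
        (μ P Q).app ((Functor.const _).obj ((Functor.const _).obj X)) ≫
        (simpleAt s (P.prod Q)).map (uncurryConst P Q X) = (lam (P.prod Q)).app X
  /-- The acyclicity criterion: for a diagram `Z` on `□_(S ⊔ {*})` that vanishes outside the faces
  containing `*`, the morphism from `Z {*}` to the simple of the diagram `β ↦ Z (β ∪ {*})` of shape
  `S` is a weak equivalence if and only if the simple of `Z` is acyclic. -/
  acyclic : ∀ (S : CubeSet) (Z : (single S.star).Idx ⥤ D),
    (∀ α : (single S.star).Idx, (⊥ : WithBot S.carrier) ∉ α.set () → Nonempty (IsInitial (Z.obj α))) →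
    (E ((lam (single S)).app (Z.obj (starFace S ∅)) ≫
        (simpleAt s (single S)).map (starAugmentation S Z)) ↔
      E (initial.to ((simpleAt s (single S.star)).obj Z)))

end Descent


/-! ### Bounded below filtered complexes -/

section Plus

attribute [local instance] Abelian.hasFiniteBiproducts

variable {A : Type u} [Category.{v} A] [Abelian A]

lemma FiltObj.isZero_iff (X : FiltObj A) : IsZero X ↔ IsZero X.X := by
  constructor
  · intro h
    refine (IsZero.iff_id_eq_zero _).2 ?_
    exact congrArg FiltObj.Hom.f (h.eq_of_src (𝟙 X) 0)
  · intro h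
    refine (IsZero.iff_id_eq_zero _).2 (FiltObj.hom_ext ?_)
    exact h.eq_of_src _ _

lemma plus_rSimple (r : ℕ) (K : CoDiag (CochainComplex.Plus (FiltObj A))) :
    CochainComplex.plus (FiltObj A)
      ((CoDiag.mapFunctor (CochainComplex.Plus.ι (FiltObj A)) ⋙ rSimple A r).obj K) := by
  choose N hN using fun α : K.P.Idx => (K.X.obj α).property
  have hm : ∃ m : ℤ, ∀ α, m ≤ N α := by
    obtain ⟨m, hm⟩ := (Set.finite_range N).bddBelow
    exact ⟨m, fun α => hm ⟨α, rfl⟩⟩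
  obtain ⟨m, hm⟩ := hm
  refine ⟨m, (CochainComplex.isStrictlyGE_iff _ _).2 fun n hn => ?_⟩
  refine (FiltObj.isZero_iff _).2 ((IsZero.iff_id_eq_zero _).2 ?_)
  refine biproduct.hom_ext' _ _ fun α => ?_
  refine IsZero.eq_of_src ?_ _ _
  have h := hN α
  refine (FiltObj.isZero_iff _).1 ((CochainComplex.isStrictlyGE_iff _ _).1 h _ ?_)
  have := hm α
  omega

/-- The `r`-simple functor on cubical codiagrams of bounded below filtered complexes. -/
def rSimplePlus (A : Type u) [Category.{v} A] [Abelian A] (r : ℕ) :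
    CoDiag (CochainComplex.Plus (FiltObj A)) ⥤ CochainComplex.Plus (FiltObj A) :=
  ObjectProperty.lift _ (CoDiag.mapFunctor (CochainComplex.Plus.ι _) ⋙ rSimple A r)
    (plus_rSimple r)

/-- The class of `E_r`-quasi-isomorphisms of bounded below filtered complexes. -/
def pageQuasiIsoPlus (A : Type u) [Category.{v} A] [Abelian A] (r : ℕ) :
    MorphismProperty (CochainComplex.Plus (FiltObj A)) :=
  (pageQuasiIso A r).inverseImage (CochainComplex.Plus.ι _)

end Plus

end CubicalDescent

end

noncomputable section

namespace CubicalDescent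

set_option linter.unusedSectionVars false

open CubicalDescent.Cube

/-! ### Generalized elements of filtered objects -/

section Elements

variable {A : Type u} [Category.{v} A]

/-! The first task is to replace the pages `E_r` by inequalities between filtration degrees. The
complex `(E_r, d_r)` of `M` is exact exactly when every `z ∈ W_p` with `dz ∈ W_(p-r-1)` lies in
`W_(p-1) + d W_(p+r)`; this is `PageAcyclic`. Elements are generalized elements `T ⟶ X`, and
existence means existence after an epimorphism `T' ⟶ T`. For a morphism `f : K ⟶ L` one imposes the
same condition on its cone, with terms `K^k ⊕ L^(k-1)` and filtration `W_p ⊕ W_(p+r)`; this is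
`ConeAcyclic`, and `pageQuasiIso_iff` identifies it with `E_r`-quasi-isomorphism. The shift by `r`
in the cone is the shift by which `W(r)` moves when the dimension of a face grows by one, and every
axiom rests on this coincidence.

Exactness (`coneAcyclic_sMap`): the components of an element of the simple are corrected face by
face, starting from the small faces. Once the proper faces of `α` have been pushed one filtration
step down, their contribution to the differential at `α` is negligible, and the hypothesis on `a_α`
corrects the component at `α`.

The morphism `μ` is an isomorphism of filtered complexes: dimensions add, and the incidence signs of
a product of cubes are those of the iterated total complex (`muHom_comm`, `coneAcyclic_muMap`).

The morphism `λ` of one simplex is a deformation retract: contraction to the least vertex is a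
homotopy that lowers the dimension of faces by one, hence raises `W(r)` by `r`, which is what the
criterion allows (`coneAcyclic_of_homotopy`, `d_vertexHomotopy`). The general case follows by
splitting off one factor at a time, using `μ`, exactness and the formula for `λ` of a product
(`coneAcyclic_lamMap`).

Acyclicity criterion: adding the point `*` raises dimensions by one and changes the signs, so the
simple of `Z` is, up to a shift, the filtered cone of the augmentation (`coneAcyclic_star_iff`,
based on `coneAcyclic_iff_pageAcyclic`).

Saturation and stability by products hold because `E_r`-quasi-isomorphisms are the morphisms
inverted by a family of additive functors, the cohomology objects of the pages. The remaining axioms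
compare components, where all maps are structure maps, signs and identifications of degrees. The
bounded below case is inherited through the full embedding. -/

/-- The generalized element `x` of `X` lies in the `p`-th step of the filtration. -/
def FiltObj.Mem (X : FiltObj A) (p : ℤ) {T : A} (x : T ⟶ X.X) : Prop := (X.W p).Factors x

namespace FiltObj.Mem

variable {X Y : FiltObj A} {p q : ℤ} {T T' : A} {x y : T ⟶ X.X}

lemma le (h : X.Mem p x) (hpq : p ≤ q) : X.Mem q x :=
  Subobject.factors_of_le _ (X.mono hpq) h

lemma precomp (h : X.Mem p x) (a : T' ⟶ T) : X.Mem p (a ≫ x) :=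
  Subobject.factors_of_factors_right _ h

lemma map (h : X.Mem p x) (f : X ⟶ Y) : Y.Mem p (x ≫ f.f) := by
  have h' := f.mapsTo p
  unfold FiltObj.Mem MapsTo at *
  rw [← Subobject.factorThru_arrow _ _ h, Category.assoc]
  exact Subobject.factors_of_factors_right _ h'

variable [Preadditive A]

lemma zero : X.Mem p (0 : T ⟶ X.X) := Subobject.factors_zero

lemma add (h : X.Mem p x) (h' : X.Mem p y) : X.Mem p (x + y) :=
  Subobject.factors_add _ _ h h'

lemma zsmul (h : X.Mem p x) (n : ℤ) : X.Mem p (n • x) := by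
  have : n • x = (n • 𝟙 _) ≫ x := by simp
  rw [this]
  exact h.precomp _

lemma neg (h : X.Mem p x) : X.Mem p (-x) := by
  simpa using h.zsmul (-1)

lemma sub (h : X.Mem p x) (h' : X.Mem p y) : X.Mem p (x - y) := by
  rw [sub_eq_add_neg]
  exact h.add h'.neg

lemma sum {I : Type*} {s : Finset I} {x : I → (T ⟶ X.X)} (h : ∀ i ∈ s, X.Mem p (x i)) :
    X.Mem p (∑ i ∈ s, x i) := by
  classical
  induction s using Finset.induction_on with
  | empty => simpa using zero
  | insert i s hi ih =>
    rw [Finset.sum_insert hi]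
    exact (h i (Finset.mem_insert_self _ _)).add
      (ih fun j hj => h j (Finset.mem_insert_of_mem hj))

end FiltObj.Mem

end Elements

/-! ### Quasi-isomorphisms and subquotients in terms of generalized elements -/

section Refinements

variable {A : Type u} [Category.{v} A] [Abelian A]

/-- A morphism is a quasi-isomorphism if and only if its mapping cone is exact, expressed in terms of
generalized elements. -/
lemma quasiIso_iff_cone {C D : CochainComplex A ℤ} (φ : C ⟶ D) :
    QuasiIso φ ↔ ∀ (i j k l : ℤ) (_ : i + 1 = j) (_ : j + 1 = k) (_ : k + 1 = l) ⦃T : A⦄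
      (x : T ⟶ C.X k) (y : T ⟶ D.X j), x ≫ C.d k l = 0 → x ≫ φ.f k = y ≫ D.d j k →
      ∃ (T' : A) (π : T' ⟶ T) (_ : Epi π) (x' : T' ⟶ C.X j) (y' : T' ⟶ D.X i),
        π ≫ x = x' ≫ C.d j k ∧ π ≫ y = x' ≫ φ.f j + y' ≫ D.d i j := by
  have hp : ∀ i j : ℤ, i + 1 = j → (ComplexShape.up ℤ).prev j = i :=
    fun i j h => (ComplexShape.up ℤ).prev_eq' h
  have hn : ∀ i j : ℤ, i + 1 = j → (ComplexShape.up ℤ).next i = j :=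
    fun i j h => (ComplexShape.up ℤ).next_eq' h
  constructor
  · intro h i j k l hij hjk hkl T x y hx hxy
    have hk : IsIso (HomologicalComplex.homologyMap φ k) := inferInstance
    have hj : IsIso (HomologicalComplex.homologyMap φ j) := inferInstance
    have hm := (HomologicalComplex.mono_homologyMap_iff_up_to_refinements φ j k l (hp _ _ hjk)
      (hn _ _ hkl)).1 inferInstance
    have he := (HomologicalComplex.epi_homologyMap_iff_up_to_refinements φ i j k (hp _ _ hij)
      (hn _ _ hjk)).1 inferInstance
    obtain ⟨T₁, π₁, _, x₁, h₁⟩ := hm x hx y hxy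
    -- Injectivity on cohomology in degree `k` has made `x` the boundary of `x₁`. Then `y - φ x₁` is
    -- a cycle, and surjectivity in degree `j` applies to it.
    obtain ⟨T₂, π₂, _, x₂, hx₂, y₂, h₂⟩ := he (π₁ ≫ y - x₁ ≫ φ.f j) (by
      rw [Preadditive.sub_comp, Category.assoc, Category.assoc, ← hxy, φ.comm,
        ← Category.assoc, h₁, Category.assoc, sub_self])
    refine ⟨T₂, π₂ ≫ π₁, epi_comp _ _, π₂ ≫ x₁ + x₂, y₂, ?_, ?_⟩
    · rw [Preadditive.add_comp, hx₂, add_zero, Category.assoc, Category.assoc, h₁]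
    · rw [Preadditive.comp_sub] at h₂
      rw [Preadditive.add_comp, Category.assoc, Category.assoc, add_assoc, ← h₂]
      abel
  · intro h
    rw [quasiIso_iff]
    intro k
    rw [quasiIsoAt_iff_isIso_homologyMap]
    have hm : Mono (HomologicalComplex.homologyMap φ k) := by
      rw [HomologicalComplex.mono_homologyMap_iff_up_to_refinements φ (k - 1) k (k + 1)
        (hp _ _ (by omega)) (hn _ _ rfl)]
      intro T x hx y hxy
      obtain ⟨T', π, hπ, x', y', h₁, -⟩ := h (k - 1 - 1) (k - 1) k (k + 1) (by omega) (by omega)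
        rfl x y hx hxy
      exact ⟨T', π, hπ, x', h₁⟩
    have he : Epi (HomologicalComplex.homologyMap φ k) := by
      rw [HomologicalComplex.epi_homologyMap_iff_up_to_refinements φ (k - 1) k (k + 1)
        (hp _ _ (by omega)) (hn _ _ rfl)]
      intro T y hy
      -- Surjectivity in degree `k` is the cone condition for `x = 0` placed one degree higher: the
      -- element `x'` it produces is then a cycle.
      obtain ⟨T', π, hπ, x', y', h₁, h₂⟩ := h (k - 1) k (k + 1) (k + 1 + 1) (by omega) rfl
        rfl (0 : T ⟶ C.X (k + 1)) y zero_comp (by rw [zero_comp, hy])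
      exact ⟨T', π, hπ, x', by rw [← h₁, comp_zero], y', h₂⟩
    exact isIso_of_mono_of_epi _

/-- The projection onto the image is an epimorphism, so elements of the image lift only after a
refinement. -/
lemma imageSubobject_factors {X Y T : A} {f : X ⟶ Y} {z : T ⟶ Y}
    (hz : (imageSubobject f).Factors z) :
    ∃ (T' : A) (π : T' ⟶ T) (_ : Epi π) (u : T' ⟶ X), π ≫ z = u ≫ f := by
  obtain ⟨T', π, hπ, u, hu⟩ := surjective_up_to_refinements_of_epi (factorThruImageSubobject f)
    ((imageSubobject f).factorThru z hz)
  refine ⟨T', π, hπ, u, ?_⟩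
  have := hu =≫ (imageSubobject f).arrow
  rwa [Category.assoc, Category.assoc, Subobject.factorThru_arrow,
    imageSubobject_arrow_comp] at this

lemma imageOf_factors {X Y T : A} {f : X ⟶ Y} {S : Subobject X} {z : T ⟶ Y}
    (hz : (imageOf f S).Factors z) :
    ∃ (T' : A) (π : T' ⟶ T) (_ : Epi π) (u : T' ⟶ X), S.Factors u ∧ π ≫ z = u ≫ f := by
  obtain ⟨T', π, hπ, u, hu⟩ := imageSubobject_factors hz
  exact ⟨T', π, hπ, u ≫ S.arrow, Subobject.factors_comp_arrow _, by rw [hu, Category.assoc]⟩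

lemma sup_factors {X T : A} {S S' : Subobject X} {z : T ⟶ X} (hz : (S ⊔ S').Factors z) :
    ∃ (T' : A) (π : T' ⟶ T) (_ : Epi π) (a b : T' ⟶ X), S.Factors a ∧ S'.Factors b ∧
      π ≫ z = a + b := by
  -- In an abelian category the join lies in the image of the direct sum, and for an image the
  -- decomposition exists locally.
  have hle : S ⊔ S' ≤ imageSubobject (biprod.desc S.arrow S'.arrow) := by
    have h' : (imageSubobject (biprod.desc S.arrow S'.arrow)).Factors
        (biprod.desc S.arrow S'.arrow) := by
      have := Subobject.factors_comp_arrow (factorThruImageSubobject (biprod.desc S.arrow S'.arrow))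
      rwa [imageSubobject_arrow_comp] at this
    refine sup_le (Subobject.le_of_factors ?_) (Subobject.le_of_factors ?_)
    · have := Subobject.factors_of_factors_right biprod.inl h'
      rwa [biprod.inl_desc] at this
    · have := Subobject.factors_of_factors_right biprod.inr h'
      rwa [biprod.inr_desc] at this
  obtain ⟨T', π, hπ, u, hu⟩ := imageSubobject_factors (Subobject.factors_of_le _ hle hz)
  refine ⟨T', π, hπ, (u ≫ biprod.fst) ≫ S.arrow, (u ≫ biprod.snd) ≫ S'.arrow,
    Subobject.factors_comp_arrow _, Subobject.factors_comp_arrow _, ?_⟩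
  rw [hu, biprod.desc_eq, Preadditive.comp_add, Category.assoc, Category.assoc]

lemma factors_comp {X Y T : A} {S : Subobject X} {f : X ⟶ Y} {S' : Subobject Y}
    (h : MapsTo S f S') {z : T ⟶ X} (hz : S.Factors z) : S'.Factors (z ≫ f) := by
  rw [← S.factorThru_arrow _ hz, Category.assoc]
  exact Subobject.factors_of_factors_right _ h

/-- The class of a generalized element of `Z` in the subquotient `Z / B`. -/
def subquotientMk {X T : A} {B Z : Subobject X} (h : B ≤ Z) (z : T ⟶ X) (hz : Z.Factors z) :
    T ⟶ subquotient h := Z.factorThru z hz ≫ subquotientπ h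

section

variable {X Y T T' : A} {B Z : Subobject X} {B' Z' : Subobject Y} (h : B ≤ Z) (h' : B' ≤ Z')

lemma exists_subquotientMk (c : T ⟶ subquotient h) :
    ∃ (T' : A) (π : T' ⟶ T) (_ : Epi π) (z : T' ⟶ X) (hz : Z.Factors z),
      π ≫ c = subquotientMk h z hz := by
  have : Epi (subquotientπ h) := inferInstanceAs (Epi (cokernel.π _))
  obtain ⟨T', π, hπ, z, hz⟩ := surjective_up_to_refinements_of_epi (subquotientπ h) c
  refine ⟨T', π, hπ, z ≫ Z.arrow, Subobject.factors_comp_arrow _, ?_⟩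
  rw [hz, subquotientMk, Subobject.factorThru_comp_arrow]

lemma comp_subquotientMk (a : T' ⟶ T) (z : T ⟶ X) (hz : Z.Factors z) :
    a ≫ subquotientMk h z hz = subquotientMk h (a ≫ z)
      (Subobject.factors_of_factors_right _ hz) := by
  unfold subquotientMk
  rw [← Category.assoc]
  congr 1
  rw [← cancel_mono Z.arrow, Category.assoc, Subobject.factorThru_arrow,
    Subobject.factorThru_arrow]

lemma subquotientMk_add (z z' : T ⟶ X) (hz : Z.Factors z) (hz' : Z.Factors z') :
    subquotientMk h z hz + subquotientMk h z' hz' =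
      subquotientMk h (z + z') (Subobject.factors_add _ _ hz hz') := by
  unfold subquotientMk
  rw [← Preadditive.add_comp]
  congr 1
  rw [← cancel_mono Z.arrow, Preadditive.add_comp, Subobject.factorThru_arrow,
    Subobject.factorThru_arrow, Subobject.factorThru_arrow]

lemma subquotientMk_comp_map (f : X ⟶ Y) (hB : MapsTo B f B') (hZ : MapsTo Z f Z') (z : T ⟶ X)
    (hz : Z.Factors z) : subquotientMk h z hz ≫ subquotientMap h h' f hB hZ =
      subquotientMk h' (z ≫ f) (factors_comp hZ hz) := by
  unfold subquotientMk
  rw [Category.assoc, π_subquotientMap, ← Category.assoc]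
  congr 1
  rw [← cancel_mono Z'.arrow, Category.assoc, MapsTo.lift_arrow, Subobject.factorThru_arrow,
    ← Category.assoc, Subobject.factorThru_arrow]

lemma ofLE_subquotientπ : Subobject.ofLE B Z h ≫ subquotientπ h = 0 := cokernel.condition _

lemma subquotientMk_eq_zero (z : T ⟶ X) (hz : Z.Factors z) (hB : B.Factors z) :
    subquotientMk h z hz = 0 := by
  have : Z.factorThru z hz = B.factorThru z hB ≫ Subobject.ofLE B Z h := by
    rw [← cancel_mono Z.arrow, Category.assoc, Subobject.ofLE_arrow, Subobject.factorThru_arrow,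
      Subobject.factorThru_arrow]
  rw [subquotientMk, this, Category.assoc, ofLE_subquotientπ, comp_zero]

lemma factors_of_subquotientMk_eq_zero (z : T ⟶ X) (hz : Z.Factors z)
    (h0 : subquotientMk h z hz = 0) : ∃ (T' : A) (π : T' ⟶ T) (_ : Epi π), B.Factors (π ≫ z) := by
  obtain ⟨T', π, hπ, x, hx⟩ := (CokernelCofork.IsColimit.comp_π_eq_zero_iff_up_to_refinements
    (cokernelIsCokernel (Subobject.ofLE B Z h)) (Z.factorThru z hz)).1 h0
  refine ⟨T', π, hπ, ?_⟩
  have := hx =≫ Z.arrow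
  rw [Category.assoc, Category.assoc, Subobject.factorThru_arrow, Subobject.ofLE_arrow] at this
  rw [this]
  exact Subobject.factors_comp_arrow _

lemma subquotientMk_eq_iff (z z' : T ⟶ X) (hz : Z.Factors z) (hz' : Z.Factors z')
    (e : subquotientMk h z hz = subquotientMk h z' hz') :
    ∃ (T' : A) (π : T' ⟶ T) (_ : Epi π), B.Factors (π ≫ (z - z')) := by
  have hs : Z.Factors (z - z') := by
    rw [sub_eq_add_neg]
    refine Subobject.factors_add _ _ hz ?_
    have : -z' = (-𝟙 _) ≫ z' := by simp
    rw [this]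
    exact Subobject.factors_of_factors_right _ hz'
  refine factors_of_subquotientMk_eq_zero h _ hs ?_
  have h1 := subquotientMk_add h (z - z') z' hs hz'
  simp only [sub_add_cancel] at h1
  rw [← e] at h1
  simpa using h1

end

end Refinements

/-! ### Membership conditions for the pages `E_r` and the cone criterion -/

section Criterion

variable {A : Type u} [Category.{v} A] [Abelian A]

lemma cyclesZ_factors (K : FiltComplex A) (r p : ℤ) {n m : ℤ} (h : n + 1 = m) {T : A}
    {z : T ⟶ (K.X n).X} : (cyclesZ K r p n).Factors z ↔
      (K.X n).Mem p z ∧ (K.X m).Mem (p - r) (z ≫ (K.d n m).f) := by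
  subst h
  unfold cyclesZ
  rw [Subobject.inf_factors, pullback_factors_iff]
  rfl

/-- Since `(p - 1) - (r - 1) = p - r`, an element of `Z_r^p` that drops one filtration step belongs
to the summand `Z_(r-1)^(p-1)` of `B_r^p`. -/
lemma boundariesB_factors_left (K : FiltComplex A) (r p : ℤ) {n m : ℤ} (h : n + 1 = m) {T : A}
    {z : T ⟶ (K.X n).X} (hz : (K.X n).Mem (p - 1) z)
    (hz' : (K.X m).Mem (p - r) (z ≫ (K.d n m).f)) : (boundariesB K r p n).Factors z :=
  Subobject.factors_of_le _ le_sup_left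
    ((cyclesZ_factors K (r - 1) (p - 1) h).2 ⟨hz, hz'.le (by omega)⟩)

lemma exists_of_boundariesB_factors (K : FiltComplex A) (r p : ℤ) {n m : ℤ} (h : n + 1 = m)
    {T : A} {z : T ⟶ (K.X m).X} (hz : (boundariesB K r p m).Factors z) :
    ∃ (T' : A) (π : T' ⟶ T) (_ : Epi π) (w : T' ⟶ (K.X m).X) (u : T' ⟶ (K.X n).X),
      (K.X m).Mem (p - 1) w ∧ (K.X n).Mem (p + r - 1) u ∧ (K.X m).Mem p (u ≫ (K.d n m).f) ∧
        π ≫ z = w + u ≫ (K.d n m).f := by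
  obtain rfl : n = m - 1 := by omega
  obtain ⟨T₁, π₁, _, w, b, hw, hb, e₁⟩ := sup_factors hz
  obtain ⟨T₂, π₂, _, u, hu, e₂⟩ := imageOf_factors hb
  rw [cyclesZ_factors K _ _ h] at hu
  rw [cyclesZ_factors K _ _ rfl] at hw
  refine ⟨T₂, π₂ ≫ π₁, epi_comp _ _, π₂ ≫ w, u, hw.1.precomp _, hu.1, hu.2.le (by omega), ?_⟩
  rw [Category.assoc, e₁, Preadditive.comp_add, e₂]

/-- Exactness of the page `E_r` of the cone of a morphism, in terms of generalized elements. -/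
def ConeAcyclic (r : ℤ) {K L : FiltComplex A} (f : K ⟶ L) : Prop :=
  ∀ (i j k l : ℤ) (_ : i + 1 = j) (_ : j + 1 = k) (_ : k + 1 = l) (p : ℤ) ⦃T : A⦄
    (x : T ⟶ (K.X k).X) (y : T ⟶ (L.X j).X),
    (K.X k).Mem p x → (K.X l).Mem (p - r - 1) (x ≫ (K.d k l).f) → (L.X j).Mem (p + r) y →
    (L.X k).Mem (p - 1) (x ≫ (f.f k).f - y ≫ (L.d j k).f) →
    ∃ (T' : A) (π : T' ⟶ T) (_ : Epi π) (x' : T' ⟶ (K.X j).X) (y' : T' ⟶ (L.X i).X),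
      (K.X j).Mem (p + r) x' ∧ (L.X i).Mem (p + r + r) y' ∧
      (K.X k).Mem (p - 1) (π ≫ x - x' ≫ (K.d j k).f) ∧
      (L.X j).Mem (p + r - 1) (π ≫ y - x' ≫ (f.f j).f - y' ≫ (L.d i j).f)

lemma comm_f {K L : FiltComplex A} (f : K ⟶ L) (i j : ℤ) :
    (f.f i).f ≫ (L.d i j).f = (K.d i j).f ≫ (f.f j).f :=
  congrArg FiltObj.Hom.f (f.comm i j)

lemma comm_f_apply {K L : FiltComplex A} (f : K ⟶ L) (i j : ℤ) {T : A} (x : T ⟶ (K.X i).X) :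
    (x ≫ (f.f i).f) ≫ (L.d i j).f = (x ≫ (K.d i j).f) ≫ (f.f j).f := by
  rw [Category.assoc, Category.assoc, comm_f]

lemma d_d_apply (K : FiltComplex A) (i j k : ℤ) {T : A} (x : T ⟶ (K.X i).X) :
    (x ≫ (K.d i j).f) ≫ (K.d j k).f = 0 := by
  rw [Category.assoc, d_comp_d_f, comp_zero]

/-- The class in the page `E_r` of a generalized element of `Z_r`. -/
def pageMk (K : FiltComplex A) (r p : ℤ) {n : ℤ} {T : A} (z : T ⟶ (K.X n).X)
    (hz : (cyclesZ K r (p - r * n) n).Factors z) : T ⟶ (pageComplex K r p).X n :=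
  subquotientMk (boundariesB_le K r _ n) z hz

lemma comp_pageMk (K : FiltComplex A) (r p : ℤ) {n : ℤ} {T T' : A} (a : T' ⟶ T)
    (z : T ⟶ (K.X n).X) (hz : (cyclesZ K r (p - r * n) n).Factors z) :
    a ≫ pageMk K r p z hz = pageMk K r p (a ≫ z) (Subobject.factors_of_factors_right _ hz) :=
  comp_subquotientMk _ _ _ _

lemma pageMk_add (K : FiltComplex A) (r p : ℤ) {n : ℤ} {T : A} (z z' : T ⟶ (K.X n).X)
    (hz : (cyclesZ K r (p - r * n) n).Factors z) (hz' : (cyclesZ K r (p - r * n) n).Factors z') :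
    pageMk K r p z hz + pageMk K r p z' hz' =
      pageMk K r p (z + z') (Subobject.factors_add _ _ hz hz') :=
  subquotientMk_add _ _ _ _ _

lemma pageMk_d (K : FiltComplex A) (r p : ℤ) {n m : ℤ} {T : A} (z : T ⟶ (K.X n).X)
    (hz : (cyclesZ K r (p - r * n) n).Factors z) :
    pageMk K r p z hz ≫ (pageComplex K r p).d n m = pageMk K r p (z ≫ (K.d n m).f)
      (factors_comp (cyclesZ_mapsTo_cyclesZ K r _ r _ n m
        (by rintro rfl; exact le_of_eq (by ring))) hz) :=
  subquotientMk_comp_map _ _ _ (boundariesB_mapsTo K r _ _ n m (by rintro rfl; ring)) _ _ _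

/-- The morphism induced on the complexes `(E_r, d_r)`. -/
def pageMap {K L : FiltComplex A} (f : K ⟶ L) (r p : ℤ) :
    pageComplex K r p ⟶ pageComplex L r p := (pageFunctor A r p).map f

lemma pageMk_map {K L : FiltComplex A} (f : K ⟶ L) (r p : ℤ) {n : ℤ} {T : A} (z : T ⟶ (K.X n).X)
    (hz : (cyclesZ K r (p - r * n) n).Factors z) :
    pageMk K r p z hz ≫ (pageMap f r p).f n = pageMk L r p (z ≫ (f.f n).f)
      (factors_comp (hom_mapsTo_cyclesZ f r _ n) hz) :=
  subquotientMk_comp_map _ _ _ (hom_mapsTo_boundariesB f r _ n) _ _ _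

lemma exists_pageMk (K : FiltComplex A) (r p : ℤ) {n : ℤ} {T : A}
    (c : T ⟶ (pageComplex K r p).X n) :
    ∃ (T' : A) (π : T' ⟶ T) (_ : Epi π) (z : T' ⟶ (K.X n).X)
      (hz : (cyclesZ K r (p - r * n) n).Factors z), π ≫ c = pageMk K r p z hz :=
  exists_subquotientMk _ c

lemma pageMk_eq_zero (K : FiltComplex A) (r p : ℤ) {n : ℤ} {T : A} (z : T ⟶ (K.X n).X)
    (hz : (cyclesZ K r (p - r * n) n).Factors z)
    (h : (boundariesB K r (p - r * n) n).Factors z) : pageMk K r p z hz = 0 :=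
  subquotientMk_eq_zero _ _ _ h

lemma pageMk_congr (K : FiltComplex A) (r p : ℤ) {n : ℤ} {T : A} {z z' : T ⟶ (K.X n).X}
    (hz : (cyclesZ K r (p - r * n) n).Factors z) (hz' : (cyclesZ K r (p - r * n) n).Factors z')
    (h : (boundariesB K r (p - r * n) n).Factors (z - z')) :
    pageMk K r p z hz = pageMk K r p z' hz' := by
  have h1 := pageMk_add K r p (z - z') z' (Subobject.factors_of_le _ (boundariesB_le K r _ n) h) hz'
  rw [pageMk_eq_zero _ _ _ _ _ h, zero_add] at h1
  rw [h1]
  congr 1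
  abel

/-- If two generalized elements have the same class in `E_r`, then up to a refinement they differ by
an element of `W_(p - 1)` and a boundary. -/
lemma exists_of_pageMk_eq (K : FiltComplex A) (r p : ℤ) {n m : ℤ} (h : n + 1 = m) {T : A}
    {z z' : T ⟶ (K.X m).X} (hz : (cyclesZ K r (p - r * m) m).Factors z)
    (hz' : (cyclesZ K r (p - r * m) m).Factors z') (e : pageMk K r p z hz = pageMk K r p z' hz') :
    ∃ (T' : A) (π : T' ⟶ T) (_ : Epi π) (w : T' ⟶ (K.X m).X) (u : T' ⟶ (K.X n).X),
      (K.X m).Mem (p - r * m - 1) w ∧ (K.X n).Mem (p - r * m + r - 1) u ∧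
        (K.X m).Mem (p - r * m) (u ≫ (K.d n m).f) ∧
        π ≫ z = π ≫ z' + w + u ≫ (K.d n m).f := by
  obtain ⟨T₁, π₁, _, h₁⟩ := subquotientMk_eq_iff _ _ _ hz hz' e
  obtain ⟨T₂, π₂, _, w, u, hw, hu, hu', e₂⟩ := exists_of_boundariesB_factors K r _ h h₁
  refine ⟨T₂, π₂ ≫ π₁, epi_comp _ _, w, u, hw, hu, hu', ?_⟩
  rw [add_assoc, ← e₂]
  simp

/-- A pair of classes that is a cycle in the cone of `E_r(f)` can be represented by elements
satisfying the sharper bounds of `ConeAcyclic`: the failure of a first choice of representatives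
lies in `B_r`, and its boundary part is absorbed into new representatives of the same classes. -/
lemma quasiIso_of_coneAcyclic (r : ℕ) {K L : FiltComplex A} (f : K ⟶ L)
    (hf : ConeAcyclic r f) : pageQuasiIso A r f := by
  intro P
  change QuasiIso (pageMap f r P)
  rw [quasiIso_iff_cone]
  intro i j k l hij hjk hkl T x y hx hxy
  have ej : P - r * j = P - r * k + r := by subst hjk; ring
  have ei : P - r * i = P - r * k + r + r := by subst hjk; subst hij; ring
  have el : P - r * l = P - r * k - r := by subst hkl; ring
  obtain ⟨T₁, π₁, _, z, hz, e₁⟩ := exists_pageMk K r P x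
  obtain ⟨T₂, π₂, _, w, hw, e₂⟩ := exists_pageMk L r P (π₁ ≫ y)
  have hz₂ := Subobject.factors_of_factors_right π₂ hz
  have e₃ : pageMk K r P _ (factors_comp (cyclesZ_mapsTo_cyclesZ K r _ r _ k l
        (by rintro rfl; exact le_of_eq (by ring))) hz₂) = pageMk K r P 0 Subobject.factors_zero := by
    rw [← pageMk_d (K := K) (hz := hz₂), ← comp_pageMk (hz := hz), ← e₁, Category.assoc,
      Category.assoc, hx, comp_zero, comp_zero]
    exact (pageMk_eq_zero K r P _ _ Subobject.factors_zero).symm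
  -- With `p = P - rk`, vanishing of `d_r` on the class of `z` means `dz = a + db` with `a ∈
  -- W_(p-r-1)` and `b ∈ W_(p-1)`.
  obtain ⟨T₃, π₃, _, a, b, ha, hb, hb', e₃⟩ := exists_of_pageMk_eq K r P hkl _ _ e₃
  rw [el] at ha hb hb'
  have hz' := (cyclesZ_factors K _ _ hkl).1 hz
  -- the corrected element, whose differential lies one step lower
  have e₃' : (π₃ ≫ π₂ ≫ z - b) ≫ (K.d k l).f = a := by
    have : π₃ ≫ π₂ ≫ z ≫ (K.d k l).f = a + b ≫ (K.d k l).f := by simpa using e₃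
    simp only [Preadditive.sub_comp, Category.assoc, this, add_sub_cancel_right]
  have hx₀ : (cyclesZ K r (P - r * k) k).Factors (π₃ ≫ π₂ ≫ z - b) := by
    refine (cyclesZ_factors K _ _ hkl).2 ⟨((hz'.1.precomp _).precomp _).sub (hb.le (by omega)), ?_⟩
    rw [e₃']
    exact ha.le (by omega)
  have f₁ : (π₃ ≫ π₂ ≫ π₁) ≫ x = pageMk K r P _ hx₀ := by
    rw [Category.assoc, Category.assoc, e₁, comp_pageMk, comp_pageMk]
    refine pageMk_congr _ _ _ _ _ (boundariesB_factors_left K _ _ hkl ?_ ?_)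
    · rw [sub_sub_cancel]; exact hb.le (by omega)
    · rw [sub_sub_cancel]; exact hb'.le (by omega)
  have f₂ : (π₃ ≫ π₂ ≫ π₁) ≫ y = pageMk L r P (π₃ ≫ w) (Subobject.factors_of_factors_right _ hw) := by
    rw [Category.assoc, Category.assoc, e₂, comp_pageMk]
  have f₃ := (π₃ ≫ π₂ ≫ π₁) ≫= hxy
  rw [← Category.assoc _ x, ← Category.assoc _ y, f₁, f₂, pageMk_map, pageMk_d] at f₃
  -- The second cycle equation gives an error `w₁ ∈ W_(p-1)` and a boundary `du₁` with `u₁ ∈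
  -- W_(p+r-1)`. Replacing `w` by `w + u₁` removes the boundary and keeps the class.
  obtain ⟨T₄, π₄, _, w₁, u₁, hw₁, hu₁, hu₁', e₄⟩ := exists_of_pageMk_eq L r P hjk _ _ f₃
  rw [cyclesZ_factors K _ _ hkl, e₃'] at hx₀
  have hw' := (cyclesZ_factors L _ _ hjk).1 hw
  rw [ej] at hw'
  have hy₁ : (L.X j).Mem (P - r * k + r) (π₄ ≫ π₃ ≫ w + u₁) :=
    ((hw'.1.precomp _).precomp _).add (hu₁.le (by omega))
  have e₅ : (π₄ ≫ (π₃ ≫ π₂ ≫ z - b)) ≫ (f.f k).f - (π₄ ≫ π₃ ≫ w + u₁) ≫ (L.d j k).f = w₁ := by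
    have := e₄
    simp only [Category.assoc] at this
    rw [Category.assoc, this]
    simp only [Preadditive.add_comp, Category.assoc]
    abel
  obtain ⟨T₅, π₅, _, x', y', hx', hy', h₁, h₂⟩ := hf i j k l hij hjk hkl (P - r * k)
    (π₄ ≫ (π₃ ≫ π₂ ≫ z - b)) (π₄ ≫ π₃ ≫ w + u₁) (hx₀.1.precomp _)
    (by rw [Category.assoc, e₃']; exact (ha.le (by omega)).precomp _) hy₁
    (by rw [e₅]; exact hw₁)
  have hx'd : (K.X k).Mem (P - r * k) (x' ≫ (K.d j k).f) := by
    have := ((hx₀.1.precomp π₄).precomp π₅).sub (h₁.le (q := P - r * k) (by omega))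
    rwa [sub_sub_cancel] at this
  have hx'' : (cyclesZ K r (P - r * j) j).Factors x' :=
    (cyclesZ_factors K _ _ hjk).2 ⟨hx'.le (by omega), hx'd.le (by omega)⟩
  have hy'd : (L.X j).Mem (P - r * k + r) (y' ≫ (L.d i j).f) := by
    have h3 := ((hy₁.precomp π₅).sub (hx'.map (f.f j))).sub (h₂.le (q := P - r * k + r) (by omega))
    rwa [sub_sub_cancel] at h3
  have hy'' : (cyclesZ L r (P - r * i) i).Factors y' :=
    (cyclesZ_factors L _ _ hij).2 ⟨hy'.le (by omega), hy'd.le (by omega)⟩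
  refine ⟨T₅, π₅ ≫ π₄ ≫ π₃ ≫ π₂ ≫ π₁, inferInstance, pageMk K r P x' hx'', pageMk L r P y' hy'',
    ?_, ?_⟩
  · rw [Category.assoc, Category.assoc, f₁, comp_pageMk, comp_pageMk]
    rw [pageMk_d]
    refine pageMk_congr _ _ _ _ _ (boundariesB_factors_left K _ _ hkl h₁ ?_)
    rw [Preadditive.sub_comp, d_d_apply, sub_zero, Category.assoc, Category.assoc, e₃']
    exact ((ha.precomp _).precomp _).le (by omega)
  · have g₁ : (π₄ ≫ π₃ ≫ π₂ ≫ π₁) ≫ y = pageMk L r P (π₄ ≫ π₃ ≫ w + u₁)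
        ((cyclesZ_factors L _ _ hjk).2 ⟨hy₁.le (by omega), by
          have := ((((hx₀.1.precomp π₄).map (f.f k))).sub (hw₁.le (q := P - r * k) (by omega)))
          rw [← e₅, sub_sub_cancel] at this
          exact this.le (by omega)⟩) := by
      rw [Category.assoc, f₂, comp_pageMk]
      refine pageMk_congr _ _ _ _ _ (boundariesB_factors_left L _ _ hjk ?_ ?_)
      · rw [sub_add_cancel_left]; exact (hu₁.le (by omega)).neg
      · rw [sub_add_cancel_left, Preadditive.neg_comp]; exact (hu₁'.le (by omega)).neg
    rw [Category.assoc, g₁, comp_pageMk]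
    rw [pageMk_d, pageMk_map, pageMk_add]
    refine pageMk_congr _ _ _ _ _ (boundariesB_factors_left L _ _ hjk ?_ ?_)
    · rw [← sub_sub]; exact h₂.le (by omega)
    -- The differential of `y - f x' - dy'` equals `f(x - dx') - (f x - dy)`, a difference of two
    -- elements already known to lie in `W_(p-1)`.
    · have h3 := (h₁.map (f.f k)).sub (hw₁.precomp π₅)
      rw [← e₅] at h3
      refine FiltObj.Mem.le (p := P - r * k - 1) ?_ (by omega)
      convert h3 using 1
      simp only [Preadditive.sub_comp, Preadditive.add_comp, Preadditive.comp_sub,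
        Preadditive.comp_add, Category.assoc, comm_f, d_comp_d_f, comp_zero]
      abel

/-- The passage between the class `E_r` and elementwise conditions; after it no quotient has to be
handled in the verification of exactness, `μ`, `λ` and acyclicity. -/
lemma pageQuasiIso_iff (r : ℕ) {K L : FiltComplex A} (f : K ⟶ L) :
    pageQuasiIso A r f ↔ ConeAcyclic r f := by
  refine ⟨fun h => ?_, quasiIso_of_coneAcyclic r f⟩
  intro i j k l hij hjk hkl p T x y hx hdx hy hxy
  -- The summand of the page complex that has filtration degree `p` in total degree `k`.
  obtain ⟨P, rfl⟩ : ∃ P, p = P - r * k := ⟨p + r * k, by ring⟩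
  have ej : P - r * j = P - r * k + r := by subst hjk; ring
  have ei : P - r * i = P - r * k + r + r := by subst hjk; subst hij; ring
  have el : P - r * l = P - r * k - r := by subst hkl; ring
  have hxZ : (cyclesZ K r (P - r * k) k).Factors x :=
    (cyclesZ_factors K _ _ hkl).2 ⟨hx, hdx.le (by omega)⟩
  have hyZ : (cyclesZ L r (P - r * j) j).Factors y := by
    refine (cyclesZ_factors L _ _ hjk).2 ⟨hy.le (by omega), ?_⟩
    have := (hx.map (f.f k)).sub (hxy.le (q := P - r * k) (by omega))
    rw [sub_sub_cancel] at this
    exact this.le (by omega)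
  obtain ⟨T₁, π₁, _, c, c', h₁, h₂⟩ := (quasiIso_iff_cone (pageMap f r P)).1 (h P) i j k l hij hjk hkl
    (pageMk K r P x hxZ) (pageMk L r P y hyZ) (by
      rw [pageMk_d]
      refine pageMk_eq_zero _ _ _ _ _ (boundariesB_factors_left K _ _ rfl (hdx.le (by omega)) ?_)
      rw [d_d_apply]
      exact FiltObj.Mem.zero) (by
      rw [pageMk_map, pageMk_d]
      refine pageMk_congr _ _ _ _ _ (boundariesB_factors_left L _ _ hkl hxy ?_)
      rw [Preadditive.sub_comp, d_d_apply, sub_zero, comm_f_apply]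
      exact (hdx.map _).le (by omega))
  obtain ⟨T₂, π₂, _, x₁, hx₁, e₁⟩ := exists_pageMk K r P c
  obtain ⟨T₃, π₃, _, y₁, hy₁, e₂⟩ := exists_pageMk L r P (π₂ ≫ c')
  have e₁' : (π₃ ≫ π₂) ≫ c = pageMk K r P (π₃ ≫ x₁) (Subobject.factors_of_factors_right _ hx₁) := by
    rw [Category.assoc, e₁, comp_pageMk]
  rw [← Category.assoc] at e₂
  have h₁' := (π₃ ≫ π₂) ≫= h₁
  have h₂' := (π₃ ≫ π₂) ≫= h₂
  rw [← Category.assoc _ c, e₁', comp_pageMk, comp_pageMk, pageMk_d] at h₁'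
  rw [Preadditive.comp_add, ← Category.assoc _ c, ← Category.assoc _ c', e₁', e₂, comp_pageMk,
    comp_pageMk, pageMk_map, pageMk_d, pageMk_add] at h₂'
  obtain ⟨T₄, π₄, _, w, u, hw, hu, hu', e₃⟩ := exists_of_pageMk_eq K r P hjk _ _ h₁'
  have h₂'' := π₄ ≫= h₂'
  rw [comp_pageMk, comp_pageMk] at h₂''
  obtain ⟨T₅, π₅, _, w', u', hw', hu', hu'', e₄⟩ := exists_of_pageMk_eq L r P hij _ _ h₂''
  rw [ej] at hw' hu'
  rw [cyclesZ_factors K _ _ hjk, ej] at hx₁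
  rw [cyclesZ_factors L _ _ hij, ei] at hy₁
  -- The representatives `x₁`, `y₁` solve the equations only modulo `B_r`, so the boundary parts
  -- `u`, `u'` are added to them. The new error `f u` in the second equation is harmless, because `u
  -- ∈ W_(p+r-1)`.
  refine ⟨T₅, π₅ ≫ π₄ ≫ π₃ ≫ π₂ ≫ π₁, inferInstance, π₅ ≫ (π₄ ≫ π₃ ≫ x₁ + u), π₅ ≫ π₄ ≫ y₁ + u',
    ?_, ?_, ?_, ?_⟩
  · exact ((((hx₁.1.precomp _).precomp _).add (hu.le (by omega))).precomp _)
  · exact (((hy₁.1.precomp _).precomp _).add (hu'.le (by omega)))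
  · convert hw.precomp π₅ using 1
    have := π₅ ≫= e₃
    simp only [Category.assoc, Preadditive.comp_add] at this
    simp only [Category.assoc, Preadditive.comp_add, Preadditive.add_comp, this]
    abel
  · convert hw'.sub ((hu.map (f.f j)).precomp π₅ |>.le (q := P - r * k + r - 1) (by omega)) using 1
    have := e₄
    simp only [Category.assoc, Preadditive.comp_add] at this
    simp only [Category.assoc, Preadditive.comp_add, Preadditive.add_comp, this]
    abel

end Criterion

/-! ### The `r`-simple in components -/

section SimpleElements

attribute [local instance] Abelian.hasFiniteBiproducts

variable {A : Type u} [Category.{v} A] [Abelian A]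

/-- The canonical isomorphism `K^i ⟶ K^j` if `i = j`, and zero otherwise. -/
def dc (K : FiltComplex A) (i j : ℤ) : (K.X i).X ⟶ (K.X j).X := (degCast K i j).f

lemma dc_self (K : FiltComplex A) (i : ℤ) : dc K i i = 𝟙 _ := by
  rw [dc, degCast_self]; rfl

lemma dc_eq_zero (K : FiltComplex A) {i j : ℤ} (h : i ≠ j) : dc K i j = 0 := by
  rw [dc, degCast_eq_zero K h]; rfl

lemma dc_comm {K L : FiltComplex A} (f : K ⟶ L) (i j : ℤ) :
    (f.f i).f ≫ dc L i j = dc K i j ≫ (f.f j).f :=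
  congrArg FiltObj.Hom.f (degCast_comm f i j)

lemma dc_comm_assoc {K L : FiltComplex A} (f : K ⟶ L) (i j : ℤ) {T : A} (g : (L.X j).X ⟶ T) :
    (f.f i).f ≫ dc L i j ≫ g = dc K i j ≫ (f.f j).f ≫ g := by
  rw [← Category.assoc, dc_comm, Category.assoc]

lemma dc_trans (K : FiltComplex A) {i j : ℤ} (h : i = j) (k : ℤ) :
    dc K i j ≫ dc K j k = dc K i k :=
  congrArg FiltObj.Hom.f (degCast_trans K h k)

lemma dc_trans_assoc (K : FiltComplex A) {i j : ℤ} (h : i = j) (k : ℤ) {T : A}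
    (g : (K.X k).X ⟶ T) : dc K i j ≫ dc K j k ≫ g = dc K i k ≫ g := by
  rw [← Category.assoc, dc_trans K h]

lemma dc_trans' (K : FiltComplex A) {j k : ℤ} (h : j = k) (i : ℤ) :
    dc K i j ≫ dc K j k = dc K i k := by
  subst h; rw [dc_self, Category.comp_id]

lemma dc_d (K : FiltComplex A) {i j i' j' : ℤ} (h : j - i = j' - i') :
    dc K i i' ≫ (K.d i' j').f = (K.d i j).f ≫ dc K j j' := by
  by_cases hi : i = i'
  · subst hi
    obtain rfl : j = j' := by omega
    rw [dc_self, dc_self, Category.id_comp, Category.comp_id]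
  · rw [dc_eq_zero K hi, dc_eq_zero K (by omega), zero_comp, comp_zero]

lemma FiltObj.Mem.dc {K : FiltComplex A} {i p : ℤ} {T : A} {x : T ⟶ (K.X i).X}
    (h : (K.X i).Mem p x) (j : ℤ) : (K.X j).Mem p (x ≫ dc K i j) :=
  h.map _

lemma degCast_forgetComplex (K : FiltComplex A) (i j : ℤ) :
    degCast (forgetComplex.obj K) i j = dc K i j := by
  by_cases h : i = j
  · subst h; rw [degCast_self, dc_self]; rfl
  · rw [degCast_eq_zero _ h, dc_eq_zero K h]; rfl

variable (r : ℕ)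

/-- The projection of the simple complex onto the summand of `α`. -/
def proj {P : Cube} (X : P.Idx ⥤ FiltComplex A) (n : ℤ) (α : P.Idx) :
    ((rSimpleComplex r X).X n).X ⟶ ((X.obj α).X (n - α.dim)).X :=
  biproduct.π (fun α : P.Idx => ((X ⋙ forgetComplex).obj α).X (n - α.dim)) α

/-- The generalized element of the simple complex with given components. -/
def ofProj {P : Cube} (X : P.Idx ⥤ FiltComplex A) (n : ℤ) {T : A}
    (x : ∀ α : P.Idx, T ⟶ ((X.obj α).X (n - α.dim)).X) : T ⟶ ((rSimpleComplex r X).X n).X :=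
  biproduct.lift (f := fun α : P.Idx => ((X ⋙ forgetComplex).obj α).X (n - α.dim)) x

lemma ofProj_proj {P : Cube} (X : P.Idx ⥤ FiltComplex A) (n : ℤ) {T : A}
    (x : ∀ α : P.Idx, T ⟶ ((X.obj α).X (n - α.dim)).X) (α : P.Idx) :
    ofProj r X n x ≫ proj r X n α = x α :=
  biproduct.lift_π (f := fun α : P.Idx => ((X ⋙ forgetComplex).obj α).X (n - α.dim)) x α

variable {r}

lemma proj_ext {P : Cube} {X : P.Idx ⥤ FiltComplex A} {n : ℤ} {T : A}
    {x y : T ⟶ ((rSimpleComplex r X).X n).X} (h : ∀ α, x ≫ proj r X n α = y ≫ proj r X n α) :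
    x = y :=
  biproduct.hom_ext (f := fun α : P.Idx => ((X ⋙ forgetComplex).obj α).X (n - α.dim)) _ _ h

lemma hom_ext_proj {P : Cube} {X : P.Idx ⥤ FiltComplex A} {K : FiltComplex A}
    {f g : K ⟶ rSimpleComplex r X}
    (h : ∀ n α, (f.f n).f ≫ proj r X n α = (g.f n).f ≫ proj r X n α) : f = g :=
  HomologicalComplex.hom_ext _ _ fun n => FiltObj.hom_ext (proj_ext (h n))

lemma mem_rSimple_iff {P : Cube} {X : P.Idx ⥤ FiltComplex A} {n p : ℤ} {T : A}
    {x : T ⟶ ((rSimpleComplex r X).X n).X} : ((rSimpleComplex r X).X n).Mem p x ↔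
      ∀ α : P.Idx, ((X.obj α).X (n - α.dim)).Mem (p + r * α.dim) (x ≫ proj r X n α) :=
  directSum_factors (f := fun α : P.Idx => ((X ⋙ forgetComplex).obj α).X (n - α.dim)) _ _

lemma matrix_π_eq_sum {I J : Type} [Fintype I] [Fintype J] {f : I → A} {g : J → A}
    (m : ∀ i j, f i ⟶ g j) (j : J) :
    biproduct.matrix m ≫ biproduct.π g j = ∑ i, biproduct.π f i ≫ m i j := by
  classical
  rw [biproduct.matrix_π]
  ext i
  rw [Preadditive.comp_sum, biproduct.ι_desc, Finset.sum_eq_single i]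
  · rw [biproduct.ι_π_self_assoc]
  · intro b _ hb
    rw [biproduct.ι_π_ne_assoc _ (Ne.symm hb), zero_comp]
  · simp

open Classical in
/-- The part of the differential of the simple complex that raises the dimension of the faces. -/
def cubeTerm {P : Cube} (X : P.Idx ⥤ FiltComplex A) (n m : ℤ) (α β : P.Idx) :
    ((X.obj α).X (n - α.dim)).X ⟶ ((X.obj β).X (m - β.dim)).X :=
  if h : α ≤ β then
    α.incidence β • (((X.map (homOfLE h)).f (n - α.dim)).f ≫ dc (X.obj β) (n - α.dim) (m - β.dim))
  else 0

lemma cubeTerm_of_le {P : Cube} (X : P.Idx ⥤ FiltComplex A) (n m : ℤ) {α β : P.Idx} (h : α ≤ β) :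
    cubeTerm X n m α β = α.incidence β •
      (((X.map (homOfLE h)).f (n - α.dim)).f ≫ dc (X.obj β) (n - α.dim) (m - β.dim)) :=
  dif_pos h

lemma cubeTerm_of_not_le {P : Cube} (X : P.Idx ⥤ FiltComplex A) (n m : ℤ) {α β : P.Idx}
    (h : ¬ α ≤ β) : cubeTerm X n m α β = 0 :=
  dif_neg h

/-- The cast runs between the degrees `n - |α|` and `n + 1 - |β|`, which agree only in codimension
one. -/
lemma cubeTerm_of_dim_ne {P : Cube} (X : P.Idx ⥤ FiltComplex A) {n m : ℤ} (hnm : n + 1 = m)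
    {α β : P.Idx} (h : β.dim ≠ α.dim + 1) : cubeTerm X n m α β = 0 := by
  by_cases hle : α ≤ β
  · rw [cubeTerm_of_le X n m hle, dc_eq_zero _ (by omega), comp_zero, smul_zero]
  · exact cubeTerm_of_not_le X n m hle

/-- A strict inclusion of faces raises the dimension, so the internal differential has no component
off the diagonal. -/
lemma simpleEntry_eq {P : Cube} (X : P.Idx ⥤ FiltComplex A) {n m : ℤ} (hnm : n + 1 = m)
    {α β : P.Idx} (h : α ≠ β) :
    simpleEntry (X ⋙ forgetComplex) n m α β = cubeTerm X n m α β := by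
  unfold simpleEntry cubeTerm
  split_ifs with hle
  · have hlt : α.dim ≠ β.dim := fun e => h (Idx.eq_of_le_of_dim_le hle e.ge)
    have hd : ((X ⋙ forgetComplex).obj β).d (n - α.dim) (m - β.dim) = 0 :=
      HomologicalComplex.shape _ _ _ (by simp; omega)
    rw [cubeDiff, hd, smul_zero, zero_add, Preadditive.comp_zsmul]
    congr 2
    exact degCast_forgetComplex _ _ _
  · rfl

lemma simpleEntry_self {P : Cube} (X : P.Idx ⥤ FiltComplex A) {n m : ℤ} (hnm : n + 1 = m)
    (β : P.Idx) : simpleEntry (X ⋙ forgetComplex) n m β β =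
      ((-1 : ℤ) ^ β.dim) • ((X.obj β).d (n - β.dim) (m - β.dim)).f := by
  unfold simpleEntry
  rw [dif_pos le_rfl, map_le_refl, cubeDiff, degCast_eq_zero _ (by omega), smul_zero, add_zero]
  exact Category.id_comp _

/-- The differential of the simple complex in terms of the components. -/
lemma d_proj {P : Cube} (X : P.Idx ⥤ FiltComplex A) {n m : ℤ} (hnm : n + 1 = m) (β : P.Idx) :
    ((rSimpleComplex r X).d n m).f ≫ proj r X m β =
      ((-1 : ℤ) ^ β.dim) • (proj r X n β ≫ ((X.obj β).d (n - β.dim) (m - β.dim)).f) +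
        ∑ α, proj r X n α ≫ cubeTerm X n m α β := by
  have h1 : ((rSimpleComplex r X).d n m).f ≫ proj r X m β =
      ∑ α, proj r X n α ≫ simpleEntry (X ⋙ forgetComplex) n m α β := by
    refine Eq.trans ?_ (matrix_π_eq_sum (simpleEntry (X ⋙ forgetComplex) n m) β)
    refine congrArg (· ≫ proj r X m β) ?_
    exact if_pos hnm
  rw [h1, ← Finset.add_sum_erase _ _ (Finset.mem_univ β),
    ← Finset.add_sum_erase _ (fun α => proj r X n α ≫ cubeTerm X n m α β) (Finset.mem_univ β),
    simpleEntry_self X hnm, cubeTerm_of_dim_ne X hnm (by omega), comp_zero, zero_add]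
  congr 1
  · exact Preadditive.comp_zsmul _ _ _
  · exact Finset.sum_congr rfl fun α hα =>
      congrArg (proj r X n α ≫ ·) (simpleEntry_eq X hnm (Finset.ne_of_mem_erase hα))

variable (r)

/-- The morphism of simples induced by a natural transformation. -/
def sMap {P : Cube} {X Y : P.Idx ⥤ FiltComplex A} (a : X ⟶ Y) :
    rSimpleComplex r X ⟶ rSimpleComplex r Y := (simpleAt (rSimple A r) P).map a

/-- The morphism of simples induced by a morphism of cubes. -/
def sRes {P P' : Cube} (u : P' ⟶ P) (X : P.Idx ⥤ FiltComplex A) :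
    rSimpleComplex r X ⟶ rSimpleComplex r (u.functor ⋙ X) := simpleRestrict (rSimple A r) u X

/-- A morphism of codiagrams feeds the summand of `β` from the single summand of `δ(β)`, so the
matrix sum has one term. The action of natural transformations and of morphisms of cubes are both
read off from this formula. -/
lemma rSimple_map_proj {K L : CoDiag (FiltComplex A)} (f : K ⟶ L) (n : ℤ) (β : L.P.Idx) :
    (((rSimple A r).map f).f n).f ≫ proj r L.X n β = (CoDiag.Hom.δ f).sign β •
      (proj r K.X n ((CoDiag.Hom.δ f).map β) ≫ ((CoDiag.Hom.app f β).f _).f ≫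
        dc (L.X.obj β) (n - ((CoDiag.Hom.δ f).map β).dim) (n - β.dim)) := by
  let e : ∀ (α : K.P.Idx) (β : L.P.Idx),
      ((K.X.obj α).X (n - α.dim)).X ⟶ ((L.X.obj β).X (n - β.dim)).X :=
    simpleMapEntry ((CoDiag.mapFunctor forgetComplex).map f) n
  refine Eq.trans (b := ∑ α, proj r K.X n α ≫ e α β)
    (matrix_π_eq_sum (simpleMapEntry ((CoDiag.mapFunctor forgetComplex).map f) n) β) ?_
  rw [Finset.sum_eq_single ((CoDiag.Hom.δ f).map β)]
  · have h0 : e ((CoDiag.Hom.δ f).map β) β = (CoDiag.Hom.δ f).sign β •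
        (((CoDiag.Hom.app f β).f _).f ≫
          dc (L.X.obj β) (n - ((CoDiag.Hom.δ f).map β).dim) (n - β.dim)) := by
      have h1 : (K.X ⋙ forgetComplex).map (homOfLE (le_refl ((CoDiag.Hom.δ f).map β))) ≫
          forgetComplex.map (CoDiag.Hom.app f β) = forgetComplex.map (CoDiag.Hom.app f β) :=
        (congrArg (· ≫ _) (map_le_refl _ _)).trans (Category.id_comp _)
      refine (dif_pos rfl).trans ?_
      refine (congrArg (fun φ : (K.X ⋙ forgetComplex).obj ((CoDiag.Hom.δ f).map β) ⟶
        forgetComplex.obj (L.X.obj β) => (CoDiag.Hom.δ f).sign β • (φ.f _ ≫ degCast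
          (forgetComplex.obj (L.X.obj β)) _ _)) h1).trans ?_
      rw [degCast_forgetComplex]
      rfl
    rw [h0]
    exact Preadditive.comp_zsmul _ _ _
  · intro α _ h
    have : e α β = 0 := dif_neg h
    rw [this, comp_zero]
  · exact fun h => absurd (Finset.mem_univ _) h

/-- Faces such as `β` and its image under the identity are equal without being interchangeable in
types; the structure map between them is traded here for an identification of degrees. -/
lemma proj_map_of_eq {P : Cube} (X : P.Idx ⥤ FiltComplex A) (n : ℤ) {α β : P.Idx} (h : α = β) :
    proj r X n α ≫ ((X.map (homOfLE h.le)).f (n - α.dim)).f =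
      proj r X n β ≫ dc (X.obj β) (n - β.dim) (n - α.dim) := by
  subst h
  rw [dc_self, map_le_refl]
  rfl

lemma sMap_proj {P : Cube} {X Y : P.Idx ⥤ FiltComplex A} (a : X ⟶ Y) (n : ℤ) (β : P.Idx) :
    ((sMap r a).f n).f ≫ proj r Y n β = proj r X n β ≫ ((a.app β).f (n - β.dim)).f := by
  refine (rSimple_map_proj r ((CoDiag.incl P).map a) n β).trans ?_
  have h : Hom.map (𝟙 P) β = β := Hom.map_id β
  have h2 : (Hom.map (𝟙 P) β).dim = β.dim := by rw [h]
  refine (congrArg₂ (fun (x : ℤ) y => x • y) (Hom.sign_id β) ?_).trans (one_smul _ _)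
  change proj r X n (Hom.map (𝟙 P) β) ≫ (((X.map (homOfLE h.le)).f _).f ≫ ((a.app β).f _).f) ≫
    dc (Y.obj β) _ _ = _
  rw [Category.assoc, ← Category.assoc, proj_map_of_eq r X n h, dc_comm, Category.assoc,
    dc_trans_assoc _ (by omega)]
  exact congrArg (proj r X n β ≫ ·) ((congrArg (· ≫ _) (dc_self _ _)).trans (Category.id_comp _))

lemma sRes_proj {P P' : Cube} (u : P' ⟶ P) (X : P.Idx ⥤ FiltComplex A) (n : ℤ) (β : P'.Idx) :
    ((sRes r u X).f n).f ≫ proj r (u.functor ⋙ X) n β =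
      u.sign β • (proj r X n (u.map β) ≫ dc (X.obj (u.map β)) _ _) := by
  refine (rSimple_map_proj r (CoDiag.restrict u X) n β).trans ?_
  congr 2
  exact Category.id_comp _

end SimpleElements

/-! ### Exactness of the `r`-simple, by induction over the faces -/

section Exactness

attribute [local instance] Abelian.hasFiniteBiproducts

variable {A : Type u} [Category.{v} A] [Abelian A] (r : ℕ)

/-- The inclusion of the summand of `α` in the simple complex. -/
def incl {P : Cube} (X : P.Idx ⥤ FiltComplex A) (n : ℤ) (α : P.Idx) :
    ((X.obj α).X (n - α.dim)).X ⟶ ((rSimpleComplex r X).X n).X :=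
  biproduct.ι (fun α : P.Idx => ((X ⋙ forgetComplex).obj α).X (n - α.dim)) α

lemma incl_proj_self {P : Cube} (X : P.Idx ⥤ FiltComplex A) (n : ℤ) (α : P.Idx) :
    incl r X n α ≫ proj r X n α = 𝟙 _ :=
  biproduct.ι_π_self _ _

lemma incl_proj_ne {P : Cube} (X : P.Idx ⥤ FiltComplex A) (n : ℤ) {α β : P.Idx} (h : α ≠ β) :
    incl r X n α ≫ proj r X n β = 0 :=
  biproduct.ι_π_ne _ h

lemma incl_d_proj_self {P : Cube} (X : P.Idx ⥤ FiltComplex A) {n m : ℤ} (hnm : n + 1 = m)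
    (α : P.Idx) : incl r X n α ≫ ((rSimpleComplex r X).d n m).f ≫ proj r X m α =
      ((-1 : ℤ) ^ α.dim) • ((X.obj α).d (n - α.dim) (m - α.dim)).f := by
  rw [d_proj X hnm, Preadditive.comp_add, Preadditive.comp_sum, Finset.sum_eq_zero, add_zero,
    Preadditive.comp_zsmul, ← Category.assoc, incl_proj_self, Category.id_comp]
  intro β _
  by_cases h : α = β
  · subst h; rw [cubeTerm_of_dim_ne X hnm (by omega), comp_zero, comp_zero]
  · rw [← Category.assoc, incl_proj_ne r X n h, zero_comp]

lemma incl_d_proj_ne {P : Cube} (X : P.Idx ⥤ FiltComplex A) {n m : ℤ} (hnm : n + 1 = m)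
    {α β : P.Idx} (h : α ≠ β) : incl r X n α ≫ ((rSimpleComplex r X).d n m).f ≫ proj r X m β =
      cubeTerm X n m α β := by
  rw [d_proj X hnm, Preadditive.comp_add, Preadditive.comp_sum, Finset.sum_eq_single α,
    Preadditive.comp_zsmul, ← Category.assoc, incl_proj_ne r X n h, zero_comp, smul_zero, zero_add,
    ← Category.assoc, incl_proj_self, Category.id_comp]
  · intro γ _ hγ
    rw [← Category.assoc, incl_proj_ne r X n (Ne.symm hγ), zero_comp]
  · exact fun h => absurd (Finset.mem_univ _) h

variable {r}

lemma FiltObj.Mem.incl {P : Cube} {X : P.Idx ⥤ FiltComplex A} {n p : ℤ} {α : P.Idx} {T : A}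
    {z : T ⟶ ((X.obj α).X (n - α.dim)).X}
    (h : ((X.obj α).X (n - α.dim)).Mem (p + r * α.dim) z) :
    ((rSimpleComplex r X).X n).Mem p (z ≫ incl r X n α) := by
  rw [mem_rSimple_iff]
  intro β
  rw [Category.assoc]
  by_cases e : α = β
  · subst e; rwa [incl_proj_self, Category.comp_id]
  · rw [incl_proj_ne r X n e, comp_zero]; exact FiltObj.Mem.zero

lemma FiltObj.Mem.cubeTerm {P : Cube} {X : P.Idx ⥤ FiltComplex A} {n q : ℤ} {α : P.Idx} {T : A}
    {z : T ⟶ ((X.obj α).X (n - α.dim)).X} (h : ((X.obj α).X (n - α.dim)).Mem q z) (m : ℤ)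
    (β : P.Idx) : ((X.obj β).X (m - β.dim)).Mem q (z ≫ cubeTerm X n m α β) := by
  by_cases hle : α ≤ β
  · rw [cubeTerm_of_le X n m hle, Preadditive.comp_zsmul, ← Category.assoc]
    exact ((h.map _).dc _).zsmul _
  · rw [cubeTerm_of_not_le X n m hle, comp_zero]; exact FiltObj.Mem.zero

/-- If the components of `x` on the proper faces of `α` lie one step lower in the filtration, then
so does the part of the differential of `x` that comes from these faces. -/
lemma mem_sum_cubeTerm {P : Cube} {X : P.Idx ⥤ FiltComplex A} {n m q : ℤ} (hnm : n + 1 = m)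
    {α : P.Idx} {T : A} {x : T ⟶ ((rSimpleComplex r X).X n).X}
    (h : ∀ β < α, ((X.obj β).X (n - β.dim)).Mem (q + r * β.dim) (x ≫ proj r X n β)) :
    ((X.obj α).X (m - α.dim)).Mem (q - r + r * α.dim)
      (∑ β, (x ≫ proj r X n β) ≫ cubeTerm X n m β α) := by
  refine FiltObj.Mem.sum fun β _ => ?_
  by_cases hle : β ≤ α
  · by_cases hd : α.dim = β.dim + 1
    · refine ((h β (lt_of_le_of_ne hle ?_)).cubeTerm m α).le ?_
      · rintro rfl; omega
      · rw [hd]; push_cast; linarith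
    · rw [cubeTerm_of_dim_ne X hnm hd, comp_zero]; exact FiltObj.Mem.zero
  · rw [cubeTerm_of_not_le X n m hle, comp_zero]; exact FiltObj.Mem.zero

lemma neg_one_pow_smul_smul {X Y : A} (n : ℕ) (f : X ⟶ Y) :
    ((-1 : ℤ) ^ n) • ((-1 : ℤ) ^ n) • f = f := by
  rw [smul_smul, ← mul_pow]; simp

lemma apply_d_proj {P : Cube} {X : P.Idx ⥤ FiltComplex A} {n m : ℤ} (hnm : n + 1 = m) (β : P.Idx)
    {T : A} (x : T ⟶ ((rSimpleComplex r X).X n).X) :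
    (x ≫ ((rSimpleComplex r X).d n m).f) ≫ proj r X m β =
      ((-1 : ℤ) ^ β.dim) • ((x ≫ proj r X n β) ≫ ((X.obj β).d (n - β.dim) (m - β.dim)).f) +
        ∑ α, (x ≫ proj r X n α) ≫ cubeTerm X n m α β := by
  rw [Category.assoc, d_proj X hnm, Preadditive.comp_add, Preadditive.comp_zsmul,
    Preadditive.comp_sum]
  simp only [Category.assoc]

/-- The component at `α` of a differential is `±d` of the component at `α` plus terms from the
facets of `α`. By `mem_sum_cubeTerm` the latter are within the permitted error, so the pair of
components at `α` satisfies the cone hypothesis for `a_α` at level `p + r|α|`. -/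
lemma coneAcyclic_sMap_aux {P : Cube} {X Y : P.Idx ⥤ FiltComplex A} (a : X ⟶ Y)
    (h : ∀ α, ConeAcyclic r (a.app α)) {i j k l : ℤ} (hij : i + 1 = j) (hjk : j + 1 = k)
    (hkl : k + 1 = l) {p : ℤ} {T : A} (x : T ⟶ ((rSimpleComplex r X).X k).X)
    (y : T ⟶ ((rSimpleComplex r Y).X j).X) (hx : ((rSimpleComplex r X).X k).Mem p x)
    (hdx : ((rSimpleComplex r X).X l).Mem (p - r - 1) (x ≫ ((rSimpleComplex r X).d k l).f))
    (hy : ((rSimpleComplex r Y).X j).Mem (p + r) y)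
    (hxy : ((rSimpleComplex r Y).X k).Mem (p - 1)
      (x ≫ ((sMap r a).f k).f - y ≫ ((rSimpleComplex r Y).d j k).f))
    (α : P.Idx)
    (hα : ∀ β < α, ((X.obj β).X (k - β.dim)).Mem (p - 1 + r * β.dim) (x ≫ proj r X k β))
    (hα' : ∀ β < α, ((Y.obj β).X (j - β.dim)).Mem (p + r - 1 + r * β.dim) (y ≫ proj r Y j β)) :
    ∃ (T' : A) (π : T' ⟶ T) (_ : Epi π) (x' : T' ⟶ ((X.obj α).X (j - α.dim)).X)
      (y' : T' ⟶ ((Y.obj α).X (i - α.dim)).X),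
      ((X.obj α).X (j - α.dim)).Mem (p + r + r * α.dim) x' ∧
      ((Y.obj α).X (i - α.dim)).Mem (p + r + r + r * α.dim) y' ∧
      ((X.obj α).X (k - α.dim)).Mem (p - 1 + r * α.dim) (π ≫ x ≫ proj r X k α -
        ((-1 : ℤ) ^ α.dim) • (x' ≫ ((X.obj α).d (j - α.dim) (k - α.dim)).f)) ∧
      ((Y.obj α).X (j - α.dim)).Mem (p + r - 1 + r * α.dim) (π ≫ y ≫ proj r Y j α -
        x' ≫ ((a.app α).f (j - α.dim)).f -
        ((-1 : ℤ) ^ α.dim) • (y' ≫ ((Y.obj α).d (i - α.dim) (j - α.dim)).f)) := by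
  have h1 : ((X.obj α).X (l - α.dim)).Mem (p + r * α.dim - r - 1)
      ((x ≫ proj r X k α) ≫ ((X.obj α).d (k - α.dim) (l - α.dim)).f) := by
    have e1 := mem_rSimple_iff.1 hdx α
    rw [apply_d_proj hkl] at e1
    have e2 := ((e1.le (q := p - 1 - r + r * α.dim) (by omega)).sub (mem_sum_cubeTerm hkl hα)).zsmul
      ((-1 : ℤ) ^ α.dim)
    rw [add_sub_cancel_right, neg_one_pow_smul_smul] at e2
    exact e2.le (by omega)
  have h2 : ((Y.obj α).X (k - α.dim)).Mem (p + r * α.dim - 1)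
      ((x ≫ proj r X k α) ≫ ((a.app α).f (k - α.dim)).f -
        (((-1 : ℤ) ^ α.dim) • (y ≫ proj r Y j α)) ≫
          ((Y.obj α).d (j - α.dim) (k - α.dim)).f) := by
    have e1 := mem_rSimple_iff.1 hxy α
    rw [Preadditive.sub_comp, apply_d_proj hjk, Category.assoc, sMap_proj] at e1
    have e2 := (e1.le (q := p + r - 1 - r + r * α.dim) (by omega)).add (mem_sum_cubeTerm hjk hα')
    rw [← sub_sub, sub_add_cancel] at e2
    rw [Category.assoc, Preadditive.zsmul_comp]
    exact e2.le (by omega)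
  -- The sign `(-1)^|α|` of the internal differential is moved onto `y` before applying the
  -- hypothesis, and onto `x'` afterwards; it squares to one.
  obtain ⟨T', π, hπ, x', y', hx', hy', e1, e2⟩ := h α (i - α.dim) (j - α.dim) (k - α.dim)
    (l - α.dim) (by omega) (by omega) (by omega) (p + r * α.dim) _ _ (mem_rSimple_iff.1 hx α) h1
    (((mem_rSimple_iff.1 hy α).zsmul _).le (by omega)) h2
  refine ⟨T', π, hπ, ((-1 : ℤ) ^ α.dim) • x', y', (hx'.zsmul _).le (by omega), hy'.le (by omega),
    ?_, ?_⟩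
  · rw [Preadditive.zsmul_comp, neg_one_pow_smul_smul]
    exact e1.le (by omega)
  · have e3 := (e2.zsmul ((-1 : ℤ) ^ α.dim)).le (q := p + r - 1 + r * α.dim) (by omega)
    rw [smul_sub, smul_sub, Preadditive.comp_zsmul, neg_one_pow_smul_smul] at e3
    rw [Preadditive.zsmul_comp]
    exact e3

/-- A correction supported at `α` reaches, besides `α`, only faces of dimension `|α| + 1`. There the
surplus `r` in the filtration degree of `z` is exactly what `W(r)` requires. -/
lemma mem_incl_d {P : Cube} {X : P.Idx ⥤ FiltComplex A} {n m p : ℤ} (hnm : n + 1 = m) {α : P.Idx}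
    {T : A} {z : T ⟶ ((X.obj α).X (n - α.dim)).X}
    (hz : ((X.obj α).X (n - α.dim)).Mem (p + r + r * α.dim) z)
    (hz' : ((X.obj α).X (m - α.dim)).Mem (p + r * α.dim)
      (((-1 : ℤ) ^ α.dim) • (z ≫ ((X.obj α).d (n - α.dim) (m - α.dim)).f))) :
    ((rSimpleComplex r X).X m).Mem p ((z ≫ incl r X n α) ≫ ((rSimpleComplex r X).d n m).f) := by
  rw [mem_rSimple_iff]
  intro β
  rw [Category.assoc, Category.assoc]
  by_cases e : α = β
  · subst e
    rw [incl_d_proj_self r X hnm, Preadditive.comp_zsmul]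
    exact hz'
  · rw [incl_d_proj_ne r X hnm e]
    by_cases hd : β.dim = α.dim + 1
    · refine (hz.cubeTerm m β).le (le_of_eq ?_)
      rw [hd]; push_cast; ring
    · rw [cubeTerm_of_dim_ne X hnm hd, comp_zero]; exact FiltObj.Mem.zero

-- Here `U` is a lower set of faces on which `x` and `y` already lie one filtration step below what
-- is assumed. One step enlarges `U` by a single face, and when `U` contains all faces no further
-- correction is needed. The number `N` bounds the steps left.
open Classical in
lemma coneAcyclic_sMap_induction {P : Cube} {X Y : P.Idx ⥤ FiltComplex A} (a : X ⟶ Y)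
    (h : ∀ α, ConeAcyclic r (a.app α)) {i j k l : ℤ} (hij : i + 1 = j) (hjk : j + 1 = k)
    (hkl : k + 1 = l) (p : ℤ) (N : ℕ) : ∀ (U : Finset P.Idx) (_ : Uᶜ.card ≤ N)
    (_ : ∀ α ∈ U, ∀ β ≤ α, β ∈ U) ⦃T : A⦄ (x : T ⟶ ((rSimpleComplex r X).X k).X)
    (y : T ⟶ ((rSimpleComplex r Y).X j).X), ((rSimpleComplex r X).X k).Mem p x →
    ((rSimpleComplex r X).X l).Mem (p - r - 1) (x ≫ ((rSimpleComplex r X).d k l).f) →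
    ((rSimpleComplex r Y).X j).Mem (p + r) y →
    ((rSimpleComplex r Y).X k).Mem (p - 1)
      (x ≫ ((sMap r a).f k).f - y ≫ ((rSimpleComplex r Y).d j k).f) →
    (∀ α ∈ U, ((X.obj α).X (k - α.dim)).Mem (p - 1 + r * α.dim) (x ≫ proj r X k α) ∧
      ((Y.obj α).X (j - α.dim)).Mem (p + r - 1 + r * α.dim) (y ≫ proj r Y j α)) →
    ∃ (T' : A) (π : T' ⟶ T) (_ : Epi π) (x' : T' ⟶ ((rSimpleComplex r X).X j).X)
      (y' : T' ⟶ ((rSimpleComplex r Y).X i).X),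
      ((rSimpleComplex r X).X j).Mem (p + r) x' ∧ ((rSimpleComplex r Y).X i).Mem (p + r + r) y' ∧
      ((rSimpleComplex r X).X k).Mem (p - 1) (π ≫ x - x' ≫ ((rSimpleComplex r X).d j k).f) ∧
      ((rSimpleComplex r Y).X j).Mem (p + r - 1)
        (π ≫ y - x' ≫ ((sMap r a).f j).f - y' ≫ ((rSimpleComplex r Y).d i j).f) := by
  induction N with
  | zero =>
    intro U hU _ T x y hx hdx hy hxy hG
    have hmem : ∀ α, α ∈ U := fun α => by
      have : Uᶜ = ∅ := Finset.card_eq_zero.1 (by omega)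
      simpa using Finset.ext_iff.1 this α
    refine ⟨T, 𝟙 _, inferInstance, 0, 0, FiltObj.Mem.zero, FiltObj.Mem.zero, ?_, ?_⟩
    · rw [Category.id_comp, zero_comp, sub_zero]
      exact mem_rSimple_iff.2 fun α => (hG α (hmem α)).1
    · rw [Category.id_comp, zero_comp, zero_comp, sub_zero, sub_zero]
      exact mem_rSimple_iff.2 fun α => (hG α (hmem α)).2
  | succ N ih =>
    intro U hU hlow T x y hx hdx hy hxy hG
    by_cases hne : Uᶜ.Nonempty
    swap
    · exact ih U (by rw [Finset.not_nonempty_iff_eq_empty.1 hne]; simp) hlow x y hx hdx hy hxy hG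
    -- Minimality puts all proper faces of `α` in `U`, as needed for the correction at `α` and for
    -- `insert α U` to be a lower set.
    obtain ⟨α, hα, hmin⟩ := Uᶜ.exists_minimal hne
    rw [Finset.mem_compl] at hα
    have hlt : ∀ β < α, β ∈ U := fun β hβ => by
      by_contra hβU
      exact absurd (hmin (Finset.mem_compl.2 hβU) hβ.le) hβ.not_ge
    obtain ⟨T₁, π₁, _, x', y', hx', hy', e1, e2⟩ := coneAcyclic_sMap_aux a h hij hjk hkl x y hx hdx
      hy hxy α (fun β hβ => (hG β (hlt β hβ)).1) (fun β hβ => (hG β (hlt β hβ)).2)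
    have m1 : ((rSimpleComplex r X).X k).Mem p
        ((x' ≫ incl r X j α) ≫ ((rSimpleComplex r X).d j k).f) := by
      refine mem_incl_d hjk hx' ?_
      have := ((mem_rSimple_iff.1 hx α).precomp π₁).sub (e1.le (q := p + r * α.dim) (by omega))
      rwa [sub_sub_cancel] at this
    have m2 : ((rSimpleComplex r Y).X j).Mem (p + r)
        ((y' ≫ incl r Y i α) ≫ ((rSimpleComplex r Y).d i j).f) := by
      refine mem_incl_d hij hy' ?_
      have := (((mem_rSimple_iff.1 hy α).precomp π₁).sub (hx'.map ((a.app α).f _))).sub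
        (e2.le (q := p + r + r * α.dim) (by omega))
      rwa [sub_sub_cancel] at this
    have hx'' : ((rSimpleComplex r X).X j).Mem (p + r) (x' ≫ incl r X j α) := hx'.incl
    have hy'' : ((rSimpleComplex r Y).X i).Mem (p + r + r) (y' ≫ incl r Y i α) := hy'.incl
    obtain ⟨T₂, π₂, _, x₂, y₂, hx₂, hy₂, f1, f2⟩ := ih (insert α U) (by
        rw [Finset.compl_insert, Finset.card_erase_of_mem (Finset.mem_compl.2 hα)]; omega)
      (by
        intro β hβ γ hγ
        rw [Finset.mem_insert] at hβ ⊢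
        rcases hβ with rfl | hβ
        · rcases hγ.eq_or_lt with rfl | hγ
          · exact Or.inl rfl
          · exact Or.inr (hlt _ hγ)
        · exact Or.inr (hlow β hβ γ hγ))
      (π₁ ≫ x - (x' ≫ incl r X j α) ≫ ((rSimpleComplex r X).d j k).f)
      (π₁ ≫ y - (x' ≫ incl r X j α) ≫ ((sMap r a).f j).f -
        (y' ≫ incl r Y i α) ≫ ((rSimpleComplex r Y).d i j).f)
      ((hx.precomp _).sub m1)
      (by
        rw [Preadditive.sub_comp, d_d_apply, sub_zero, Category.assoc]
        exact hdx.precomp _)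
      (((hy.precomp _).sub (hx''.map _)).sub m2)
      (by
        convert hxy.precomp π₁ using 1
        simp only [Preadditive.sub_comp, Preadditive.comp_sub, Category.assoc, comm_f, d_comp_d_f,
          comp_zero]
        abel)
      (by
        intro β hβ
        by_cases e : β = α
        · subst e
          constructor
          · rw [Preadditive.sub_comp, Category.assoc, Category.assoc, Category.assoc,
              incl_d_proj_self r X hjk, Preadditive.comp_zsmul]
            exact e1
          · simp only [Preadditive.sub_comp, Category.assoc]
            rw [incl_d_proj_self r Y hij, Preadditive.comp_zsmul, sMap_proj, ← Category.assoc (incl r X j β),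
              incl_proj_self, Category.id_comp]
            exact e2
        -- Since `U` is a lower set that avoids `α`, no face in `U` contains `α`. The differential
        -- of the correction therefore leaves the components on `U` unchanged.
        · have hβU : β ∈ U := (Finset.mem_insert.1 hβ).resolve_left e
          have hnle : ¬ α ≤ β := fun hle => hα (hlow β hβU α hle)
          constructor
          · rw [Preadditive.sub_comp, Category.assoc, Category.assoc, Category.assoc,
              incl_d_proj_ne r X hjk (Ne.symm e), cubeTerm_of_not_le _ _ _ hnle, comp_zero, sub_zero]
            exact (hG β hβU).1.precomp _
          · simp only [Preadditive.sub_comp, Category.assoc]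
            rw [incl_d_proj_ne r Y hij (Ne.symm e), cubeTerm_of_not_le _ _ _ hnle, comp_zero, sub_zero,
              sMap_proj, ← Category.assoc (incl r X j α), incl_proj_ne r X j (Ne.symm e), zero_comp,
              comp_zero, sub_zero]
            exact (hG β hβU).2.precomp _)
    refine ⟨T₂, π₂ ≫ π₁, epi_comp _ _, π₂ ≫ x' ≫ incl r X j α + x₂, π₂ ≫ y' ≫ incl r Y i α + y₂,
      (hx''.precomp _).add hx₂, (hy''.precomp _).add hy₂, ?_, ?_⟩
    · convert f1 using 1
      simp only [Preadditive.comp_sub, Preadditive.add_comp, Category.assoc]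
      abel
    · convert f2 using 1
      simp only [Preadditive.comp_sub, Preadditive.add_comp, Category.assoc]
      abel

/-- The simple functor is exact. -/
lemma coneAcyclic_sMap {P : Cube} {X Y : P.Idx ⥤ FiltComplex A} (a : X ⟶ Y)
    (h : ∀ α, ConeAcyclic r (a.app α)) : ConeAcyclic r (sMap r a) := by
  classical
  intro i j k l hij hjk hkl p T x y hx hdx hy hxy
  exact coneAcyclic_sMap_induction a h hij hjk hkl p _ ∅ le_rfl (by simp) x y hx hdx hy hxy
    (by simp)

end Exactness

/-! ### Criteria for `E_r`-quasi-isomorphisms -/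

section Criteria

variable {A : Type u} [Category.{v} A] [Abelian A] {r : ℤ}

/-- The lift in `hsurj` is required to respect all filtration steps at once, so `f` is an
isomorphism of filtered objects in each degree. The preimage of `y` then solves the cone equations
with `y' = 0`. -/
lemma coneAcyclic_of_bijective {K L : FiltComplex A} (f : K ⟶ L)
    (hsurj : ∀ (n : ℤ) ⦃T : A⦄ (y : T ⟶ (L.X n).X), ∃ x : T ⟶ (K.X n).X, x ≫ (f.f n).f = y ∧
      ∀ p, (L.X n).Mem p y → (K.X n).Mem p x)
    (hinj : ∀ (n : ℤ) ⦃T : A⦄ (x : T ⟶ (K.X n).X), x ≫ (f.f n).f = 0 → x = 0) :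
    ConeAcyclic r f := by
  intro i j k l hij hjk hkl p T x y hx hdx hy hxy
  obtain ⟨x', rfl, hx'⟩ := hsurj j y
  refine ⟨T, 𝟙 _, inferInstance, x', 0, hx' _ hy, FiltObj.Mem.zero, ?_, ?_⟩
  · obtain ⟨x₀, e, hx₀⟩ := hsurj k (x ≫ (f.f k).f - (x' ≫ (f.f j).f) ≫ (L.d j k).f)
    have : x₀ - (x - x' ≫ (K.d j k).f) = 0 := hinj k _ (by
      rw [Preadditive.sub_comp, e, comm_f_apply, ← Preadditive.sub_comp, sub_self])
    rw [Category.id_comp, ← sub_eq_zero.1 this]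
    exact hx₀ _ hxy
  · rw [Category.id_comp, zero_comp, sub_self, sub_zero]
    exact FiltObj.Mem.zero

/-- A deformation retract in which the homotopy may raise the filtration degree by `r`. Such
homotopies are not filtered, but they are invisible to the cohomology of `E_r`. -/
lemma coneAcyclic_of_homotopy {K L : FiltComplex A} (f : K ⟶ L) (g : L ⟶ K) (hfg : f ≫ g = 𝟙 K)
    (h : ∀ j i : ℤ, (L.X j).X ⟶ (L.X i).X)
    (hh : ∀ i j k : ℤ, i + 1 = j → j + 1 = k → (L.d j k).f ≫ h k j + h j i ≫ (L.d i j).f =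
      𝟙 _ - (g.f j).f ≫ (f.f j).f)
    (hf : ∀ i j : ℤ, i + 1 = j → (f.f j).f ≫ h j i = 0)
    (hm : ∀ (i j p : ℤ) (_ : i + 1 = j) ⦃T : A⦄ (y : T ⟶ (L.X j).X), (L.X j).Mem p y →
      (L.X i).Mem (p + r) (y ≫ h j i)) : ConeAcyclic r f := by
  intro i j k l hij hjk hkl p T x y hx hdx hy hxy
  -- With `x' = g y` and `y' = h y`, the first error is `g(f x - dy)`. The second is `h(dy) = -h(f x
  -- - dy)`, because `h` vanishes on the image of `f`.
  refine ⟨T, 𝟙 _, inferInstance, y ≫ (g.f j).f, y ≫ h j i, hy.map _, hm _ _ _ hij _ hy, ?_, ?_⟩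
  · convert hxy.map (g.f k) using 1
    have : (f.f k).f ≫ (g.f k).f = 𝟙 _ :=
      congrArg (fun φ : K ⟶ K => (φ.f k).f) hfg
    rw [Category.id_comp, Preadditive.sub_comp, Category.assoc, Category.assoc, this,
      Category.comp_id, comm_f, Category.assoc]
  · have e1 := (hm j k _ hjk _ hxy).neg.le (q := p + r - 1) (by omega)
    convert e1 using 1
    have e2 := y ≫= hh i j k hij hjk
    rw [Preadditive.comp_add, Preadditive.comp_sub, Category.comp_id] at e2
    rw [Preadditive.sub_comp, Category.assoc x, hf _ _ hjk, comp_zero, zero_sub, neg_neg,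
      Category.id_comp, Category.assoc, Category.assoc, Category.assoc, ← e2, add_sub_cancel_right]

/-- Exactness of the page `E_r` of a filtered complex, in terms of generalized elements. -/
def PageAcyclic (r : ℤ) (M : FiltComplex A) : Prop :=
  ∀ (i j k : ℤ) (_ : i + 1 = j) (_ : j + 1 = k) (p : ℤ) ⦃T : A⦄ (z : T ⟶ (M.X j).X),
    (M.X j).Mem p z → (M.X k).Mem (p - r - 1) (z ≫ (M.d j k).f) →
    ∃ (T' : A) (π : T' ⟶ T) (_ : Epi π) (z' : T' ⟶ (M.X i).X),
      (M.X i).Mem (p + r) z' ∧ (M.X j).Mem (p - 1) (π ≫ z - z' ≫ (M.d i j).f)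

lemma FiltComplex.eq_zero_of_isZero {K : FiltComplex A} (hK : IsZero K) {n : ℤ} {T : A}
    (x : T ⟶ (K.X n).X) : x = 0 := by
  have : 𝟙 (K.X n).X = 0 :=
    congrArg (fun φ : K ⟶ K => (φ.f n).f) (hK.eq_of_src (𝟙 K) 0)
  rw [← Category.comp_id x, this, comp_zero]

/-- When `K` vanishes, only the `y` half of the cone condition remains. It lives at level `p + r`,
which accounts for the change of index between the two sides. -/
lemma coneAcyclic_iff_of_isZero {K M : FiltComplex A} (hK : IsZero K) (f : K ⟶ M) :
    ConeAcyclic r f ↔ PageAcyclic r M := by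
  constructor
  · intro h i j k hij hjk p T z hz hdz
    obtain ⟨T', π, hπ, x', y', -, hy', -, h2⟩ := h i j k (k + 1) hij hjk rfl (p - r) (0 : T ⟶ _) z
      FiltObj.Mem.zero (by rw [zero_comp]; exact FiltObj.Mem.zero) (hz.le (by omega))
      (by rw [zero_comp, zero_sub]; exact hdz.neg)
    rw [FiltComplex.eq_zero_of_isZero hK x', zero_comp, sub_zero] at h2
    exact ⟨T', π, hπ, y', hy'.le (by omega), h2.le (by omega)⟩
  · intro h i j k l hij hjk hkl p T x y hx hdx hy hxy
    rw [FiltComplex.eq_zero_of_isZero hK x, zero_comp, zero_sub] at hxy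
    obtain ⟨T', π, hπ, y', hy', h2⟩ := h i j k hij hjk (p + r) y hy
      (by have := hxy.neg; rw [neg_neg] at this; exact this.le (by omega))
    refine ⟨T', π, hπ, 0, y', FiltObj.Mem.zero, hy', ?_, ?_⟩
    · rw [FiltComplex.eq_zero_of_isZero hK (_ - _)]; exact FiltObj.Mem.zero
    · rw [zero_comp, sub_zero]; exact h2

/-- If `M` is the cone of `f`, up to a shift, then `f` is an `E_r`-quasi-isomorphism if and only if
the page `E_r` of `M` is acyclic. -/
lemma coneAcyclic_iff_pageAcyclic {K L M : FiltComplex A} (f : K ⟶ L)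
    (pr : ∀ n : ℤ, (M.X n).X ⟶ (K.X n).X) (qr : ∀ n m : ℤ, (M.X n).X ⟶ (L.X m).X)
    (hex : ∀ (n m : ℤ) (_ : m + 1 = n) ⦃T : A⦄ (x : T ⟶ (K.X n).X) (y : T ⟶ (L.X m).X),
      ∃ z : T ⟶ (M.X n).X, z ≫ pr n = x ∧ z ≫ qr n m = y)
    (hmem : ∀ (n m p : ℤ) (_ : m + 1 = n) ⦃T : A⦄ (z : T ⟶ (M.X n).X), (M.X n).Mem p z ↔
      (K.X n).Mem p (z ≫ pr n) ∧ (L.X m).Mem (p + r) (z ≫ qr n m))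
    (hp : ∀ n m : ℤ, n + 1 = m → (M.d n m).f ≫ pr m = pr n ≫ (K.d n m).f)
    (hq : ∀ l n m : ℤ, l + 1 = n → n + 1 = m → (M.d n m).f ≫ qr m n =
      pr n ≫ (f.f n).f - qr n l ≫ (L.d l n).f) :
    ConeAcyclic r f ↔ PageAcyclic r M := by
  constructor
  · intro h j k l hjk hkl p T z hz hdz
    rw [hmem k j p hjk] at hz
    rw [hmem l k _ hkl] at hdz
    obtain ⟨T', π, hπ, x', y', hx', hy', h1, h2⟩ := h (j - 1) j k l (by omega) hjk hkl p
      (z ≫ pr k) (z ≫ qr k j) hz.1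
      (by have := hdz.1; rwa [Category.assoc, hp _ _ hkl, ← Category.assoc] at this) hz.2
      (by
        have := hdz.2
        rw [Category.assoc, hq _ _ _ hjk hkl, Preadditive.comp_sub] at this
        rw [Category.assoc, Category.assoc]
        exact this.le (by omega))
    -- The cone differential acts by `-d` on the part coming from `L`, hence the sign on `y'`.
    obtain ⟨z', e1, e2⟩ := hex j (j - 1) (by omega) x' (-y')
    refine ⟨T', π, hπ, z', (hmem j (j - 1) _ (by omega) _).2 ⟨by rw [e1]; exact hx', ?_⟩,
      (hmem k j _ hjk _).2 ⟨?_, ?_⟩⟩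
    · rw [e2]; exact hy'.neg
    · rw [Preadditive.sub_comp, Category.assoc, Category.assoc, hp _ _ hjk, ← Category.assoc z', e1]
      exact h1
    · rw [Preadditive.sub_comp, Category.assoc, Category.assoc, hq (j - 1) _ _ (by omega) hjk,
        Preadditive.comp_sub, ← Category.assoc z', ← Category.assoc z', e1, e2,
        Preadditive.neg_comp, sub_neg_eq_add, ← sub_sub]
      exact h2.le (by omega)
  · intro h i j k l hij hjk hkl p T x y hx hdx hy hxy
    obtain ⟨z, rfl, rfl⟩ := hex k j hjk x y
    obtain ⟨T', π, hπ, z', hz', h1⟩ := h j k l hjk hkl p z ((hmem k j _ hjk _).2 ⟨hx, hy⟩)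
      ((hmem l k _ hkl _).2 ⟨by rw [Category.assoc, hp _ _ hkl, ← Category.assoc]; exact hdx, by
        rw [Category.assoc, hq _ _ _ hjk hkl, Preadditive.comp_sub, ← Category.assoc,
          ← Category.assoc]
        exact hxy.le (by omega)⟩)
    rw [hmem j i _ hij] at hz'
    rw [hmem k j _ hjk] at h1
    refine ⟨T', π, hπ, z' ≫ pr j, -(z' ≫ qr j i), hz'.1, hz'.2.neg, ?_, ?_⟩
    · have := h1.1
      rwa [Preadditive.sub_comp, Category.assoc, Category.assoc, hp _ _ hjk,
        ← Category.assoc z'] at this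
    · have := h1.2
      rw [Preadditive.sub_comp, Category.assoc, Category.assoc, hq i _ _ hij hjk,
        Preadditive.comp_sub, ← Category.assoc z', ← Category.assoc z', ← sub_add] at this
      rw [Preadditive.neg_comp, sub_neg_eq_add]
      exact this.le (by omega)

end Criteria

/-! ### The morphism `lam` -/

namespace Cube

variable {P : Cube}

lemma Idx.card_set_of_dim_eq_zero {α : P.Idx} (h : α.dim = 0) (i : P.ι) : (α.set i).card = 1 := by
  have h1 := (Finset.sum_eq_zero_iff.1 h) i (Finset.mem_univ i)
  have := (α.set_nonempty i).card_pos
  omega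

lemma Idx.exists_vertex_le (β : P.Idx) : ∃ α ≤ β, α.dim = 0 := by
  choose t ht using fun i => β.set_nonempty i
  refine ⟨fun i => ⟨{t i}, Finset.singleton_nonempty _⟩,
    fun i => Finset.singleton_subset_iff.2 (ht i), ?_⟩
  exact Finset.sum_eq_zero fun i _ => by simp [Idx.set]

open Classical in
/-- The incidence signs of the two end points of an edge are opposite. -/
lemma Idx.sum_incidence_vertices {β : P.Idx} (h : β.dim = 1) :
    ∑ α : P.Idx with α ≤ β ∧ α.dim = 0, α.incidence β = 0 := by
  obtain ⟨α, hle, hα⟩ := β.exists_vertex_le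
  obtain ⟨i, s, hs, rfl⟩ := Idx.exists_eq_add hle (by omega)
  obtain ⟨t, ht⟩ := Finset.card_eq_one.1 (Idx.card_set_of_dim_eq_zero hα i)
  have hst : s ≠ t := by rintro rfl; exact hs (by simp [ht])
  -- The other end point of the edge: the vertex `t` of `α` in the factor `i` is replaced by the
  -- added vertex `s`.
  let α' : P.Idx := Function.update α i ⟨{s}, Finset.singleton_nonempty _⟩
  have h1 : α'.set i = {s} := congrArg Subtype.val (Function.update_self i _ α)
  have h2 : ∀ j, j ≠ i → α'.set j = α.set j := fun j hj =>
    congrArg Subtype.val (Function.update_of_ne hj _ α)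
  have hα' : α'.dim = 0 := by
    refine Finset.sum_eq_zero fun j _ => ?_
    by_cases hj : j = i
    · subst hj; rw [h1]; simp
    · rw [h2 j hj, Idx.card_set_of_dim_eq_zero hα, Nat.sub_self]
  have hadd : α'.add i t = α.add i s := by
    refine Idx.ext fun j => ?_
    by_cases hj : j = i
    · subst hj; rw [Idx.add_set_self, Idx.add_set_self, h1, ht]; exact Finset.pair_comm _ _
    · rw [Idx.add_set_ne _ _ hj, Idx.add_set_ne _ _ hj, h2 j hj]
  have hne : α ≠ α' := by
    intro e
    have : α.set i = α'.set i := by rw [← e]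
    rw [ht, h1, Finset.singleton_inj] at this
    exact hst this.symm
  have hset : (Finset.univ.filter fun γ : P.Idx => γ ≤ α.add i s ∧ γ.dim = 0) = {α, α'} := by
    ext γ
    simp only [Finset.mem_filter, Finset.mem_univ, true_and, Finset.mem_insert,
      Finset.mem_singleton]
    constructor
    · rintro ⟨hγ, hd⟩
      obtain ⟨w, hw⟩ := Finset.card_eq_one.1 (Idx.card_set_of_dim_eq_zero hd i)
      have hwm : w ∈ (α.add i s).set i := hγ i (by change w ∈ γ.set i; simp [hw])
      rw [Idx.add_set_self, ht, Finset.mem_insert, Finset.mem_singleton] at hwm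
      have hj : ∀ j, j ≠ i → γ.set j = α.set j := fun j hj => by
        refine Finset.eq_of_subset_of_card_le ?_ ?_
        · have := hγ j
          change γ.set j ⊆ (α.add i s).set j at this
          rwa [Idx.add_set_ne _ _ hj] at this
        · rw [Idx.card_set_of_dim_eq_zero hd, Idx.card_set_of_dim_eq_zero hα]
      rcases hwm with rfl | rfl
      · right
        refine Idx.ext fun j => ?_
        by_cases e : j = i
        · subst e; rw [hw, h1]
        · rw [hj j e, h2 j e]
      · left
        refine Idx.ext fun j => ?_
        by_cases e : j = i
        · subst e; rw [hw, ht]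
        · rw [hj j e]
    · rintro (rfl | rfl)
      · exact ⟨hle, hα⟩
      · exact ⟨hadd ▸ Idx.le_add _ _ _, hα'⟩
  have hs' : t ∉ α'.set i := by rw [h1]; simpa using hst.symm
  rw [hset, Finset.sum_pair hne, Idx.incidence_add _ hs, ← hadd, Idx.incidence_add _ hs']
  have hw : ∀ (γ : P.Idx), γ.dim = 0 → ∑ k with k < i, ((γ.set k).card - 1) = 0 := fun γ hγ =>
    Finset.sum_eq_zero fun k _ => by rw [Idx.card_set_of_dim_eq_zero hγ, Nat.sub_self]
  rw [Idx.weight, Idx.weight, hw α hα, hw α' hα', ht, h1]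
  -- All factors have dimension zero at the end points, so only the order of `s` and `t` counts.
  -- Adding `s` to `{t}` and adding `t` to `{s}` have weights `0` and `1` in one order or the other.
  rcases lt_or_gt_of_ne hst with h | h
  · simp [Finset.filter_singleton, h, h.not_gt]
  · simp [Finset.filter_singleton, h, h.not_gt]

end Cube

section Lam

attribute [local instance] Abelian.hasFiniteBiproducts

variable {A : Type u} [Category.{v} A] [Abelian A] (r : ℕ)

/-- The constant diagram of shape `P`. -/
abbrev constDiag {C : Type*} [Category* C] (P : Cube) (X : C) : P.Idx ⥤ C where
  obj _ := X
  map _ := 𝟙 X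

lemma cubeTerm_const {P : Cube} (X : FiltComplex A) (n m : ℤ) {α β : P.Idx} (h : α ≤ β) :
    cubeTerm (constDiag P X) n m α β =
      α.incidence β • dc X (n - α.dim) (m - β.dim) :=
  (cubeTerm_of_le _ n m h).trans (congrArg _ (Category.id_comp _))

/-- This is what makes `λ` commute with the differentials: an element placed diagonally on all
vertices has no component on edges, since the two end points of an edge contribute with opposite
signs. In all other dimensions the terms vanish for degree reasons. -/
lemma sum_dc_cubeTerm {P : Cube} (X : FiltComplex A) {n m : ℤ} (hnm : n + 1 = m) (β : P.Idx) :
    ∑ α : P.Idx, dc X n (n - α.dim) ≫ cubeTerm (constDiag P X) n m α β = 0 := by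
  classical
  by_cases hβ : β.dim = 1
  swap
  · refine Finset.sum_eq_zero fun α _ => ?_
    by_cases hα : α.dim = 0
    · rw [cubeTerm_of_dim_ne _ hnm (by omega), comp_zero]
    · exact (congrArg (· ≫ _) (dc_eq_zero X (by omega))).trans zero_comp
  have key : ∀ α : P.Idx, dc X n (n - α.dim) ≫ cubeTerm (constDiag P X) n m α β =
      if α ≤ β ∧ α.dim = 0 then α.incidence β • dc X n (m - β.dim) else 0 := by
    intro α
    by_cases h1 : α ≤ β
    · rw [cubeTerm_const X n m h1]
      by_cases h2 : α.dim = 0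
      · rw [if_pos ⟨h1, h2⟩, Preadditive.comp_zsmul, dc_trans _ (by omega)]
      · rw [if_neg (by tauto), dc_eq_zero X (by omega), zero_comp]
    · rw [cubeTerm_of_not_le _ n m h1, if_neg (by tauto), comp_zero]
  rw [Finset.sum_congr rfl fun α _ => key α, ← Finset.sum_filter, ← Finset.sum_smul,
    Idx.sum_incidence_vertices hβ, zero_smul]

/-- The canonical morphism from a filtered complex to the simple of the constant diagram. -/
def lamMap (P : Cube) (X : FiltComplex A) :
    X ⟶ rSimpleComplex r (constDiag P X) where
  f n := ⟨ofProj r (constDiag P X) n fun α => dc X n (n - α.dim), fun p => by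
    refine mem_rSimple_iff.2 fun α => ?_
    rw [Category.assoc, ofProj_proj]
    have h : (X.X n).Mem p ((X.X n).W p).arrow := Subobject.factors_self _
    exact (h.dc _).le (by
      have : (0 : ℤ) ≤ r * α.dim := by positivity
      omega)⟩
  comm' n m hnm := by
    refine FiltObj.hom_ext (proj_ext fun β => ?_)
    change (ofProj r (constDiag P X) n _ ≫ ((rSimpleComplex r _).d n m).f) ≫ _ =
      ((X.d n m).f ≫ ofProj r (constDiag P X) m _) ≫ _
    have hnm : n + 1 = m := hnm
    rw [apply_d_proj hnm, Category.assoc (X.d n m).f, ofProj_proj]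
    simp only [ofProj_proj]
    refine (congrArg₂ (· + ·) rfl (sum_dc_cubeTerm X hnm β)).trans ((add_zero _).trans ?_)
    change ((-1 : ℤ) ^ β.dim) • (dc X n (n - β.dim) ≫ (X.d _ _).f) = _
    by_cases hβ : β.dim = 0
    · have hs : (-1 : ℤ) ^ β.dim = 1 := by rw [hβ, pow_zero]
      rw [hs, one_smul]
      exact dc_d X (by omega)
    · rw [dc_eq_zero X (show n ≠ n - β.dim by omega), dc_eq_zero X (show m ≠ m - β.dim by omega),
        zero_comp, comp_zero, smul_zero]

lemma lamMap_proj (P : Cube) (X : FiltComplex A) (n : ℤ) (α : P.Idx) :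
    ((lamMap r P X).f n).f ≫ proj r (constDiag P X) n α = dc X n (n - α.dim) :=
  ofProj_proj _ _ _ _ _

end Lam

/-! ### Faces of products of cubes -/

namespace Cube

variable {P Q : Cube}

lemma Idx.pair_fst (α : P.Idx) (β : Q.Idx) : (α.pair β).fst = α := rfl

lemma Idx.pair_snd (α : P.Idx) (β : Q.Idx) : (α.pair β).snd = β := rfl

/-- The faces of `P × Q` are the pairs of faces of `P` and `Q`. -/
def Idx.prodEquiv (P Q : Cube) : (P.prod Q).Idx ≃ P.Idx × Q.Idx where
  toFun γ := (γ.fst, γ.snd)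
  invFun p := p.1.pair p.2
  left_inv _ := Idx.prod_ext rfl rfl
  right_inv _ := rfl

lemma sum_prod_ι {M : Type*} [AddCommMonoid M] (f : (P.prod Q).ι → M) :
    ∑ x, f x = ∑ i : P.ι, f (toLex (Sum.inl i)) + ∑ j : Q.ι, f (toLex (Sum.inr j)) := by
  rw [← Fintype.sum_sum_type fun x => f (toLex x)]
  exact Fintype.sum_equiv ofLex _ _ fun _ => rfl

lemma prod_prod_ι {M : Type*} [CommMonoid M] (f : (P.prod Q).ι → M) :
    ∏ x, f x = (∏ i : P.ι, f (toLex (Sum.inl i))) * ∏ j : Q.ι, f (toLex (Sum.inr j)) := by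
  rw [← Fintype.prod_sum_type fun x => f (toLex x)]
  exact Fintype.prod_equiv ofLex _ _ fun _ => rfl

lemma Idx.dim_prod (γ : (P.prod Q).Idx) : γ.dim = γ.fst.dim + γ.snd.dim :=
  sum_prod_ι _

lemma Idx.le_prod_iff {γ γ' : (P.prod Q).Idx} : γ ≤ γ' ↔ γ.fst ≤ γ'.fst ∧ γ.snd ≤ γ'.snd := by
  refine ⟨fun h => ⟨Idx.fst_mono h, Idx.snd_mono h⟩, fun h x => ?_⟩
  rcases x with i | j
  · exact h.1 i
  · exact h.2 j

lemma Idx.weight_inl (γ : (P.prod Q).Idx) (i : P.ι) (s : (P.S i).carrier) :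
    γ.weight (toLex (Sum.inl i)) s = γ.fst.weight i s := by
  unfold Idx.weight
  congr 1
  rw [Finset.sum_filter, Finset.sum_filter, sum_prod_ι, Finset.sum_eq_zero (s := Finset.univ (α := Q.ι)),
    add_zero]
  · refine Finset.sum_congr rfl fun k _ => ?_
    by_cases h : k < i
    · exact (if_pos (Sum.Lex.inl_lt_inl_iff.2 h)).trans (if_pos h).symm
    · exact (if_neg fun h' => h (Sum.Lex.inl_lt_inl_iff.1 h')).trans (if_neg h).symm
  · intro j _
    exact if_neg Sum.Lex.not_inr_lt_inl

/-- Every factor of `P` precedes every factor of `Q`, so all of them contribute their dimensions. -/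
lemma Idx.weight_inr (γ : (P.prod Q).Idx) (j : Q.ι) (s : (Q.S j).carrier) :
    γ.weight (toLex (Sum.inr j)) s = γ.fst.dim + γ.snd.weight j s := by
  unfold Idx.weight
  rw [← add_assoc]
  congr 1
  rw [Finset.sum_filter, Finset.sum_filter, sum_prod_ι]
  refine congrArg₂ (· + ·) ?_ ?_
  · exact Finset.sum_congr rfl fun k _ => if_pos (Sum.Lex.inl_lt_inr _ _)
  · refine Finset.sum_congr rfl fun k _ => ?_
    by_cases h : k < j
    · exact (if_pos (Sum.Lex.inr_lt_inr_iff.2 h)).trans (if_pos h).symm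
    · exact (if_neg fun h' => h (Sum.Lex.inr_lt_inr_iff.1 h')).trans (if_neg h).symm

lemma Idx.sum_card_sdiff {α β : P.Idx} (h : α ≤ β) :
    ∑ i, (β.set i \ α.set i).card + α.dim = β.dim := by
  unfold Idx.dim
  rw [← Finset.sum_add_distrib]
  refine Finset.sum_congr rfl fun i _ => ?_
  have h1 := Finset.card_sdiff_add_card_eq_card (h i)
  have h2 := (α.set_nonempty i).card_pos
  change (β.set i \ α.set i).card + ((α.set i).card - 1) = (β.set i).card - 1
  change (β.set i \ α.set i).card + (α.set i).card = (β.set i).card at h1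
  omega

lemma Idx.incidence_prod_of_snd_eq {γ γ' : (P.prod Q).Idx} (h : γ.snd = γ'.snd) :
    γ.incidence γ' = γ.fst.incidence γ'.fst := by
  unfold Idx.incidence
  congr 1
  rw [sum_prod_ι, Finset.sum_eq_zero (s := Finset.univ (α := Q.ι)), add_zero]
  · refine Finset.sum_congr rfl fun i _ => Finset.sum_congr rfl fun s _ => ?_
    exact Idx.weight_inl γ i s
  · intro j _
    have : γ'.set (toLex (Sum.inr j)) = γ.set (toLex (Sum.inr j)) :=
      congrArg (fun β : Q.Idx => β.set j) h.symm
    rw [this, Finset.sdiff_self, Finset.sum_empty]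

/-- Exactly one vertex is added, in a factor of `Q`, and its weight is shifted by the dimension of
the face of `P`. The resulting sign is the one that the outer total complex puts on the inner
differential, so `μ` can be defined without signs. -/
lemma Idx.incidence_prod_of_fst_eq {γ γ' : (P.prod Q).Idx} (h : γ.fst = γ'.fst) (hle : γ ≤ γ')
    (hd : γ'.dim = γ.dim + 1) :
    γ.incidence γ' = (-1) ^ γ'.fst.dim * γ.snd.incidence γ'.snd := by
  unfold Idx.incidence
  rw [← pow_add]
  congr 1
  rw [sum_prod_ι, Finset.sum_eq_zero (s := Finset.univ (α := P.ι)), zero_add]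
  · have h1 : ∑ j, (γ'.snd.set j \ γ.snd.set j).card = 1 := by
      have := Idx.sum_card_sdiff (Idx.snd_mono hle)
      rw [Idx.dim_prod, Idx.dim_prod γ, h] at hd
      omega
    have h2 : ∑ j, ∑ s ∈ γ'.snd.set j \ γ.snd.set j, (γ.fst.dim + γ.snd.weight j s) =
        γ'.fst.dim + ∑ j, ∑ s ∈ γ'.snd.set j \ γ.snd.set j, γ.snd.weight j s := by
      simp only [Finset.sum_add_distrib, Finset.sum_const, smul_eq_mul]
      rw [← Finset.sum_mul, h1, one_mul, h]
    rw [← h2]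
    refine Finset.sum_congr rfl fun j _ => Finset.sum_congr rfl fun s _ => ?_
    exact Idx.weight_inr γ j s
  · intro i _
    have : γ'.set (toLex (Sum.inl i)) = γ.set (toLex (Sum.inl i)) :=
      congrArg (fun β : P.Idx => β.set i) h.symm
    rw [this, Finset.sdiff_self, Finset.sum_empty]

lemma Hom.sign_prodMap {P' Q' : Cube} (u : P' ⟶ P) (w : Q' ⟶ Q) (γ : (P'.prod Q').Idx) :
    Hom.sign (prodMap u w) γ = u.sign γ.fst * w.sign γ.snd :=
  prod_prod_ι _

end Cube

/-- For the differential on a product of cubes: passing to a face of codimension one changes only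
one of the two coordinates, and never neither. -/
lemma sum_sum_eq_cross {I J M : Type*} [Fintype I] [Fintype J] [AddCommMonoid M] (F : I → J → M)
    (a : I) (b : J) (h : ∀ i j, i ≠ a → j ≠ b → F i j = 0) (h0 : F a b = 0) :
    ∑ i, ∑ j, F i j = ∑ j, F a j + ∑ i, F i b := by
  classical
  have key : ∀ i j, F i j = (if i = a then F a j else 0) + (if j = b then F i b else 0) := by
    intro i j
    by_cases hi : i = a
    · subst hi
      by_cases hj : j = b
      · subst hj; simp [h0]
      · simp [hj]
    · by_cases hj : j = b
      · subst hj; simp [hi]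
      · simp [hi, hj, h i j hi hj]
  rw [Finset.sum_congr rfl fun i _ => Finset.sum_congr rfl fun j _ => key i j]
  simp only [Finset.sum_add_distrib]
  congr 1
  · rw [Finset.sum_comm]; simp
  · simp

/-! ### The morphism `μ` as an isomorphism of filtered complexes -/

section Mu

attribute [local instance] Abelian.hasFiniteBiproducts

variable {A : Type u} [Category.{v} A] [Abelian A] (r : ℕ)

lemma dc_proj {P : Cube} (X : P.Idx ⥤ FiltComplex A) (i j : ℤ) (β : P.Idx) :
    dc (rSimpleComplex r X) i j ≫ proj r X j β =
      proj r X i β ≫ dc (X.obj β) (i - β.dim) (j - β.dim) := by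
  by_cases h : i = j
  · subst h; rw [dc_self, dc_self, Category.id_comp, Category.comp_id]
  · rw [dc_eq_zero _ h, dc_eq_zero _ (by omega), zero_comp, comp_zero]

/-- The functor `α ↦ s_Q (X(α, -))` on `P`. -/
abbrev inner {P Q : Cube} (X : P.Idx ⥤ Q.Idx ⥤ FiltComplex A) : P.Idx ⥤ FiltComplex A where
  obj α := rSimpleComplex r (X.obj α)
  map h := sMap r (X.map h)
  map_id α := ((innerSimple (rSimple A r) P Q).obj X).map_id α
  map_comp f g := ((innerSimple (rSimple A r) P Q).obj X).map_comp f g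

/-- The functor on `P × Q` given by a functor `P ⥤ Q ⥤ C`. -/
abbrev uncurried {C : Type*} [Category* C] {P Q : Cube} (X : P.Idx ⥤ Q.Idx ⥤ C) :
    (P.prod Q).Idx ⥤ C where
  obj γ := (X.obj γ.fst).obj γ.snd
  map {γ γ'} f := (X.map (homOfLE (Idx.fst_mono (leOfHom f)))).app γ.snd ≫
    (X.obj γ'.fst).map (homOfLE (Idx.snd_mono (leOfHom f)))
  map_id γ := ((uncurryCube C P Q).obj X).map_id γ
  map_comp f g := ((uncurryCube C P Q).obj X).map_comp f g

/-- The projection of the iterated simple complex onto the summand of `α` and `β`. -/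
def iterProj {P Q : Cube} (X : P.Idx ⥤ Q.Idx ⥤ FiltComplex A) (n : ℤ) (α : P.Idx) (β : Q.Idx) :
    ((rSimpleComplex r (inner r X)).X n).X ⟶ (((X.obj α).obj β).X (n - α.dim - β.dim)).X :=
  proj r (inner r X) n α ≫ proj r (X.obj α) (n - α.dim) β

variable {r}

lemma iter_d_proj {P Q : Cube} (X : P.Idx ⥤ Q.Idx ⥤ FiltComplex A) {n m : ℤ} (hnm : n + 1 = m)
    (α : P.Idx) (β : Q.Idx) :
    ((rSimpleComplex r (inner r X)).d n m).f ≫ iterProj r X m α β =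
      ((-1 : ℤ) ^ α.dim) • ((-1 : ℤ) ^ β.dim) • (iterProj r X n α β ≫
        (((X.obj α).obj β).d (n - α.dim - β.dim) (m - α.dim - β.dim)).f) +
      ((-1 : ℤ) ^ α.dim) • (∑ β', iterProj r X n α β' ≫
        cubeTerm (X.obj α) (n - α.dim) (m - α.dim) β' β) +
      ∑ α', proj r (inner r X) n α' ≫ cubeTerm (inner r X) n m α' α ≫
        proj r (X.obj α) (m - α.dim) β := by
  unfold iterProj
  rw [← Category.assoc, d_proj _ hnm, Preadditive.add_comp, Preadditive.zsmul_comp, Category.assoc]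
  have h1 := d_proj (r := r) (X.obj α) (n := n - α.dim) (m := m - α.dim) (by omega) β
  have h2 := congrArg (fun φ => proj r (inner r X) n α ≫ φ) h1
  refine (congrArg₂ (fun a b => ((-1 : ℤ) ^ α.dim) • a + b) h2 (Preadditive.sum_comp _ _ _)).trans ?_
  dsimp only
  rw [Preadditive.comp_add, smul_add, Preadditive.comp_zsmul, Preadditive.comp_sum]
  simp only [Category.assoc]

lemma inner_cubeTerm_proj {P Q : Cube} (X : P.Idx ⥤ Q.Idx ⥤ FiltComplex A) (n m : ℤ)
    {α' α : P.Idx} (h : α' ≤ α) (β : Q.Idx) :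
    cubeTerm (inner r X) n m α' α ≫ proj r (X.obj α) (m - α.dim) β = α'.incidence α •
      (proj r (X.obj α') (n - α'.dim) β ≫ (((X.map (homOfLE h)).app β).f _).f ≫
        dc ((X.obj α).obj β) (n - α'.dim - β.dim) (m - α.dim - β.dim)) := by
  rw [cubeTerm_of_le _ n m h, Preadditive.zsmul_comp, Category.assoc]
  congr 1
  have h1 := dc_proj r (X.obj α) (n - α'.dim) (m - α.dim) β
  have h2 := sMap_proj r (X.map (homOfLE h)) (n - α'.dim) β
  refine (congrArg (((sMap r (X.map (homOfLE h))).f (n - α'.dim)).f ≫ ·) h1).trans ?_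
  rw [← Category.assoc, h2, Category.assoc]

/-- The morphism `s_P s_Q X ⟶ s_(P × Q) X`. -/
def muHom {P Q : Cube} (X : P.Idx ⥤ Q.Idx ⥤ FiltComplex A) (n : ℤ) :
    ((rSimpleComplex r (inner r X)).X n).X ⟶ ((rSimpleComplex r (uncurried X)).X n).X :=
  ofProj r (uncurried X) n fun γ => iterProj r X n γ.fst γ.snd ≫
    dc ((X.obj γ.fst).obj γ.snd) (n - γ.fst.dim - γ.snd.dim) (n - γ.dim)

lemma muHom_proj {P Q : Cube} (X : P.Idx ⥤ Q.Idx ⥤ FiltComplex A) (n : ℤ)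
    (γ : (P.prod Q).Idx) : muHom (r := r) X n ≫ proj r (uncurried X) n γ =
      iterProj r X n γ.fst γ.snd ≫
        dc ((X.obj γ.fst).obj γ.snd) (n - γ.fst.dim - γ.snd.dim) (n - γ.dim) :=
  ofProj_proj _ _ _ _ _

lemma mem_iter_iff {P Q : Cube} {X : P.Idx ⥤ Q.Idx ⥤ FiltComplex A} {n p : ℤ} {T : A}
    {x : T ⟶ ((rSimpleComplex r (inner r X)).X n).X} :
    ((rSimpleComplex r (inner r X)).X n).Mem p x ↔ ∀ (α : P.Idx) (β : Q.Idx),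
      (((X.obj α).obj β).X (n - α.dim - β.dim)).Mem (p + r * α.dim + r * β.dim)
        (x ≫ iterProj r X n α β) := by
  rw [mem_rSimple_iff]
  refine forall_congr' fun α => ?_
  refine (mem_rSimple_iff (X := X.obj α)).trans ?_
  refine forall_congr' fun β => ?_
  rw [iterProj, ← Category.assoc]

/-- The terms of the differential in the direction of `Q`. The sign comes from the dimension of the
`P` component, which precedes the added vertex. -/
lemma cubeTerm_uncurried_of_fst_eq {P Q : Cube} (X : P.Idx ⥤ Q.Idx ⥤ FiltComplex A) {n m : ℤ}
    (hnm : n + 1 = m) (γ : (P.prod Q).Idx) (β : Q.Idx) :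
    dc ((X.obj γ.fst).obj β) (n - γ.fst.dim - β.dim) (n - (γ.fst.pair β).dim) ≫
        cubeTerm (uncurried X) n m (γ.fst.pair β) γ =
      ((-1 : ℤ) ^ γ.fst.dim) • (cubeTerm (X.obj γ.fst) (n - γ.fst.dim) (m - γ.fst.dim) β γ.snd ≫
        dc ((X.obj γ.fst).obj γ.snd) (m - γ.fst.dim - γ.snd.dim) (m - γ.dim)) := by
  have d1 := (γ.fst.pair β).dim_prod
  have d2 := γ.dim_prod
  rw [Idx.pair_fst, Idx.pair_snd] at d1
  by_cases hd : γ.snd.dim = β.dim + 1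
  swap
  · rw [cubeTerm_of_dim_ne _ hnm (by omega), cubeTerm_of_dim_ne _ (by omega) hd, zero_comp,
      smul_zero]
    exact comp_zero
  by_cases hle : β ≤ γ.snd
  swap
  · rw [cubeTerm_of_not_le _ _ _ hle, cubeTerm_of_not_le _ _ _ fun h => hle (Idx.snd_mono h),
      zero_comp, smul_zero]
    exact comp_zero
  have hle' : γ.fst.pair β ≤ γ := Idx.le_prod_iff.2 ⟨le_rfl, hle⟩
  have e1 : (uncurried X).map (homOfLE hle') = (X.obj γ.fst).map (homOfLE hle) := by
    refine Eq.trans (congrArg (· ≫ _) ?_) (Category.id_comp _)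
    exact congrArg (fun φ : X.obj γ.fst ⟶ X.obj γ.fst => φ.app β) (map_le_refl X _)
  rw [cubeTerm_of_le _ _ _ hle, cubeTerm_of_le _ _ _ hle',
    Preadditive.zsmul_comp, smul_smul,
    Idx.incidence_prod_of_fst_eq (γ := γ.fst.pair β) (Idx.pair_fst _ _) hle' (by omega)]
  refine (Preadditive.comp_zsmul _ _ _).trans (congrArg _ ?_)
  rw [e1, Category.assoc, dc_trans _ (by omega)]
  refine (dc_comm_assoc ((X.obj γ.fst).map (homOfLE hle)) _ _ _).symm.trans ?_
  exact congrArg (_ ≫ ·) (dc_trans _ (by omega) _)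

/-- The terms in the direction of `P`. Factors of `Q` come later in the order, so no sign appears.
-/
lemma cubeTerm_uncurried_of_snd_eq {P Q : Cube} (X : P.Idx ⥤ Q.Idx ⥤ FiltComplex A) (n m : ℤ)
    (γ : (P.prod Q).Idx) (α : P.Idx) :
    (iterProj r X n α γ.snd ≫
      dc ((X.obj α).obj γ.snd) (n - α.dim - γ.snd.dim) (n - (α.pair γ.snd).dim)) ≫
        cubeTerm (uncurried X) n m (α.pair γ.snd) γ =
      (proj r (inner r X) n α ≫ cubeTerm (inner r X) n m α γ.fst ≫
        proj r (X.obj γ.fst) (m - γ.fst.dim) γ.snd) ≫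
        dc ((X.obj γ.fst).obj γ.snd) (m - γ.fst.dim - γ.snd.dim) (m - γ.dim) := by
  have d1 := (α.pair γ.snd).dim_prod
  have d2 := γ.dim_prod
  rw [Idx.pair_fst, Idx.pair_snd] at d1
  by_cases hle : α ≤ γ.fst
  swap
  · rw [cubeTerm_of_not_le _ _ _ hle, cubeTerm_of_not_le _ _ _ fun h => hle (Idx.fst_mono h),
      zero_comp, comp_zero, zero_comp]
    exact comp_zero
  have hle' : α.pair γ.snd ≤ γ := Idx.le_prod_iff.2 ⟨hle, le_rfl⟩
  have e1 : (uncurried X).map (homOfLE hle') = (X.map (homOfLE hle)).app γ.snd := by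
    refine Eq.trans (congrArg (_ ≫ ·) ?_) (Category.comp_id _)
    exact map_le_refl (X.obj γ.fst) _
  rw [inner_cubeTerm_proj _ _ _ hle, cubeTerm_of_le _ _ _ hle', 
    Preadditive.comp_zsmul, Preadditive.zsmul_comp,
    Idx.incidence_prod_of_snd_eq (γ := α.pair γ.snd) (Idx.pair_snd _ _), Idx.pair_fst]
  refine (Preadditive.comp_zsmul _ _ _).trans (congrArg _ ?_)
  rw [e1, iterProj]
  simp only [Category.assoc]
  rw [dc_trans' _ (by omega)]
  refine (Category.assoc _ _ _).trans (congrArg (proj r (inner r X) n α ≫ ·) ?_)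
  refine (Category.assoc _ _ _).trans (congrArg (proj r (X.obj α) (n - α.dim) γ.snd ≫ ·) ?_)
  refine (dc_comm_assoc ((X.map (homOfLE hle)).app γ.snd) _ _ _).symm.trans ?_
  exact congrArg (_ ≫ ·) (dc_trans _ (by omega) _)

/-- The internal differentials match because the exponents `|α|` and `|β|` add up to the dimension
of the pair. The structure maps split into the `P` direction and the `Q` direction. -/
lemma muHom_comm {P Q : Cube} (X : P.Idx ⥤ Q.Idx ⥤ FiltComplex A) {n m : ℤ} (hnm : n + 1 = m) :
    muHom (r := r) X n ≫ ((rSimpleComplex r (uncurried X)).d n m).f =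
      ((rSimpleComplex r (inner r X)).d n m).f ≫ muHom X m := by
  refine proj_ext fun γ => ?_
  rw [apply_d_proj hnm, Category.assoc ((rSimpleComplex r (inner r X)).d n m).f, muHom_proj,
    muHom_proj, ← Category.assoc ((rSimpleComplex r (inner r X)).d n m).f, iter_d_proj X hnm,
    Preadditive.add_comp, Preadditive.add_comp, add_assoc]
  have hd := γ.dim_prod
  refine congrArg₂ (· + ·) ?_ ?_
  · rw [Preadditive.zsmul_comp, Preadditive.zsmul_comp, smul_smul, ← pow_add, ← hd,
      Category.assoc, Category.assoc]
    refine congrArg _ (congrArg (iterProj r X n γ.fst γ.snd ≫ ·) ?_)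
    exact dc_d _ (by omega)
  · simp only [muHom_proj]
    rw [← Equiv.sum_comp (Idx.prodEquiv P Q).symm, Fintype.sum_prod_type]
    -- A pair that differs from `γ` in both coordinates has codimension at least two in `γ` or is
    -- not contained in it; its term vanishes.
    rw [sum_sum_eq_cross _ γ.fst γ.snd]
    · rw [Preadditive.zsmul_comp, Preadditive.sum_comp, Preadditive.sum_comp, Finset.smul_sum]
      refine congrArg₂ (· + ·) (Finset.sum_congr rfl fun β _ => ?_)
        (Finset.sum_congr rfl fun α _ => cubeTerm_uncurried_of_snd_eq X n m γ α)
      refine (Category.assoc _ _ _).trans ?_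
      refine (congrArg (iterProj r X n γ.fst β ≫ ·)
        (cubeTerm_uncurried_of_fst_eq X hnm γ β)).trans ?_
      rw [Preadditive.comp_zsmul, Category.assoc]
    · intro α β hα hβ
      have d1 : ((Idx.prodEquiv P Q).symm (α, β)).dim = α.dim + β.dim := Idx.dim_prod _
      by_cases hle : (Idx.prodEquiv P Q).symm (α, β) ≤ γ
      · have h1 : α ≤ γ.fst := Idx.fst_mono hle
        have h2 : β ≤ γ.snd := Idx.snd_mono hle
        have h3 := Idx.dim_mono h1
        have h4 := Idx.dim_mono h2
        have h5 : α.dim ≠ γ.fst.dim := fun e => hα (Idx.eq_of_le_of_dim_le h1 e.ge)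
        have h6 : β.dim ≠ γ.snd.dim := fun e => hβ (Idx.eq_of_le_of_dim_le h2 e.ge)
        rw [cubeTerm_of_dim_ne _ hnm (by omega), comp_zero]
      · rw [cubeTerm_of_not_le _ _ _ hle, comp_zero]
    · have d1 : ((Idx.prodEquiv P Q).symm (γ.fst, γ.snd)).dim = γ.fst.dim + γ.snd.dim :=
        Idx.dim_prod _
      rw [cubeTerm_of_dim_ne _ hnm (by omega), comp_zero]

/-- The morphism `s_P s_Q X ⟶ s_(P × Q) X` of filtered complexes. -/
def muMap {P Q : Cube} (X : P.Idx ⥤ Q.Idx ⥤ FiltComplex A) :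
    rSimpleComplex r (inner r X) ⟶ rSimpleComplex r (uncurried X) where
  f n := ⟨muHom X n, fun p => by
    have h : ((rSimpleComplex r (inner r X)).X n).Mem p
      (((rSimpleComplex r (inner r X)).X n).W p).arrow := Subobject.factors_self _
    refine mem_rSimple_iff.2 fun γ => ?_
    rw [Category.assoc, muHom_proj, ← Category.assoc]
    refine ((mem_iter_iff.1 h γ.fst γ.snd).dc _).le (le_of_eq ?_)
    rw [γ.dim_prod]; push_cast; ring⟩
  comm' n m hnm := FiltObj.hom_ext (muHom_comm X hnm)

lemma muMap_proj {P Q : Cube} (X : P.Idx ⥤ Q.Idx ⥤ FiltComplex A) (n : ℤ)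
    (γ : (P.prod Q).Idx) : ((muMap (r := r) X).f n).f ≫ proj r (uncurried X) n γ =
      iterProj r X n γ.fst γ.snd ≫
        dc ((X.obj γ.fst).obj γ.snd) (n - γ.fst.dim - γ.snd.dim) (n - γ.dim) :=
  muHom_proj X n γ

/-- The generalized element of the iterated simple complex with given components. -/
lemma exists_iterProj_eq {P Q : Cube} (X : P.Idx ⥤ Q.Idx ⥤ FiltComplex A) (n : ℤ) {T : A}
    (x : ∀ (α : P.Idx) (β : Q.Idx), T ⟶ (((X.obj α).obj β).X (n - α.dim - β.dim)).X) :
    ∃ y : T ⟶ ((rSimpleComplex r (inner r X)).X n).X, ∀ α β, y ≫ iterProj r X n α β = x α β := by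
  refine ⟨ofProj r (inner r X) n fun α => ofProj r (X.obj α) (n - α.dim) (x α), fun α β => ?_⟩
  rw [iterProj, ← Category.assoc, ofProj_proj, ofProj_proj]

lemma iterProj_ext {P Q : Cube} {X : P.Idx ⥤ Q.Idx ⥤ FiltComplex A} {n : ℤ} {T : A}
    {x y : T ⟶ ((rSimpleComplex r (inner r X)).X n).X}
    (h : ∀ α β, x ≫ iterProj r X n α β = y ≫ iterProj r X n α β) : x = y :=
  proj_ext fun α => proj_ext (X := X.obj α) fun β => by
    rw [Category.assoc, Category.assoc]
    exact h α β

/-- The components on both sides are the same objects, and the shifts agree: `r|α| + r|β| = r|(α,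
β)|`. -/
lemma coneAcyclic_muMap {P Q : Cube} (X : P.Idx ⥤ Q.Idx ⥤ FiltComplex A) :
    ConeAcyclic r (muMap (r := r) X) := by
  refine coneAcyclic_of_bijective _ (fun n T y => ?_) (fun n T x hx => ?_)
  · obtain ⟨x, hx⟩ := exists_iterProj_eq (r := r) X n fun α β =>
      (y ≫ proj r (uncurried X) n (α.pair β)) ≫
        dc ((X.obj α).obj β) (n - (α.pair β).dim) (n - α.dim - β.dim)
    refine ⟨x, proj_ext fun γ => ?_, fun p hp => mem_iter_iff.2 fun α β => ?_⟩
    · obtain ⟨⟨α, β⟩, rfl⟩ := (Idx.prodEquiv P Q).symm.surjective γ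
      have d : (α.pair β).dim = α.dim + β.dim := Idx.dim_prod _
      rw [Category.assoc, muMap_proj, ← Category.assoc]
      refine (congrArg (· ≫ _) (hx α β)).trans ?_
      refine (Category.assoc _ _ _).trans ?_
      refine (congrArg ((y ≫ proj r (uncurried X) n (α.pair β)) ≫ ·) ?_).trans (Category.comp_id _)
      exact (dc_trans _ (by omega) _).trans (dc_self _ _)
    · rw [hx]
      have d := (α.pair β).dim_prod
      rw [Idx.pair_fst, Idx.pair_snd] at d
      refine ((mem_rSimple_iff.1 hp (α.pair β)).dc _).le (le_of_eq ?_)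
      rw [d]; push_cast; ring
  · refine iterProj_ext fun α β => ?_
    have d := (α.pair β).dim_prod
    rw [Idx.pair_fst, Idx.pair_snd] at d
    have e := (hx =≫ proj r (uncurried X) n (α.pair β)) =≫
      dc ((X.obj α).obj β) (n - (α.pair β).dim) (n - α.dim - β.dim)
    rw [Category.assoc, muMap_proj, zero_comp] at e
    rw [zero_comp]
    refine Eq.trans ?_ (e.trans zero_comp)
    refine Eq.trans (congrArg (x ≫ ·) ?_) (Category.assoc _ _ _).symm
    refine Eq.trans ?_ (Category.assoc _ _ _).symm
    refine (Category.comp_id _).symm.trans (congrArg (iterProj r X n α β ≫ ·) ?_)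
    exact ((dc_trans _ (by omega) _).trans (dc_self _ _)).symm

end Mu

/-! ### Faces of a simplex -/

namespace Cube

lemma Idx.weight_of_subsingleton {P : Cube} [Subsingleton P.ι] (α : P.Idx) (i : P.ι)
    (s : (P.S i).carrier) : α.weight i s = ((α.set i).filter (· < s)).card := by
  unfold Idx.weight
  rw [Finset.sum_eq_zero, zero_add]
  intro k hk
  obtain rfl := Subsingleton.elim k i
  exact absurd (Finset.mem_filter.1 hk).2 (lt_irrefl _)

variable {S : CubeSet}

instance : Subsingleton (single S).ι := inferInstanceAs (Subsingleton Unit)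

/-- The set of vertices of a face of a simplex. -/
def verts (α : (single S).Idx) : Finset S.carrier := α.set ()

/-- The face of a simplex with given set of vertices. -/
def faceOf (a : Finset S.carrier) (h : a.Nonempty) : (single S).Idx := fun _ => (⟨a, h⟩ : S.Face)

/-- The face of a simplex with a single vertex. -/
def vertex (m : S.carrier) : (single S).Idx := faceOf {m} (Finset.singleton_nonempty m)

/-- The face of a simplex obtained by adding a vertex. -/
def adjoin (α : (single S).Idx) (m : S.carrier) : (single S).Idx := α.add () m

lemma verts_faceOf (a : Finset S.carrier) (h : a.Nonempty) : verts (faceOf a h) = a := rfl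

lemma verts_vertex (m : S.carrier) : verts (vertex m) = {m} := rfl

lemma verts_adjoin (α : (single S).Idx) (m : S.carrier) :
    verts (adjoin α m) = insert m (verts α) :=
  α.add_set_self () m

lemma verts_nonempty (α : (single S).Idx) : (verts α).Nonempty := α.set_nonempty ()

lemma single_ext {α β : (single S).Idx} (h : verts α = verts β) : α = β :=
  Idx.ext fun _ => h

lemma single_le_iff {α β : (single S).Idx} : α ≤ β ↔ verts α ⊆ verts β :=
  ⟨fun h => h (), fun h _ => h⟩

lemma dim_eq_card_verts (α : (single S).Idx) : α.dim = (verts α).card - 1 :=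
  Fintype.sum_unique (ι := Unit) _

lemma vertex_dim (m : S.carrier) : (vertex m).dim = 0 := by
  rw [dim_eq_card_verts, verts_vertex, Finset.card_singleton]

lemma adjoin_dim {α : (single S).Idx} {m : S.carrier} (h : m ∉ verts α) :
    (adjoin α m).dim = α.dim + 1 :=
  α.dim_add h

lemma incidence_adjoin {α : (single S).Idx} {m : S.carrier} (h : m ∉ verts α) :
    α.incidence (adjoin α m) = (-1) ^ ((verts α).filter (· < m)).card :=
  (Idx.incidence_add α h).trans (congrArg _ (Idx.weight_of_subsingleton α () m))

lemma exists_eq_adjoin {α β : (single S).Idx} (h : α ≤ β) (hd : β.dim = α.dim + 1) :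
    ∃ s ∉ verts α, β = adjoin α s := by
  obtain ⟨i, s, hs, rfl⟩ := Idx.exists_eq_add h hd
  exact ⟨s, hs, rfl⟩

lemma incidence_adjoin_of_min {α : (single S).Idx} {m : S.carrier} (hm : ∀ s, m ≤ s)
    (h : m ∉ verts α) : α.incidence (adjoin α m) = 1 := by
  have : (verts α).filter (· < m) = ∅ := Finset.filter_eq_empty_iff.2 fun s _ => (hm s).not_gt
  rw [incidence_adjoin h, this, Finset.card_empty, pow_zero]

lemma adjoin_le_adjoin_iff {α β : (single S).Idx} {m : S.carrier} (hα : m ∉ verts α) :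
    adjoin α m ≤ adjoin β m ↔ α ≤ β := by
  rw [single_le_iff, single_le_iff, verts_adjoin, verts_adjoin]
  exact Finset.insert_subset_insert_iff hα

lemma vertex_le_adjoin (β : (single S).Idx) (m : S.carrier) : vertex m ≤ adjoin β m := by
  rw [single_le_iff, verts_vertex, verts_adjoin]
  exact Finset.singleton_subset_iff.2 (Finset.mem_insert_self _ _)

lemma le_adjoin (β : (single S).Idx) (m : S.carrier) : β ≤ adjoin β m := Idx.le_add _ _ _

lemma le_of_le_adjoin {α γ : (single S).Idx} {m : S.carrier} (hγ : m ∉ verts γ)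
    (h : γ ≤ adjoin α m) : γ ≤ α := by
  rw [single_le_iff, verts_adjoin] at h
  exact single_le_iff.2 ((Finset.subset_insert_iff_of_notMem hγ).1 h)

/-- Relative to `{m}` the added vertex is the other end point of the edge, and the least vertex `m`
is the only one before it. -/
lemma incidence_vertex_adjoin_of_min {β : (single S).Idx} {m : S.carrier} (hm : ∀ s, m ≤ s)
    (h : m ∉ verts β) (hβ : β.dim = 0) : (vertex m).incidence (adjoin β m) = -1 := by
  obtain ⟨s, hs, e⟩ := exists_eq_adjoin (vertex_le_adjoin β m)
    (by rw [adjoin_dim h, hβ, vertex_dim])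
  rw [verts_vertex, Finset.mem_singleton] at hs
  have : (verts (vertex m)).filter (· < s) = {m} := by
    rw [verts_vertex, Finset.filter_singleton, if_pos (lt_of_le_of_ne (hm s) (Ne.symm hs))]
  rw [e, incidence_adjoin (by rw [verts_vertex, Finset.mem_singleton]; exact hs), this,
    Finset.card_singleton, pow_one]

lemma adjoin_comm (α : (single S).Idx) (s t : S.carrier) :
    adjoin (adjoin α s) t = adjoin (adjoin α t) s :=
  Idx.add_comm α _ _ _ _

/-- The vertex that distinguishes `β` from `α` has one more predecessor, `m`, once `m` is present.
This sign change is the source of the cancellations in the contracting homotopy. -/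
lemma incidence_adjoin_adjoin_of_min {α β : (single S).Idx} {m : S.carrier} (hm : ∀ s, m ≤ s)
    (hβ : m ∉ verts β) (h : α ≤ β) (hd : β.dim = α.dim + 1) :
    (adjoin α m).incidence (adjoin β m) = - α.incidence β := by
  obtain ⟨s, hs, rfl⟩ := exists_eq_adjoin h hd
  have hα : m ∉ verts α := fun h' => hβ (single_le_iff.1 h h')
  have hne : s ≠ m := by
    rintro rfl
    exact hβ (by rw [verts_adjoin]; exact Finset.mem_insert_self _ _)
  have hs' : s ∉ verts (adjoin α m) := by
    rw [verts_adjoin, Finset.mem_insert, not_or]; exact ⟨hne, hs⟩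
  rw [adjoin_comm, incidence_adjoin hs, incidence_adjoin hs', verts_adjoin, Finset.filter_insert,
    if_pos (lt_of_le_of_ne (hm s) hne.symm), Finset.card_insert_of_notMem (by simp [hα]), pow_succ,
    mul_neg_one]

lemma adjoin_injOn {α β : (single S).Idx} {m : S.carrier} (hα : m ∉ verts α) (hβ : m ∉ verts β)
    (h : adjoin α m = adjoin β m) : α = β :=
  le_antisymm ((adjoin_le_adjoin_iff hα).1 h.le) ((adjoin_le_adjoin_iff hβ).1 h.ge)

lemma exists_adjoin {γ : (single S).Idx} {m : S.carrier} (hm : m ∈ verts γ) (h : γ ≠ vertex m) :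
    ∃ α, m ∉ verts α ∧ adjoin α m = γ := by
  refine ⟨faceOf ((verts γ).erase m) ?_, Finset.notMem_erase m _, single_ext ?_⟩
  · rw [Finset.nonempty_iff_ne_empty]
    intro e
    refine h (single_ext ?_)
    rw [verts_vertex, ← Finset.insert_erase hm, e]
    rfl
  · rw [verts_adjoin, verts_faceOf, Finset.insert_erase hm]

open Classical in
/-- A sum over the faces of a simplex, organized by means of a vertex. -/
lemma sum_single {M : Type*} [AddCommMonoid M] (F : (single S).Idx → M) (m : S.carrier) :
    ∑ α, F α = F (vertex m) +
      (∑ α with m ∉ verts α, F α + ∑ α with m ∉ verts α, F (adjoin α m)) := by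
  have h1 : ∑ α with m ∈ verts α, F α =
      F (vertex m) + ∑ α with m ∉ verts α, F (adjoin α m) := by
    have hv : vertex m ∈ Finset.univ.filter fun α : (single S).Idx => m ∈ verts α :=
      Finset.mem_filter.2 ⟨Finset.mem_univ _, Finset.mem_singleton_self m⟩
    rw [← Finset.add_sum_erase _ _ hv]
    congr 1
    symm
    refine Finset.sum_bij (fun α _ => adjoin α m) ?_ ?_ ?_ fun _ _ => rfl
    · intro α hα
      have hα' := (Finset.mem_filter.1 hα).2
      refine Finset.mem_erase.2 ⟨fun e => ?_, Finset.mem_filter.2 ⟨Finset.mem_univ _, ?_⟩⟩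
      · have := adjoin_dim hα'
        rw [e, vertex_dim] at this
        omega
      · rw [verts_adjoin]; exact Finset.mem_insert_self _ _
    · intro α hα β hβ h
      exact adjoin_injOn (Finset.mem_filter.1 hα).2 (Finset.mem_filter.1 hβ).2 h
    · intro γ hγ
      obtain ⟨h1, h2⟩ := Finset.mem_erase.1 hγ
      obtain ⟨α, hα, e⟩ := exists_adjoin (Finset.mem_filter.1 h2).2 h1
      exact ⟨α, Finset.mem_filter.2 ⟨Finset.mem_univ _, hα⟩, e⟩
  rw [← Finset.sum_filter_add_sum_filter_not Finset.univ fun α : (single S).Idx => m ∈ verts α,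
    h1, add_assoc, add_comm (∑ α with m ∉ verts α, F (adjoin α m))]

end Cube

/-! ### The morphism `λ` of one simplex: contraction to the least vertex -/

section LamMem

attribute [local instance] Abelian.hasFiniteBiproducts

variable {A : Type u} [Category.{v} A] [Abelian A] (r : ℕ)

/-- The projection of the simple of a constant diagram onto the summand of a vertex. -/
def vertexMap {S : CubeSet} (m : S.carrier) (X : FiltComplex A) :
    rSimpleComplex r (constDiag (single S) X) ⟶ X where
  f n := ⟨proj r (constDiag (single S) X) n (vertex m) ≫
      dc X (n - (vertex m).dim) n, fun p => by
    have h := mem_rSimple_iff.1 (Subobject.factors_self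
      (((rSimpleComplex r (constDiag (single S) X)).X n).W p)) (vertex m)
    have h' := (h.dc n).le (q := p) (by rw [vertex_dim]; simp)
    rwa [Category.assoc] at h'⟩
  comm' n m' hnm := by
    refine FiltObj.hom_ext ?_
    have hnm : n + 1 = m' := hnm
    have hd := vertex_dim m
    change (proj r (constDiag (single S) X) n (vertex m) ≫ dc X _ n) ≫ (X.d n m').f =
      _ ≫ proj r (constDiag (single S) X) m' (vertex m) ≫ dc X _ m'
    have h1 := d_proj (r := r) (constDiag (single S) X) hnm (vertex m)
    rw [Finset.sum_eq_zero, add_zero] at h1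
    · have hs : (-1 : ℤ) ^ (vertex m).dim = 1 := by rw [hd, pow_zero]
      rw [← Category.assoc ((rSimpleComplex r _).d n m').f, h1, hs, one_smul,
        Category.assoc, Category.assoc]
      exact congrArg (_ ≫ ·) (dc_d X (by omega))
    · intro α _
      rw [cubeTerm_of_dim_ne _ hnm (by omega), comp_zero]

open Classical in
/-- The contracting homotopy of the simple of a constant diagram given by a vertex of a simplex. -/
def vertexHomotopy {S : CubeSet} (m : S.carrier) (X : FiltComplex A) (j i : ℤ) :
    ((rSimpleComplex r (constDiag (single S) X)).X j).X ⟶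
      ((rSimpleComplex r (constDiag (single S) X)).X i).X :=
  ofProj r (constDiag (single S) X) i fun α =>
    if m ∈ verts α then 0 else
      proj r (constDiag (single S) X) j (adjoin α m) ≫
        dc X (j - (adjoin α m).dim) (i - α.dim)

variable {r}

lemma vertexHomotopy_proj_of_mem {S : CubeSet} {m : S.carrier} (X : FiltComplex A) (j i : ℤ)
    {α : (single S).Idx} (h : m ∈ verts α) :
    vertexHomotopy r m X j i ≫ proj r (constDiag (single S) X) i α = 0 :=
  (ofProj_proj _ _ _ _ _).trans (if_pos h)

lemma vertexHomotopy_proj {S : CubeSet} {m : S.carrier} (X : FiltComplex A) (j i : ℤ)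
    {α : (single S).Idx} (h : m ∉ verts α) :
    vertexHomotopy r m X j i ≫ proj r (constDiag (single S) X) i α =
      proj r (constDiag (single S) X) j (adjoin α m) ≫
        dc X (j - (adjoin α m).dim) (i - α.dim) :=
  (ofProj_proj _ _ _ _ _).trans (if_neg h)

lemma vertexMap_lamMap_proj {S : CubeSet} (m : S.carrier) (X : FiltComplex A) (j : ℤ)
    (β : (single S).Idx) :
    (((vertexMap r m X).f j).f ≫ ((lamMap r (single S) X).f j).f) ≫
        proj r (constDiag (single S) X) j β =
      proj r (constDiag (single S) X) j (vertex m) ≫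
        dc X (j - (vertex m).dim) (j - β.dim) := by
  rw [Category.assoc, lamMap_proj]
  refine (Category.assoc _ _ _).trans (congrArg (_ ≫ ·) ?_)
  exact dc_trans X (by rw [vertex_dim]; simp) _

/-- Cancellation of the structure maps that do not involve `m`: they occur once among faces
containing `m` and once among faces avoiding it, with opposite incidence signs. -/
lemma cubeTerm_adjoin_add {S : CubeSet} {m : S.carrier} (hm : ∀ s, m ≤ s) (X : FiltComplex A)
    {i j k : ℤ} (hij : i + 1 = j) (hjk : j + 1 = k) {α β : (single S).Idx} (hα : m ∉ verts α)
    (hβ : m ∉ verts β) :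
    cubeTerm (constDiag (single S) X) j k (adjoin α m) (adjoin β m) ≫
        dc X (k - (adjoin β m).dim) (j - β.dim) +
      dc X (j - (adjoin α m).dim) (i - α.dim) ≫
        cubeTerm (constDiag (single S) X) i j α β = 0 := by
  have e1 := adjoin_dim hα
  have e2 := adjoin_dim hβ
  by_cases hle : α ≤ β
  swap
  · rw [cubeTerm_of_not_le _ _ _ hle,
      cubeTerm_of_not_le _ _ _ fun h => hle ((adjoin_le_adjoin_iff hα).1 h)]
    exact (congrArg₂ (· + ·) zero_comp comp_zero).trans (add_zero 0)
  by_cases hd : β.dim = α.dim + 1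
  swap
  · rw [cubeTerm_of_dim_ne _ hij hd, cubeTerm_of_dim_ne _ hjk (by omega)]
    exact (congrArg₂ (· + ·) zero_comp comp_zero).trans (add_zero 0)
  rw [cubeTerm_const X _ _ hle, cubeTerm_const X _ _ ((adjoin_le_adjoin_iff hα).2 hle),
    incidence_adjoin_adjoin_of_min hm hβ hle hd]
  refine (congrArg₂ (· + ·) (Preadditive.zsmul_comp _ _ _) (Preadditive.comp_zsmul _ _ _)).trans ?_
  rw [dc_trans' X (by omega), dc_trans X (by omega), neg_smul, neg_add_cancel]

/-- The cancellation pattern at a face `β` avoiding `m`: `a`, `a'` are the internal differentials,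
`c`, `c'` the structure maps away from `m`, `v` the term of the vertex `m`, and `b` the term of `β`
itself. -/
lemma add_add_eq_sub_of_add_eq_zero {G : Type*} [AddCommGroup G] {a a' b c c' v : G}
    (h : a + a' = 0) (h' : c + c' = 0) : a + (-v + (b + c)) + (a' + c') = b - v := by
  rw [eq_neg_of_add_eq_zero_right h, eq_neg_of_add_eq_zero_right h']
  abel

/-- The homotopy reads the component at `β ∪ {m}` into the summand of `β`, as in the cone structure
of a simplex over one vertex. Choosing `m` least gives all inclusions `β ⊂ β ∪ {m}` the sign `+1`.
-/
lemma d_vertexHomotopy {S : CubeSet} {m : S.carrier} (hm : ∀ s, m ≤ s) (X : FiltComplex A)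
    {i j k : ℤ} (hij : i + 1 = j) (hjk : j + 1 = k) :
    ((rSimpleComplex r (constDiag (single S) X)).d j k).f ≫
        vertexHomotopy r m X k j +
      vertexHomotopy r m X j i ≫
        ((rSimpleComplex r (constDiag (single S) X)).d i j).f =
    𝟙 _ - ((vertexMap r m X).f j).f ≫ ((lamMap r (single S) X).f j).f := by
  classical
  refine proj_ext fun β => ?_
  rw [Preadditive.add_comp, Preadditive.sub_comp, vertexMap_lamMap_proj, Category.id_comp,
    apply_d_proj hij, Category.assoc, sum_single _ m]
  have hv : m ∈ verts (vertex m) := Finset.mem_singleton_self m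
  have h0 : ∑ α : (single S).Idx with m ∉ verts α,
      (vertexHomotopy r m X j i ≫
        proj r (constDiag (single S) X) i (adjoin α m)) ≫
          cubeTerm (constDiag (single S) X) i j (adjoin α m) β = 0 := by
    refine Finset.sum_eq_zero fun α _ => ?_
    rw [vertexHomotopy_proj_of_mem, zero_comp]
    rw [verts_adjoin]; exact Finset.mem_insert_self _ _
  rw [h0, vertexHomotopy_proj_of_mem X j i hv, zero_comp, zero_add, add_zero]
  -- If `m ∈ β`, only the homotopy followed by the differential contributes. For `β ≠ {m}` the facet
  -- without `m` returns the component at `β`; for `β = {m}` both sides are zero.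
  by_cases hβ : m ∈ verts β
  · rw [vertexHomotopy_proj_of_mem X j i hβ, vertexHomotopy_proj_of_mem X k j hβ, zero_comp,
      smul_zero, comp_zero, zero_add, zero_add]
    by_cases hβv : β = vertex m
    · subst hβv
      rw [Finset.sum_eq_zero]
      · rw [dc_self]
        exact (sub_eq_zero.2 (Category.comp_id _).symm).symm
      · intro α hα
        rw [cubeTerm_of_dim_ne _ hij (by rw [vertex_dim]; omega), comp_zero]
    · obtain ⟨α, hα, rfl⟩ := exists_adjoin hβ hβv
      have e1 := adjoin_dim hα
      have e3 := vertex_dim m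
      rw [Finset.sum_eq_single α]
      · rw [vertexHomotopy_proj X j i hα, cubeTerm_const X _ _ (le_adjoin α m),
          incidence_adjoin_of_min hm hα, one_smul, Category.assoc, dc_trans X (by omega), dc_self,
          Category.comp_id, dc_eq_zero X (i := j - (vertex m).dim) (by omega), comp_zero, sub_zero]
      · intro γ hγ hne
        have hγ := (Finset.mem_filter.1 hγ).2
        by_cases hle : γ ≤ adjoin α m
        · rw [cubeTerm_of_dim_ne _ hij, comp_zero]
          intro hd
          exact hne (Idx.eq_of_le_of_dim_le (le_of_le_adjoin hγ hle) (by omega))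
        · rw [cubeTerm_of_not_le _ _ _ hle, comp_zero]
      · exact fun h => (h (Finset.mem_filter.2 ⟨Finset.mem_univ _, hα⟩)).elim
  -- If `m ∉ β`, the component at `β ∪ {m}` of the differential is expanded. The facet `β` gives the
  -- identity and the vertex `m` gives the subtracted term, nonzero only when `β` is a vertex; the
  -- rest cancels against the other half of the homotopy.
  · have e2 := adjoin_dim hβ
    have e3 := vertex_dim m
    rw [vertexHomotopy_proj X j i hβ, Category.assoc, vertexHomotopy_proj X k j hβ,
      ← Category.assoc, d_proj _ hjk, sum_single _ m, Preadditive.add_comp, Preadditive.add_comp,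
      Preadditive.add_comp, Preadditive.sum_comp, Preadditive.sum_comp]
    have t1 : (((-1 : ℤ) ^ (adjoin β m).dim) • (proj r (constDiag (single S) X) j (adjoin β m) ≫
          (X.d (j - (adjoin β m).dim) (k - (adjoin β m).dim)).f)) ≫
            dc X (k - (adjoin β m).dim) (j - β.dim) +
        ((-1 : ℤ) ^ β.dim) • ((proj r (constDiag (single S) X) j (adjoin β m) ≫
          dc X (j - (adjoin β m).dim) (i - β.dim) ≫ (X.d (i - β.dim) (j - β.dim)).f)) = 0 := by
      have hs : (-1 : ℤ) ^ (adjoin β m).dim = -(-1) ^ β.dim := by rw [e2, pow_succ, mul_neg_one]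
      rw [Preadditive.zsmul_comp, Category.assoc,
        dc_d X (j := k - (adjoin β m).dim) (by omega), hs, neg_smul,
        neg_add_cancel]
    have t2 : (proj r (constDiag (single S) X) j (vertex m) ≫
        cubeTerm (constDiag (single S) X) j k (vertex m) (adjoin β m)) ≫
          dc X (k - (adjoin β m).dim) (j - β.dim) =
        - (proj r (constDiag (single S) X) j (vertex m) ≫ dc X (j - (vertex m).dim) (j - β.dim)) := by
      rw [cubeTerm_const X _ _ (vertex_le_adjoin β m), Preadditive.comp_zsmul,
        Preadditive.zsmul_comp, Category.assoc, dc_trans' X (by omega)]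
      by_cases h0 : β.dim = 0
      · rw [incidence_vertex_adjoin_of_min hm hβ h0, neg_smul, one_smul]
      · rw [dc_eq_zero X (by omega), comp_zero, smul_zero, neg_zero]
    have t3 : ∑ α : (single S).Idx with m ∉ verts α, (proj r (constDiag (single S) X) j α ≫
        cubeTerm (constDiag (single S) X) j k α (adjoin β m)) ≫
          dc X (k - (adjoin β m).dim) (j - β.dim) = proj r (constDiag (single S) X) j β := by
      rw [Finset.sum_eq_single β]
      · rw [cubeTerm_const X _ _ (le_adjoin β m), incidence_adjoin_of_min hm hβ, one_smul,
          Category.assoc, dc_trans' X (by omega), dc_self, Category.comp_id]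
      · intro γ hγ hne
        have hγ := (Finset.mem_filter.1 hγ).2
        by_cases hle : γ ≤ adjoin β m
        · rw [cubeTerm_of_dim_ne _ hjk, comp_zero, zero_comp]
          intro hd
          exact hne (Idx.eq_of_le_of_dim_le (le_of_le_adjoin hγ hle) (by omega))
        · rw [cubeTerm_of_not_le _ _ _ hle, comp_zero, zero_comp]
      · exact fun h => (h (Finset.mem_filter.2 ⟨Finset.mem_univ _, hβ⟩)).elim
    have t4 : ∑ α : (single S).Idx with m ∉ verts α,
          (proj r (constDiag (single S) X) j (adjoin α m) ≫
            cubeTerm (constDiag (single S) X) j k (adjoin α m) (adjoin β m)) ≫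
          dc X (k - (adjoin β m).dim) (j - β.dim) +
        ∑ α : (single S).Idx with m ∉ verts α,
          (vertexHomotopy r m X j i ≫ proj r (constDiag (single S) X) i α) ≫
            cubeTerm (constDiag (single S) X) i j α β = 0 := by
      rw [← Finset.sum_add_distrib]
      refine Finset.sum_eq_zero fun α hα => ?_
      have hα := (Finset.mem_filter.1 hα).2
      rw [vertexHomotopy_proj X j i hα, Category.assoc, Category.assoc, ← Preadditive.comp_add,
        cubeTerm_adjoin_add hm X hij hjk hα hβ, comp_zero]
    rw [t2, t3]
    exact add_add_eq_sub_of_add_eq_zero t1 t4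

/-- The retraction is the projection to the least vertex. -/
lemma coneAcyclic_lamMap_single (S : CubeSet) (X : FiltComplex A) :
    ConeAcyclic r (lamMap r (single S) X) := by
  obtain ⟨m, hm⟩ : ∃ m : S.carrier, ∀ s, m ≤ s :=
    ⟨Finset.univ.min' Finset.univ_nonempty, fun s => Finset.min'_le _ _ (Finset.mem_univ s)⟩
  refine coneAcyclic_of_homotopy _ (vertexMap r m X) ?_ (vertexHomotopy r m X)
    (fun i j k hij hjk => d_vertexHomotopy hm X hij hjk) ?_ ?_
  · refine HomologicalComplex.hom_ext _ _ fun n => FiltObj.hom_ext ?_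
    change ((lamMap r (single S) X).f n).f ≫ proj r _ n (vertex m) ≫ dc X _ n = 𝟙 _
    rw [← Category.assoc, lamMap_proj]
    exact (dc_trans X (by rw [vertex_dim]; simp) _).trans (dc_self X n)
  -- The image of `λ` is supported on vertices, whereas the homotopy reads only faces `β ∪ {m}` of
  -- positive dimension.
  · intro i j _
    refine proj_ext fun β => ?_
    rw [Category.assoc, zero_comp]
    by_cases hβ : m ∈ verts β
    · rw [vertexHomotopy_proj_of_mem X j i hβ, comp_zero]
    · have e := adjoin_dim hβ
      rw [vertexHomotopy_proj X j i hβ, ← Category.assoc, lamMap_proj, dc_eq_zero X (by omega)]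
      exact zero_comp
  -- The component at `β` comes from a face of dimension `|β| + 1`, where `W(r)_p` allows `r` more:
  -- this is the permitted rise of the filtration degree.
  · intro i j p _ T y hy
    refine mem_rSimple_iff.2 fun β => ?_
    rw [Category.assoc]
    by_cases hβ : m ∈ verts β
    · rw [vertexHomotopy_proj_of_mem X j i hβ, comp_zero]; exact FiltObj.Mem.zero
    · have e := adjoin_dim hβ
      rw [vertexHomotopy_proj X j i hβ, ← Category.assoc]
      refine ((mem_rSimple_iff.1 hy (adjoin β m)).dc _).le (le_of_eq ?_)
      rw [e]; push_cast; ring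

end LamMem

/-! ### Naturality, associativity and unitality -/

namespace Cube

variable {P Q R : Cube}

/-- Naturality of `λ` in the cube needs signs only at vertices, where there is nothing to permute.
-/
lemma Hom.sign_of_dim_eq_zero (f : P ⟶ Q) {α : P.Idx} (h : α.dim = 0) : f.sign α = 1 := by
  refine Finset.prod_eq_one fun j _ => Finset.prod_eq_one fun s hs =>
    Finset.prod_eq_one fun t ht => ?_
  obtain rfl := Finset.card_le_one.1 (Idx.card_set_of_dim_eq_zero h _).le s hs t ht
  exact if_neg fun h => lt_irrefl _ h.1

/-- Applied to the associativity, unit and splitting isomorphisms of cubes, which are identities on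
each factor and so introduce no signs. -/
lemma Hom.sign_of_monotone (f : P ⟶ Q) (h : ∀ j, Monotone (f.u j)) (α : P.Idx) :
    f.sign α = 1 :=
  Finset.prod_eq_one fun j _ => Finset.prod_eq_one fun _ _ => Finset.prod_eq_one fun _ _ =>
    if_neg fun h' => absurd (h j h'.1.le) h'.2.not_ge

lemma sign_assoc (γ : ((P.prod Q).prod R).Idx) : Hom.sign (assoc P Q R) γ = 1 := by
  refine Hom.sign_of_monotone _ (fun j => ?_) γ
  rcases j with i | j
  · exact monotone_id
  · rcases j with i | j
    · exact monotone_id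
    · exact monotone_id

lemma sign_leftUnit (α : P.Idx) : Hom.sign (leftUnit P) α = 1 := by
  refine Hom.sign_of_monotone _ (fun j => ?_) α
  rcases j with i | j
  · exact i.elim
  · exact monotone_id

lemma sign_rightUnit (α : P.Idx) : Hom.sign (rightUnit P) α = 1 := by
  refine Hom.sign_of_monotone _ (fun j => ?_) α
  rcases j with i | j
  · exact monotone_id
  · exact j.elim

end Cube

section Axioms

attribute [local instance] Abelian.hasFiniteBiproducts

variable {A : Type u} [Category.{v} A] [Abelian A] {r : ℕ} {P Q R : Cube} {K : FiltComplex A}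

lemma comp_sMap_proj {X Y : P.Idx ⥤ FiltComplex A} (f : K ⟶ rSimpleComplex r X) (a : X ⟶ Y)
    (n : ℤ) (β : P.Idx) : ((f ≫ sMap r a).f n).f ≫ proj r Y n β =
      ((f.f n).f ≫ proj r X n β) ≫ ((a.app β).f (n - β.dim)).f := by
  refine (Category.assoc _ _ _).trans ?_
  rw [sMap_proj, Category.assoc]

lemma comp_sRes_proj {X : P.Idx ⥤ FiltComplex A} (f : K ⟶ rSimpleComplex r X) {P' : Cube}
    (u : P' ⟶ P) (n : ℤ) (β : P'.Idx) :
    ((f ≫ sRes r u X).f n).f ≫ proj r (u.functor ⋙ X) n β =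
      u.sign β • (((f.f n).f ≫ proj r X n (u.map β)) ≫ dc (X.obj (u.map β)) _ (n - β.dim)) := by
  refine (Category.assoc _ _ _).trans ?_
  rw [sRes_proj]
  exact (Preadditive.comp_zsmul _ _ _).trans (congrArg _ (Category.assoc _ _ _).symm)

lemma comp_lamMap_proj {X : FiltComplex A} (f : K ⟶ X) (n : ℤ) (α : P.Idx) :
    ((f ≫ lamMap r P X).f n).f ≫ proj r (constDiag P X) n α = (f.f n).f ≫ dc X n (n - α.dim) := by
  refine (Category.assoc _ _ _).trans ?_
  rw [lamMap_proj]

lemma comp_muMap_proj {X : P.Idx ⥤ Q.Idx ⥤ FiltComplex A}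
    (f : K ⟶ rSimpleComplex r (inner r X)) (n : ℤ) (γ : (P.prod Q).Idx) :
    ((f ≫ muMap X).f n).f ≫ proj r (uncurried X) n γ =
      (((f.f n).f ≫ proj r (inner r X) n γ.fst) ≫ proj r (X.obj γ.fst) (n - γ.fst.dim) γ.snd) ≫
        dc ((X.obj γ.fst).obj γ.snd) (n - γ.fst.dim - γ.snd.dim) (n - γ.dim) := by
  refine (Category.assoc _ _ _).trans ?_
  rw [muMap_proj, iterProj, Category.assoc, Category.assoc, Category.assoc]

lemma lamMap_naturality {X Y : FiltComplex A} (f : X ⟶ Y) :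
    f ≫ lamMap r P Y = lamMap r P X ≫ sMap r ((Functor.const P.Idx).map f) := by
  refine hom_ext_proj fun n β => ?_
  refine (comp_lamMap_proj _ _ _).trans (Eq.trans ?_ (comp_sMap_proj _ _ _ _).symm)
  refine Eq.trans ?_ (congrArg (· ≫ _) (lamMap_proj r P X n β)).symm
  exact dc_comm f _ _

lemma lamMap_restrict {P' : Cube} (u : P' ⟶ P) (X : FiltComplex A) :
    lamMap r P X ≫ sRes r u (constDiag P X) = lamMap r P' X := by
  refine hom_ext_proj fun n β => ?_
  refine (comp_sRes_proj _ _ _ _).trans (Eq.trans ?_ (lamMap_proj r P' X n β).symm)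
  rw [lamMap_proj]
  have hd := u.dim_map β
  by_cases hβ : β.dim = 0
  · rw [u.sign_of_dim_eq_zero hβ, one_smul, dc_trans X (by omega)]
  · rw [dc_eq_zero X (i := n) (j := n - (u.map β).dim) (by omega), zero_comp, smul_zero,
      dc_eq_zero X (by omega)]

/-- Restriction along an identification of cubes, followed by the comparison of the two diagrams,
has a face equal to `α` but not syntactically so. The structure map along this equality is removed
here once for all three coherence laws. -/
lemma comp_sRes_sMap_proj {P' : Cube} {X : P.Idx ⥤ FiltComplex A} (f : K ⟶ rSimpleComplex r X)
    (u : P' ⟶ P) {Y : P'.Idx ⥤ FiltComplex A} (a : u.functor ⋙ X ⟶ Y) (n : ℤ) {α : P.Idx}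
    {β : P'.Idx} (hs : u.sign β = 1) (h : u.map β = α) (b : X.obj α ⟶ Y.obj β)
    (hb : a.app β = X.map (homOfLE h.le) ≫ b) :
    ((f ≫ sRes r u X ≫ sMap r a).f n).f ≫ proj r Y n β =
      (((f.f n).f ≫ proj r X n α) ≫ (b.f _).f) ≫ dc (Y.obj β) (n - α.dim) (n - β.dim) := by
  subst h
  rw [map_le_refl, Category.id_comp] at hb
  rw [← Category.assoc]
  refine (comp_sMap_proj _ _ _ _).trans ?_
  refine (congrArg (· ≫ _) (comp_sRes_proj _ _ _ _)).trans ?_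
  rw [hs, one_smul, hb]
  refine (Category.assoc _ _ _).trans (Eq.trans ?_ (Category.assoc _ _ _).symm)
  exact congrArg (_ ≫ ·) (dc_comm b _ _).symm

/-- The morphism of iterated simples given by a natural transformation. -/
abbrev innerMap {X Y : P.Idx ⥤ Q.Idx ⥤ FiltComplex A} (a : X ⟶ Y) : inner r X ⟶ inner r Y where
  app α := sMap r (a.app α)
  naturality := ((innerSimple (rSimple A r) P Q).map a).naturality

/-- The natural transformation on `P × Q` given by a natural transformation. -/
abbrev uncurriedMap {C : Type*} [Category* C] {X Y : P.Idx ⥤ Q.Idx ⥤ C} (a : X ⟶ Y) :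
    uncurried X ⟶ uncurried Y where
  app γ := (a.app γ.fst).app γ.snd
  naturality := ((uncurryCube C P Q).map a).naturality

lemma muMap_naturality {X Y : P.Idx ⥤ Q.Idx ⥤ FiltComplex A} (a : X ⟶ Y) :
    sMap r (innerMap a) ≫ muMap Y = muMap X ≫ sMap r (uncurriedMap a) := by
  refine hom_ext_proj fun n γ => ?_
  rw [comp_muMap_proj, comp_sMap_proj, muMap_proj, sMap_proj, Category.assoc (proj r _ n γ.fst),
    sMap_proj, iterProj]
  simp only [Category.assoc]
  rw [dc_comm]

/-- The natural transformation of simples in the second variable given by a morphism of cubes. -/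
abbrev innerRes {P' Q' : Cube} (u : P' ⟶ P) (w : Q' ⟶ Q) (X : P.Idx ⥤ Q.Idx ⥤ FiltComplex A) :
    u.functor ⋙ inner r X ⟶ inner r (restrict₂ u w X) where
  app α := sRes r w (X.obj (u.map α))
  naturality _ _ f :=
    simpleRestrict_naturality (rSimple A r) w (X.map (homOfLE (u.map_mono (leOfHom f))))

/-- Both sides project to the summand of the image of `γ`, with the same sign because the sign of `u
× w` is the product of the two signs. -/
lemma muMap_restrict_proj {P' Q' : Cube} (u : P' ⟶ P) (w : Q' ⟶ Q)
    (X : P.Idx ⥤ Q.Idx ⥤ FiltComplex A) (a : (prodMap u w).functor ⋙ uncurried X ⟶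
      uncurried (restrict₂ u w X)) (ha : ∀ γ, a.app γ = 𝟙 _) :
    (sRes r u (inner r X) ≫ sMap r (innerRes u w X)) ≫ muMap (restrict₂ u w X) =
      muMap X ≫ sRes r (prodMap u w) (uncurried X) ≫ sMap r a := by
  refine hom_ext_proj fun n γ => ?_
  have d1 := u.dim_map γ.fst
  have d2 := w.dim_map γ.snd
  have d3 := γ.dim_prod
  have d4 : (Hom.map (prodMap u w) γ).dim = γ.dim := (prodMap u w).dim_map γ
  rw [comp_muMap_proj, comp_sMap_proj, sRes_proj, ← Category.assoc (muMap X)]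
  refine Eq.trans ?_ (comp_sMap_proj _ _ _ _).symm
  rw [ha]
  refine Eq.trans ?_ (Category.comp_id _).symm
  refine Eq.trans ?_ (comp_sRes_proj (muMap X) (prodMap u w) n γ).symm
  rw [muMap_proj, Hom.sign_prodMap, mul_smul]
  refine (congrArg (· ≫ _) ((Category.assoc _ _ _).trans (congrArg (_ ≫ ·)
    (sRes_proj r w (X.obj (u.map γ.fst)) (n - γ.fst.dim) γ.snd)))).trans ?_
  refine Eq.trans (congrArg (· ≫ _) ((Preadditive.zsmul_comp _ _ _).trans (congrArg _
    (Preadditive.comp_zsmul _ _ _)))) ?_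
  refine (Preadditive.zsmul_comp _ _ _).trans (congrArg _ ((Preadditive.zsmul_comp _ _ _).trans
    (congrArg _ ?_)))
  have e1 := dc_proj r (X.obj (u.map γ.fst)) (n - (u.map γ.fst).dim) (n - γ.fst.dim) (w.map γ.snd)
  refine (congrArg (· ≫ _) ((Category.assoc _ _ _).trans (congrArg (_ ≫ ·)
    ((Category.assoc _ _ _).symm.trans (congrArg (· ≫ _) e1))))).trans ?_
  let Y := (X.obj (u.map γ.fst)).obj (w.map γ.snd)
  change (proj r (inner r X) n (u.map γ.fst) ≫ (proj r (X.obj (u.map γ.fst)) (n - (u.map γ.fst).dim)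
      (w.map γ.snd) ≫ dc Y _ (n - γ.fst.dim - (w.map γ.snd).dim)) ≫
        dc Y _ (n - γ.fst.dim - γ.snd.dim)) ≫ dc Y _ (n - γ.dim) =
    (iterProj r X n (u.map γ.fst) (w.map γ.snd) ≫
      dc Y _ (n - (Hom.map (prodMap u w) γ).dim)) ≫ dc Y _ _
  rw [iterProj]
  simp only [Category.assoc]
  rw [dc_trans_assoc Y (by omega), dc_trans Y (by omega), dc_trans Y (by omega)]

/-- The morphism of simples in the third variable. -/
abbrev innerInner (X : P.Idx ⥤ Q.Idx ⥤ R.Idx ⥤ FiltComplex A) : P.Idx ⥤ Q.Idx ⥤ FiltComplex A where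
  obj α := inner r (X.obj α)
  map h := innerMap (X.map h)
  map_id := (X ⋙ innerSimple (rSimple A r) Q R).map_id
  map_comp := (X ⋙ innerSimple (rSimple A r) Q R).map_comp

abbrev innerUncurried (X : P.Idx ⥤ Q.Idx ⥤ R.Idx ⥤ FiltComplex A) :
    P.Idx ⥤ (Q.prod R).Idx ⥤ FiltComplex A where
  obj α := uncurried (X.obj α)
  map h := uncurriedMap (X.map h)
  map_id := (X ⋙ uncurryCube (FiltComplex A) Q R).map_id
  map_comp := (X ⋙ uncurryCube (FiltComplex A) Q R).map_comp

abbrev innerMu (X : P.Idx ⥤ Q.Idx ⥤ R.Idx ⥤ FiltComplex A) :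
    inner r (innerInner (r := r) X) ⟶ inner r (innerUncurried X) where
  app α := muMap (X.obj α)
  naturality _ _ f := muMap_naturality (X.map f)

/-- In the summand of `γ` both sides are the threefold projection followed by identifications of
degrees between the same two degrees. The identification of cubes contributes the sign `+1`. -/
lemma muMap_assoc (X : P.Idx ⥤ Q.Idx ⥤ R.Idx ⥤ FiltComplex A)
    (a : uncurried (innerInner (r := r) X) ⟶ inner r (uncurried X)) (ha : ∀ γ, a.app γ = 𝟙 _)
    (b : (assoc P Q R).functor ⋙ uncurried (innerUncurried X) ⟶ uncurried (uncurried X))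
    (hb : ∀ γ, b.app γ = (uncurried (innerUncurried X)).map (homOfLE (assoc_map γ).le)) :
    muMap (innerInner (r := r) X) ≫ sMap r a ≫ muMap (uncurried X) =
      sMap r (innerMu X) ≫ muMap (innerUncurried X) ≫ sRes r (assoc P Q R) _ ≫ sMap r b := by
  refine hom_ext_proj fun n γ => ?_
  have d1 := γ.dim_prod
  have d2 := γ.fst.dim_prod
  have d3 : (γ.fst.fst.pair (γ.fst.snd.pair γ.snd)).dim =
      γ.fst.fst.dim + (γ.fst.snd.pair γ.snd).dim := Idx.dim_prod _
  have d4 : (γ.fst.snd.pair γ.snd).dim = γ.fst.snd.dim + γ.snd.dim := Idx.dim_prod _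
  rw [← Category.assoc, comp_muMap_proj, comp_sMap_proj, ha, muMap_proj,
    ← Category.assoc (sMap r (innerMu X))]
  refine Eq.trans ?_ (comp_sRes_sMap_proj _ _ b n (sign_assoc γ) (assoc_map γ)
    (𝟙 _) ((hb γ).trans (Category.comp_id _).symm)).symm
  refine Eq.trans ?_ (congrArg (fun φ => (φ ≫ _) ≫ _) (comp_muMap_proj _ _ _)).symm
  let Y := ((X.obj γ.fst.fst).obj γ.fst.snd).obj γ.snd
  let K := rSimpleComplex r ((X.obj γ.fst.fst).obj γ.fst.snd)
  change ((((proj r (inner r (innerInner (r := r) X)) n γ.fst.fst ≫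
      proj r (inner r (X.obj γ.fst.fst)) (n - γ.fst.fst.dim) γ.fst.snd) ≫ dc K _ (n - γ.fst.dim)) ≫
        𝟙 _) ≫ proj r ((X.obj γ.fst.fst).obj γ.fst.snd) (n - γ.fst.dim) γ.snd) ≫
          dc Y _ (n - γ.dim) =
    ((((((sMap r (innerMu X)).f n).f ≫ proj r (inner r (innerUncurried X)) n γ.fst.fst) ≫
      proj r (uncurried (X.obj γ.fst.fst)) (n - γ.fst.fst.dim) (γ.fst.snd.pair γ.snd)) ≫
        dc Y _ _) ≫ 𝟙 _) ≫ dc Y (n - (γ.fst.fst.pair (γ.fst.snd.pair γ.snd)).dim) _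
  have h1 := dc_proj r ((X.obj γ.fst.fst).obj γ.fst.snd) (n - γ.fst.fst.dim - γ.fst.snd.dim)
    (n - γ.fst.dim) γ.snd
  have h2 : ((muMap (r := r) (X.obj γ.fst.fst)).f (n - γ.fst.fst.dim)).f ≫
      proj r (uncurried (X.obj γ.fst.fst)) (n - γ.fst.fst.dim) (γ.fst.snd.pair γ.snd) =
      (proj r (inner r (X.obj γ.fst.fst)) (n - γ.fst.fst.dim) γ.fst.snd ≫
        proj r ((X.obj γ.fst.fst).obj γ.fst.snd) (n - γ.fst.fst.dim - γ.fst.snd.dim) γ.snd) ≫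
      dc Y _ (n - γ.fst.fst.dim - (γ.fst.snd.pair γ.snd).dim) := muMap_proj _ _ _
  have h3 := sMap_proj r (innerMu (r := r) X) n γ.fst.fst
  rw [Category.comp_id, Category.comp_id, h3, Category.assoc (_ ≫ _) (dc K _ _), h1,
    Category.assoc (proj r (inner r (innerInner X)) n γ.fst.fst) _
      (proj r (uncurried (X.obj γ.fst.fst)) (n - γ.fst.fst.dim) (γ.fst.snd.pair γ.snd)), h2]
  simp only [Category.assoc]
  rw [dc_trans Y (by omega)]
  change _ = ((proj r (inner r (innerInner (r := r) X)) n γ.fst.fst ≫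
    proj r (inner r (X.obj γ.fst.fst)) (n - γ.fst.fst.dim) γ.fst.snd ≫
      proj r ((X.obj γ.fst.fst).obj γ.fst.snd) (n - γ.fst.fst.dim - γ.fst.snd.dim) γ.snd ≫
        dc Y _ _) ≫ dc Y (n - γ.fst.fst.dim - (γ.fst.snd.pair γ.snd).dim)
          (n - (γ.fst.fst.pair (γ.fst.snd.pair γ.snd)).dim)) ≫ dc Y _ _
  simp only [Category.assoc]
  rw [dc_trans Y (by omega), dc_trans Y (by omega)]

/-- The face of the empty product. -/
def unitFace : unit.Idx := fun i => isEmptyElim i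

lemma leftUnit_map_eq (α : P.Idx) : Hom.map (leftUnit P) α = unitFace.pair α :=
  Idx.prod_ext (Idx.ext fun i => isEmptyElim i) (leftUnit_map α)

lemma rightUnit_map_eq (α : P.Idx) : Hom.map (rightUnit P) α = α.pair unitFace :=
  Idx.prod_ext (rightUnit_map α) (Idx.ext fun i => isEmptyElim i)

lemma unitFace_dim : unitFace.dim = 0 := rfl

lemma lamMap_muMap (Y : Q.Idx ⥤ FiltComplex A)
    (c : constDiag unit (rSimpleComplex r Y) ⟶ inner r (constDiag unit Y)) (hc : ∀ α, c.app α = 𝟙 _)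
    (a : (leftUnit Q).functor ⋙ uncurried (constDiag unit Y) ⟶ Y)
    (ha : ∀ α, a.app α = Y.map (homOfLE (leftUnit_map α).le)) :
    lamMap r unit (rSimpleComplex r Y) ≫ sMap r c ≫ muMap (constDiag unit Y) ≫
      sRes r (leftUnit Q) _ ≫ sMap r a = 𝟙 _ := by
  refine hom_ext_proj fun n β => ?_
  have d1 : ((unitFace.pair β).dim : ℤ) = β.dim := by
    have := (unitFace.pair β).dim_prod
    rw [Idx.pair_fst, Idx.pair_snd, unitFace_dim] at this
    omega
  have d2 : (unitFace.dim : ℤ) = 0 := rfl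
  rw [← Category.assoc, ← Category.assoc]
  refine (comp_sRes_sMap_proj _ _ a n (sign_leftUnit β) (leftUnit_map_eq β) (𝟙 _) ?_).trans ?_
  · rw [ha]
    exact ((Category.comp_id _).trans (Category.id_comp _)).symm
  rw [comp_muMap_proj, comp_sMap_proj, hc, lamMap_proj]
  change ((((dc (rSimpleComplex r Y) n (n - unitFace.dim) ≫ 𝟙 _) ≫ proj r Y (n - unitFace.dim) β) ≫
    dc (Y.obj β) _ (n - (unitFace.pair β).dim)) ≫ 𝟙 _) ≫ dc (Y.obj β) _ _ = 𝟙 _ ≫ _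
  rw [Category.comp_id, Category.comp_id, Category.id_comp, dc_proj, Category.assoc, Category.assoc,
    dc_trans (Y.obj β) (by omega), dc_trans (Y.obj β) (by omega), dc_self, Category.comp_id]

/-- The functor `α ↦ const (Y α)`. -/
abbrev constRight (Y : P.Idx ⥤ FiltComplex A) : P.Idx ⥤ Q.Idx ⥤ FiltComplex A where
  obj α := constDiag Q (Y.obj α)
  map h := { app := fun _ => Y.map h
             naturality := fun _ _ _ => (Category.id_comp _).trans (Category.comp_id _).symm }
  map_id := (Y ⋙ Functor.const Q.Idx).map_id
  map_comp := (Y ⋙ Functor.const Q.Idx).map_comp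

lemma muMap_lamMap (Y : P.Idx ⥤ FiltComplex A)
    (c : Y ⟶ inner r (constRight (Q := unit) Y)) (hc : ∀ α, c.app α = lamMap r unit (Y.obj α))
    (a : (rightUnit P).functor ⋙ uncurried (constRight Y) ⟶ Y)
    (ha : ∀ α, a.app α = Y.map (homOfLE (rightUnit_map α).le)) :
    sMap r c ≫ muMap (constRight Y) ≫ sRes r (rightUnit P) _ ≫ sMap r a = 𝟙 _ := by
  refine hom_ext_proj fun n β => ?_
  have d1 : ((β.pair unitFace).dim : ℤ) = β.dim := by
    have := (β.pair unitFace).dim_prod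
    rw [Idx.pair_fst, Idx.pair_snd, unitFace_dim] at this
    omega
  have d2 : (unitFace.dim : ℤ) = 0 := rfl
  rw [← Category.assoc]
  refine (comp_sRes_sMap_proj _ _ a n (sign_rightUnit β) (rightUnit_map_eq β) (𝟙 _) ?_).trans ?_
  · rw [ha]
    exact ((Category.comp_id _).trans (Category.comp_id _)).symm
  rw [comp_muMap_proj, sMap_proj]
  change ((((proj r Y n β ≫ ((c.app β).f (n - β.dim)).f) ≫
    proj r (constDiag unit (Y.obj β)) (n - β.dim) unitFace) ≫
    dc (Y.obj β) _ (n - (β.pair unitFace).dim)) ≫ 𝟙 _) ≫ dc (Y.obj β) _ _ = 𝟙 _ ≫ _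
  rw [hc, Category.comp_id, Category.id_comp, Category.assoc (proj r Y n β), lamMap_proj,
    Category.assoc, Category.assoc,
    dc_trans (Y.obj β) (by omega), dc_trans (Y.obj β) (by omega), dc_self, Category.comp_id]

lemma lamMap_prod (X : FiltComplex A) (c : constDiag P X ⟶ inner r (constDiag P (constDiag Q X)))
    (hc : ∀ α, c.app α = lamMap r Q X)
    (a : uncurried (constDiag P (constDiag Q X)) ⟶ constDiag (P.prod Q) X)
    (ha : ∀ γ, a.app γ = 𝟙 X) :
    lamMap r P X ≫ sMap r c ≫ muMap (constDiag P (constDiag Q X)) ≫ sMap r a =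
      lamMap r (P.prod Q) X := by
  refine hom_ext_proj fun n γ => ?_
  have d1 := γ.dim_prod
  rw [← Category.assoc, ← Category.assoc, comp_sMap_proj, comp_muMap_proj, comp_sMap_proj, ha, hc,
    lamMap_proj, lamMap_proj]
  change (((dc X _ _ ≫ ((lamMap r Q X).f (n - γ.fst.dim)).f) ≫
    proj r (constDiag Q X) (n - γ.fst.dim) γ.snd) ≫ dc X _ (n - γ.dim)) ≫ 𝟙 _ = _
  rw [Category.comp_id, Category.assoc (dc X _ _), lamMap_proj, Category.assoc,
    dc_trans' X (by omega)]
  -- If the first coordinate is not a vertex, neither is `γ`, and the identifications of degrees on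
  -- both sides are zero.
  by_cases h : γ.fst.dim = 0
  · exact dc_trans X (by omega) _
  · rw [dc_eq_zero X (by omega), zero_comp, dc_eq_zero X (by omega)]

end Axioms

/-! ### The morphisms `lam` are `E_r`-quasi-isomorphisms -/

namespace Cube

variable {P : Cube}

/-- The cube obtained by omitting the `i`-th factor. -/
def erase (P : Cube) (i : P.ι) : Cube where
  ι := {k : P.ι // k ≠ i}
  fintype := by classical exact inferInstance
  S k := P.S k

/-- The index set of a cube is obtained by adding its least element to the others. -/
def eraseOrderIso (P : Cube) (i : P.ι) (hi : ∀ k, i ≤ k) :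
    ((single (P.S i)).prod (P.erase i)).ι ≃o P.ι :=
  StrictMono.orderIsoOfSurjective
    (fun x : Unit ⊕ₗ {k : P.ι // k ≠ i} => Sum.elim (fun _ => i) Subtype.val (ofLex x))
    (by
      rintro (x | x) (y | y) h
      · exact absurd (Sum.Lex.inl_lt_inl_iff.1 h) (lt_irrefl _)
      · exact lt_of_le_of_ne (hi _) y.2.symm
      · exact absurd h Sum.Lex.not_inr_lt_inl
      · exact show x < y from Sum.Lex.inr_lt_inr_iff.1 h)
    (fun k => by
      by_cases h : k = i
      · exact ⟨toLex (Sum.inl ()), h.symm⟩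
      · exact ⟨toLex (Sum.inr ⟨k, h⟩), rfl⟩)

/-- The identification of a cube with the product of its first factor and the others. -/
def splitFirst (P : Cube) (i : P.ι) (hi : ∀ k, i ≤ k) :
    P ⟶ (single (P.S i)).prod (P.erase i) where
  σ := eraseOrderIso P i hi
  u x := Sum.rec (motive := fun x => (P.S (eraseOrderIso P i hi (toLex x))).carrier ↪
      (((single (P.S i)).prod (P.erase i)).S (toLex x)).carrier)
    (fun _ => Function.Embedding.refl _) (fun _ => Function.Embedding.refl _) (ofLex x)

lemma sign_splitFirst (i : P.ι) (hi : ∀ k, i ≤ k) (α : P.Idx) :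
    Hom.sign (splitFirst P i hi) α = 1 := by
  refine Hom.sign_of_monotone _ (fun j => ?_) α
  rcases j with j | j
  · exact monotone_id
  · exact monotone_id

lemma Hom.map_surjective {Q : Cube} (f : P ⟶ Q) (h : ∀ j, Function.Surjective (f.u j)) :
    Function.Surjective f.map := by
  intro α
  -- Every face lies below the image of the top face, and the image of a morphism of cubes is closed
  -- downwards.
  obtain ⟨β, -, hβ⟩ := f.exists_of_le_map (α := α)
    (γ := fun i => ⟨Finset.univ, Finset.univ_nonempty⟩) (fun j s _ => by
      obtain ⟨t, rfl⟩ := h j s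
      exact Finset.mem_map_of_mem _ (Finset.mem_univ t))
  exact ⟨β, hβ⟩

lemma splitFirst_map_surjective (i : P.ι) (hi : ∀ k, i ≤ k) :
    Function.Surjective (Hom.map (splitFirst P i hi)) := by
  refine Hom.map_surjective _ fun j => ?_
  rcases j with j | j
  · exact Function.surjective_id
  · exact Function.surjective_id

lemma card_erase (i : P.ι) : Fintype.card (P.erase i).ι < Fintype.card P.ι :=
  Fintype.card_lt_of_injective_of_notMem (b := i) (fun k : {k : P.ι // k ≠ i} => k.1)
    Subtype.val_injective (by rintro ⟨k, hk⟩; exact k.2 hk)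

end Cube

section LamMem

attribute [local instance] Abelian.hasFiniteBiproducts

variable {A : Type u} [Category.{v} A] [Abelian A] {r : ℕ}

lemma ConeAcyclic.comp {K L M : FiltComplex A} {f : K ⟶ L} {g : L ⟶ M} (hf : ConeAcyclic r f)
    (hg : ConeAcyclic r g) : ConeAcyclic r (f ≫ g) := by
  rw [← pageQuasiIso_iff] at *
  intro p
  rw [Functor.map_comp]
  have := hf p
  have := hg p
  infer_instance

lemma coneAcyclic_id (K : FiltComplex A) : ConeAcyclic r (𝟙 K) := by
  rw [← pageQuasiIso_iff]
  intro p
  rw [CategoryTheory.Functor.map_id]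
  infer_instance

/-- Such a `u` is a bijection on faces that preserves dimensions and introduces no signs;
restriction merely relabels the summands. -/
lemma coneAcyclic_sRes_constDiag {P P' : Cube} (u : P' ⟶ P) (hu : Function.Surjective u.map)
    (hs : ∀ β, u.sign β = 1) (X : FiltComplex A) :
    ConeAcyclic r (sRes r u (constDiag P X)) := by
  have hproj : ∀ (n : ℤ) (β : P'.Idx) ⦃T : A⦄
      (x : T ⟶ ((rSimpleComplex r (constDiag P X)).X n).X),
      (x ≫ ((sRes r u (constDiag P X)).f n).f) ≫ proj r (u.functor ⋙ constDiag P X) n β =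
        (x ≫ proj r (constDiag P X) n (u.map β)) ≫ dc X (n - (u.map β).dim) (n - β.dim) := by
    intro n β T x
    rw [Category.assoc, sRes_proj, hs, one_smul, Category.assoc]
  choose e he using hu
  refine coneAcyclic_of_bijective _ (fun n T y => ?_) fun n T x hx => ?_
  · refine ⟨ofProj r (constDiag P X) n fun α => (y ≫ proj r (u.functor ⋙ constDiag P X) n (e α)) ≫
      dc X (n - (e α).dim) (n - α.dim), proj_ext fun β => ?_, fun p hp => ?_⟩
    · have key : ∀ β', β' = β → ((y ≫ proj r (u.functor ⋙ constDiag P X) n β') ≫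
          dc X (n - β'.dim) (n - (u.map β).dim)) ≫ dc X _ (n - β.dim) =
          y ≫ proj r (u.functor ⋙ constDiag P X) n β := by
        intro β' h
        subst h
        have hd := u.dim_map β'
        rw [Category.assoc, dc_trans X (by omega)]
        exact (congrArg (_ ≫ ·) (dc_self X _)).trans (Category.comp_id _)
      rw [hproj, ofProj_proj]
      exact key _ (u.map_injective (he _))
    · refine mem_rSimple_iff.2 fun α => ?_
      rw [ofProj_proj]
      have hd := u.dim_map (e α)
      rw [he] at hd
      refine ((mem_rSimple_iff.1 hp (e α)).dc _).le (le_of_eq ?_)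
      rw [hd]
  · refine proj_ext fun α => ?_
    obtain ⟨β, rfl⟩ : ∃ β, u.map β = α := ⟨e α, he α⟩
    have h := (hproj n β x).symm.trans ((congrArg (· ≫ _) hx).trans zero_comp)
    have h2 := h =≫ dc X (n - β.dim) (n - (u.map β).dim)
    have hd := u.dim_map β
    rw [Category.assoc, dc_trans X (by omega), dc_self, zero_comp] at h2
    rw [zero_comp]
    exact (Category.comp_id _).symm.trans h2

/-- The only face has dimension zero, so the simple is `X` with its own filtration. The base of the
induction on the number of factors. -/
lemma coneAcyclic_lamMap_unit {P : Cube} [IsEmpty P.ι] (X : FiltComplex A) :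
    ConeAcyclic r (lamMap r P X) := by
  have hd : ∀ α : P.Idx, α.dim = 0 := fun α => Finset.sum_eq_zero fun i _ => isEmptyElim i
  let o : P.Idx := fun i => isEmptyElim i
  have ho : ∀ α : P.Idx, α = o := fun α => Idx.ext fun i => isEmptyElim i
  have := hd o
  refine coneAcyclic_of_bijective _ (fun n T y => ?_) fun n T x hx => ?_
  · refine ⟨(y ≫ proj r (constDiag P X) n o) ≫ dc X (n - o.dim) n, proj_ext fun α => ?_,
      fun p hp => ?_⟩
    · obtain rfl := ho α
      rw [Category.assoc, lamMap_proj, Category.assoc, dc_trans X (by omega), dc_self]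
      exact Category.comp_id _
    · refine ((mem_rSimple_iff.1 hp o).dc _).le (le_of_eq ?_)
      rw [hd o]; simp
  · have h := (hx =≫ proj r (constDiag P X) n o) =≫ dc X (n - o.dim) n
    rwa [Category.assoc x, lamMap_proj, Category.assoc, dc_trans X (by omega), dc_self,
      Category.comp_id, zero_comp, zero_comp] at h

/-- By `lamMap_prod` the morphism is a composite of `λ_P`, the simple of `λ_Q`, `μ` and a simple of
identities. Exactness handles the second and the last. -/
lemma coneAcyclic_lamMap_prod {P Q : Cube} (X : FiltComplex A) (hP : ConeAcyclic r (lamMap r P X))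
    (hQ : ConeAcyclic r (lamMap r Q X)) : ConeAcyclic r (lamMap r (P.prod Q) X) := by
  let c : constDiag P X ⟶ inner r (constDiag P (constDiag Q X)) :=
    (Functor.const P.Idx).map (lamMap r Q X) ≫
      (Functor.constComp _ ((Functor.const Q.Idx).obj X) (simpleAt (rSimple A r) Q)).inv
  have hc : ∀ α, c.app α = lamMap r Q X := fun α => Category.comp_id _
  let a : uncurried (constDiag P (constDiag Q X)) ⟶ constDiag (P.prod Q) X := uncurryConst P Q X
  have ha : ∀ γ, a.app γ = 𝟙 X := fun _ => rfl
  rw [← lamMap_prod X c hc a ha]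
  refine hP.comp (ConeAcyclic.comp (coneAcyclic_sMap _ fun α => ?_)
    ((coneAcyclic_muMap _).comp (coneAcyclic_sMap _ fun γ => ?_)))
  · rw [hc]; exact hQ
  · rw [ha]; exact coneAcyclic_id _

theorem coneAcyclic_lamMap (P : Cube) (X : FiltComplex A) : ConeAcyclic r (lamMap r P X) := by
  induction hn : Fintype.card P.ι using Nat.strong_induction_on generalizing P with
  | _ n ih =>
    subst hn
    rcases isEmpty_or_nonempty P.ι with h | h
    · exact coneAcyclic_lamMap_unit X
    · obtain ⟨i, hi⟩ : ∃ i : P.ι, ∀ k, i ≤ k :=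
        ⟨Finset.univ.min' Finset.univ_nonempty, fun k => Finset.min'_le _ _ (Finset.mem_univ k)⟩
      -- Naturality in the cube writes `λ_P` as `λ` of the split product followed by a relabelling
      -- of summands. The second factor has fewer indices.
      rw [← lamMap_restrict (splitFirst P i hi) X]
      exact (coneAcyclic_lamMap_prod X (coneAcyclic_lamMap_single _ X)
        (ih _ (card_erase i) _ rfl)).comp (coneAcyclic_sRes_constDiag _
          (splitFirst_map_surjective i hi) (sign_splitFirst i hi) X)

end LamMem

/-! ### The acyclicity criterion -/

namespace Cube

variable {S : CubeSet}

/-- The added point of `S ⊔ {*}`. -/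
def starBot (S : CubeSet) : S.star.carrier := (⊥ : WithBot S.carrier)

/-- The inclusion of `S` in `S ⊔ {*}`. -/
def starMk (S : CubeSet) : S.carrier ↪ S.star.carrier := ⟨WithBot.some, WithBot.coe_injective⟩

lemma starBot_lt (s : S.carrier) : starBot S < starMk S s := WithBot.bot_lt_coe s

lemma starMk_lt_iff {s t : S.carrier} : starMk S s < starMk S t ↔ s < t := WithBot.coe_lt_coe

lemma star_cases (x : S.star.carrier) : x = starBot S ∨ ∃ s, x = starMk S s := by
  rcases x with _ | s
  · exact Or.inl rfl
  · exact Or.inr ⟨s, rfl⟩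

lemma verts_starFace (a : Finset S.carrier) :
    verts (starFace S a) = insert (starBot S) (a.map (starMk S)) := by
  ext x
  exact Finset.mem_insert.trans Finset.mem_insert.symm

lemma starBot_notMem_map (a : Finset S.carrier) : starBot S ∉ a.map (starMk S) := by
  intro h
  obtain ⟨s, -, hs⟩ := Finset.mem_map.1 h
  exact (starBot_lt s).ne' hs

lemma mem_verts_starFace {a : Finset S.carrier} {s : S.carrier} :
    starMk S s ∈ verts (starFace S a) ↔ s ∈ a := by
  rw [verts_starFace, Finset.mem_insert, Finset.mem_map']
  exact or_iff_right (starBot_lt s).ne'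

lemma starFace_le_iff {a b : Finset S.carrier} : starFace S a ≤ starFace S b ↔ a ⊆ b :=
  ⟨fun h _ hs => mem_verts_starFace.1 (single_le_iff.1 h (mem_verts_starFace.2 hs)),
    fun h => starFace_mono S h⟩

lemma starFace_injective : Function.Injective (starFace S) := fun _ _ h =>
  le_antisymm (starFace_le_iff.1 h.le) (starFace_le_iff.1 h.ge)

lemma starFace_dim (a : Finset S.carrier) : (starFace S a).dim = a.card := by
  rw [dim_eq_card_verts, verts_starFace, Finset.card_insert_of_notMem (starBot_notMem_map a),
    Finset.card_map, Nat.add_sub_cancel]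

lemma starFace_empty_dim : (starFace S ∅).dim = 0 := starFace_dim _

lemma starFace_verts_dim (β : (single S).Idx) : (starFace S (verts β)).dim = β.dim + 1 := by
  have := (verts_nonempty β).card_pos
  rw [starFace_dim, dim_eq_card_verts]
  omega

lemma starFace_insert (a : Finset S.carrier) (s : S.carrier) :
    starFace S (insert s a) = adjoin (starFace S a) (starMk S s) := by
  refine single_ext ?_
  rw [verts_adjoin, verts_starFace, verts_starFace, Finset.map_insert]
  exact Finset.insert_comm _ _ _

/-- The point `*` is the least vertex, so it adds one predecessor to every vertex of `S`; hence the
extra sign compared with `S`. -/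
lemma incidence_starFace_insert {a : Finset S.carrier} {s : S.carrier} (h : s ∉ a) :
    (starFace S a).incidence (starFace S (insert s a)) = -(-1) ^ (a.filter (· < s)).card := by
  have h1 : (verts (starFace S a)).filter (· < starMk S s) =
      insert (starBot S) ((a.filter (· < s)).map (starMk S)) := by
    rw [verts_starFace, Finset.filter_insert, if_pos (starBot_lt s), Finset.filter_map]
    congr 2
    ext t
    simp only [Finset.mem_filter, Function.comp_apply, starMk_lt_iff]
  rw [starFace_insert, incidence_adjoin (fun h' => h (mem_verts_starFace.1 h')), h1,
    Finset.card_insert_of_notMem (starBot_notMem_map _), Finset.card_map, pow_succ, mul_neg_one]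

lemma incidence_starFace {α β : (single S).Idx} (h : α ≤ β) (hd : β.dim = α.dim + 1) :
    (starFace S (verts α)).incidence (starFace S (verts β)) = -α.incidence β := by
  obtain ⟨s, hs, rfl⟩ := exists_eq_adjoin h hd
  rw [verts_adjoin, incidence_starFace_insert hs, incidence_adjoin hs]

lemma incidence_starFace_empty {β : (single S).Idx} (hβ : β.dim = 0) :
    (starFace S ∅).incidence (starFace S (verts β)) = -1 := by
  obtain ⟨s, hs⟩ : ∃ s : S.carrier, verts β = insert s ∅ :=
    Finset.card_eq_one.1 (Idx.card_set_of_dim_eq_zero hβ ())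
  rw [hs, incidence_starFace_insert (Finset.notMem_empty s)]
  simp

lemma exists_starFace (α : (single S.star).Idx) (h : starBot S ∈ verts α) :
    ∃ a, α = starFace S a := by
  classical
  refine ⟨Finset.univ.filter fun s => starMk S s ∈ verts α, single_ext ?_⟩
  ext x
  rcases star_cases x with rfl | ⟨s, rfl⟩
  · rw [verts_starFace]
    exact iff_of_true h (Finset.mem_insert_self _ _)
  · rw [mem_verts_starFace]; simp

/-- The faces containing `*` are `{*}` and the `β ∪ {*}` with `β` nonempty: the two parts of the
cone. -/
lemma sum_star {M : Type*} [AddCommMonoid M] (F : (single S.star).Idx → M)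
    (h : ∀ α, starBot S ∉ verts α → F α = 0) :
    ∑ α, F α = F (starFace S ∅) + ∑ β : (single S).Idx, F (starFace S (verts β)) := by
  classical
  rw [← Finset.add_sum_erase _ _ (Finset.mem_univ (starFace S ∅))]
  congr 1
  symm
  refine Finset.sum_of_injOn (fun β => starFace S (verts β)) ?_ ?_ ?_ fun _ _ => rfl
  · intro α _ β _ e
    exact single_ext (starFace_injective e)
  · intro β _
    refine Finset.mem_coe.2 (Finset.mem_erase.2 ⟨fun e => ?_, Finset.mem_univ _⟩)
    exact (verts_nonempty β).ne_empty (starFace_injective e)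
  · intro α hα hα'
    refine h α fun hb => ?_
    obtain ⟨a, rfl⟩ := exists_starFace α hb
    rcases Finset.eq_empty_or_nonempty a with rfl | ha
    · exact (Finset.mem_erase.1 hα).1 rfl
    · exact hα' ⟨faceOf a ha, Finset.mem_univ _, rfl⟩

end Cube

/-! ### The simple of `Z` as the cone of the augmentation -/

section Acyclic

attribute [local instance] Abelian.hasFiniteBiproducts

variable {A : Type u} [Category.{v} A] [Abelian A] {r : ℕ} {S : CubeSet}

/-- The diagram `β ↦ Z (β ∪ {*})` of shape `S`. -/
abbrev starDiag (Z : (single S.star).Idx ⥤ FiltComplex A) : (single S).Idx ⥤ FiltComplex A where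
  obj β := Z.obj (starFace S (verts β))
  map h := Z.map (homOfLE (starFace_mono S (leOfHom h ())))
  map_id := (starFunctor S ⋙ Z).map_id
  map_comp := (starFunctor S ⋙ Z).map_comp

/-- Adding `*` lowers the internal degree by one and reverses the incidence sign. This gives the
`-d` by which a cone differential acts on its second part. -/
lemma cubeTerm_starFace (Z : (single S.star).Idx ⥤ FiltComplex A) {l n m : ℤ} (hln : l + 1 = n)
    (hnm : n + 1 = m) (α β : (single S).Idx) :
    cubeTerm Z n m (starFace S (verts α)) (starFace S (verts β)) ≫
        dc (Z.obj (starFace S (verts β))) (m - (starFace S (verts β)).dim) (n - β.dim) =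
      -(dc (Z.obj (starFace S (verts α))) (n - (starFace S (verts α)).dim) (l - α.dim) ≫
        cubeTerm (starDiag Z) l n α β) := by
  have e1 := starFace_verts_dim α
  have e2 := starFace_verts_dim β
  by_cases hle : α ≤ β
  swap
  · rw [cubeTerm_of_not_le _ _ _ hle, cubeTerm_of_not_le _ _ _ fun h => hle
      (single_le_iff.2 (starFace_le_iff.1 h)), zero_comp, comp_zero, neg_zero]
  by_cases hd : β.dim = α.dim + 1
  swap
  · rw [cubeTerm_of_dim_ne _ hln hd, cubeTerm_of_dim_ne _ hnm (by omega), zero_comp, comp_zero,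
      neg_zero]
  rw [cubeTerm_of_le _ _ _ hle, cubeTerm_of_le _ _ _ (starFace_mono S (single_le_iff.1 hle)),
    incidence_starFace hle hd, Preadditive.zsmul_comp, Preadditive.comp_zsmul, neg_smul,
    Category.assoc, dc_trans' _ (by omega)]
  congr 2
  rw [← dc_comm_assoc, dc_trans _ (by omega)]

variable (r) in
/-- The projection of the simple complex onto the summand of `{*}`. -/
def starPr (Z : (single S.star).Idx ⥤ FiltComplex A) (n : ℤ) :
    ((rSimpleComplex r Z).X n).X ⟶ ((Z.obj (starFace S ∅)).X n).X :=
  proj r Z n (starFace S ∅) ≫ dc (Z.obj (starFace S ∅)) _ n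

variable (r) in
/-- The projection of the simple complex onto the summands of the `β ∪ {*}`, with the opposite
sign. -/
def starQr (Z : (single S.star).Idx ⥤ FiltComplex A) (n m : ℤ) :
    ((rSimpleComplex r Z).X n).X ⟶ ((rSimpleComplex r (starDiag Z)).X m).X :=
  ofProj r (starDiag Z) m fun β => -(proj r Z n (starFace S (verts β)) ≫
    dc (Z.obj (starFace S (verts β))) _ (m - β.dim))

lemma starQr_proj (Z : (single S.star).Idx ⥤ FiltComplex A) (n m : ℤ) (β : (single S).Idx) :
    starQr r Z n m ≫ proj r (starDiag Z) m β = -(proj r Z n (starFace S (verts β)) ≫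
      dc (Z.obj (starFace S (verts β))) _ (m - β.dim)) :=
  ofProj_proj _ _ _ _ _

lemma exists_starPr_starQr (Z : (single S.star).Idx ⥤ FiltComplex A) {n m : ℤ} (hmn : m + 1 = n)
    {T : A} (x : T ⟶ ((Z.obj (starFace S ∅)).X n).X)
    (y : T ⟶ ((rSimpleComplex r (starDiag Z)).X m).X) :
    ∃ z : T ⟶ ((rSimpleComplex r Z).X n).X, z ≫ starPr r Z n = x ∧ z ≫ starQr r Z n m = y := by
  have e0 := starFace_empty_dim (S := S)
  have hne : ∀ β : (single S).Idx, starFace S (verts β) ≠ starFace S ∅ := fun β e =>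
    (verts_nonempty β).ne_empty (starFace_injective e)
  -- The components of `y` are inserted with a minus sign because `starQr` is minus the projection.
  refine ⟨(x ≫ dc _ _ _) ≫ incl r Z n (starFace S ∅) - ∑ β, ((y ≫ proj r (starDiag Z) m β) ≫
    dc (Z.obj (starFace S (verts β))) _ _) ≫ incl r Z n (starFace S (verts β)), ?_,
    proj_ext fun β => ?_⟩
  · rw [starPr, Preadditive.sub_comp, Preadditive.sum_comp, Finset.sum_eq_zero, sub_zero,
      Category.assoc, ← Category.assoc (incl r Z n _), incl_proj_self, Category.id_comp,
      Category.assoc, dc_trans _ (by omega), dc_self, Category.comp_id]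
    intro β _
    rw [Category.assoc, ← Category.assoc (incl r Z n _), incl_proj_ne r Z n (hne β), zero_comp,
      comp_zero]
  · have e1 := starFace_verts_dim β
    rw [Category.assoc, starQr_proj, Preadditive.comp_neg, ← Category.assoc, Preadditive.sub_comp,
      Category.assoc, incl_proj_ne r Z n (hne β).symm, comp_zero, zero_sub, Preadditive.neg_comp,
      neg_neg, Preadditive.sum_comp, Finset.sum_eq_single β,
      Category.assoc _ (incl r Z n _), incl_proj_self,
      Category.comp_id, Category.assoc, dc_trans _ (by omega), dc_self]
    · exact Category.comp_id _
    · intro β' _ hβ'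
      rw [Category.assoc, incl_proj_ne r Z n, comp_zero]
      exact fun e => hβ' (single_ext (starFace_injective e))
    · exact fun h => absurd (Finset.mem_univ _) h

/-- Faces without `*` carry zero objects and impose no condition. The face `β ∪ {*}` has dimension
`|β| + 1`, so its step in the simple of `Z` is the step `p + r` in the simple over `S`. -/
lemma mem_starPr_starQr_iff {Z : (single S.star).Idx ⥤ FiltComplex A}
    (hZ : ∀ α, starBot S ∉ verts α → IsZero (Z.obj α)) {n m p : ℤ} (hmn : m + 1 = n) {T : A}
    (z : T ⟶ ((rSimpleComplex r Z).X n).X) : ((rSimpleComplex r Z).X n).Mem p z ↔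
      ((Z.obj (starFace S ∅)).X n).Mem p (z ≫ starPr r Z n) ∧
        ((rSimpleComplex r (starDiag Z)).X m).Mem (p + r) (z ≫ starQr r Z n m) := by
  have e0 := starFace_empty_dim (S := S)
  constructor
  · intro h
    rw [mem_rSimple_iff] at h
    constructor
    · rw [starPr, ← Category.assoc]
      refine ((h (starFace S ∅)).dc n).le (le_of_eq ?_)
      rw [e0]; simp
    · refine mem_rSimple_iff.2 fun β => ?_
      rw [Category.assoc, starQr_proj, Preadditive.comp_neg, ← Category.assoc]
      refine (((h (starFace S (verts β))).dc _).le (le_of_eq ?_)).neg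
      rw [starFace_verts_dim]; push_cast; ring
  · rintro ⟨h1, h2⟩
    refine mem_rSimple_iff.2 fun α => ?_
    by_cases hα : starBot S ∈ verts α
    · obtain ⟨a, rfl⟩ := exists_starFace α hα
      rcases Finset.eq_empty_or_nonempty a with rfl | ha
      · have h3 := (h1.dc (n - (starFace S ∅).dim)).le (q := p + r * (starFace S ∅).dim)
          (by rw [e0]; simp)
        rwa [starPr, Category.assoc, Category.assoc, dc_trans _ (by omega), dc_self,
          Category.comp_id] at h3
      · have e1 := starFace_verts_dim (faceOf a ha)
        have h3 := mem_rSimple_iff.1 h2 (faceOf a ha)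
        rw [Category.assoc, starQr_proj, Preadditive.comp_neg, ← Category.assoc] at h3
        have h4 := ((h3.neg).dc (n - (starFace S a).dim)).le
          (q := p + r * (starFace S a).dim) (le_of_eq (by
            rw [verts_faceOf] at e1
            rw [e1]; push_cast; ring))
        rw [neg_neg, Category.assoc, Category.assoc] at h4
        rw [verts_faceOf] at e1
        have h5 : dc (Z.obj (starFace S a)) (n - (starFace S a).dim) (m - (faceOf a ha).dim) ≫
            dc (Z.obj (starFace S a)) _ (n - (starFace S a).dim) = 𝟙 _ :=
          (dc_trans _ (by omega) _).trans (dc_self _ _)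
        have h6 : (z ≫ proj r Z n (starFace S a)) ≫
            dc (Z.obj (starFace S a)) (n - (starFace S a).dim) (m - (faceOf a ha).dim) ≫
            dc (Z.obj (starFace S a)) _ (n - (starFace S a).dim) = z ≫ proj r Z n (starFace S a) := by
          rw [h5, Category.comp_id]
        rw [← h6, Category.assoc]
        exact h4
    · rw [FiltComplex.eq_zero_of_isZero (hZ α hα) (z ≫ proj r Z n α)]
      exact FiltObj.Mem.zero

lemma d_starPr (Z : (single S.star).Idx ⥤ FiltComplex A) {n m : ℤ} (hnm : n + 1 = m) :
    ((rSimpleComplex r Z).d n m).f ≫ starPr r Z m =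
      starPr r Z n ≫ ((Z.obj (starFace S ∅)).d n m).f := by
  have e0 := starFace_empty_dim (S := S)
  have hs : (-1 : ℤ) ^ (starFace S ∅).dim = 1 := by rw [e0, pow_zero]
  rw [starPr, starPr, ← Category.assoc, d_proj Z hnm, Finset.sum_eq_zero, add_zero, hs, one_smul,
    Category.assoc, Category.assoc]
  · exact congrArg (_ ≫ ·) (dc_d _ (by omega)).symm
  · intro α _
    rw [cubeTerm_of_dim_ne _ hnm (by omega), comp_zero]

/-- All signs on the summands of `β ∪ {*}` are opposite to those of `β`, which gives the term with
`-d`. The maps from `{*}` to the faces `{s, *}` have incidence `-1`, and the sign in `starQr` turns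
them into `+f`. -/
lemma d_starQr {Z : (single S.star).Idx ⥤ FiltComplex A}
    (hZ : ∀ α, starBot S ∉ verts α → IsZero (Z.obj α))
    (f : Z.obj (starFace S ∅) ⟶ rSimpleComplex r (starDiag Z))
    (hf : ∀ n β, (f.f n).f ≫ proj r (starDiag Z) n β = dc (Z.obj (starFace S ∅)) n (n - β.dim) ≫
      ((Z.map (homOfLE (starFace_mono S (Finset.empty_subset (verts β))))).f (n - β.dim)).f)
    {l n m : ℤ} (hln : l + 1 = n) (hnm : n + 1 = m) :
    ((rSimpleComplex r Z).d n m).f ≫ starQr r Z m n = starPr r Z n ≫ (f.f n).f -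
      starQr r Z n l ≫ ((rSimpleComplex r (starDiag Z)).d l n).f := by
  refine proj_ext fun β => ?_
  have e0 := starFace_empty_dim (S := S)
  have e1 := starFace_verts_dim β
  have hs : (-1 : ℤ) ^ (starFace S (verts β)).dim = -(-1) ^ β.dim := by
    rw [e1, pow_succ, mul_neg_one]
  rw [Category.assoc, starQr_proj, Preadditive.comp_neg, ← Category.assoc, d_proj Z hnm,
    sum_star _ fun α hα => by
      rw [FiltComplex.eq_zero_of_isZero (hZ α hα) (proj r Z n α), zero_comp],
    Preadditive.sub_comp, apply_d_proj hln, Category.assoc, hf, Preadditive.add_comp,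
    Preadditive.add_comp, Preadditive.sum_comp, hs]
  have t1 : (-(-1 : ℤ) ^ β.dim • (proj r Z n (starFace S (verts β)) ≫
      ((Z.obj (starFace S (verts β))).d (n - (starFace S (verts β)).dim)
        (m - (starFace S (verts β)).dim)).f)) ≫
        dc (Z.obj (starFace S (verts β))) (m - (starFace S (verts β)).dim) (n - β.dim) =
      ((-1 : ℤ) ^ β.dim) • ((starQr r Z n l ≫ proj r (starDiag Z) l β) ≫
        ((Z.obj (starFace S (verts β))).d (l - β.dim) (n - β.dim)).f) := by
    rw [starQr_proj, Preadditive.neg_comp, Category.assoc, dc_d (Z.obj (starFace S (verts β)))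
      (j := m - (starFace S (verts β)).dim) (by omega), neg_smul, Preadditive.neg_comp,
      Preadditive.zsmul_comp, smul_neg, Category.assoc]
  have t2 : (proj r Z n (starFace S ∅) ≫
      cubeTerm Z n m (starFace S ∅) (starFace S (verts β))) ≫
        dc (Z.obj (starFace S (verts β))) (m - (starFace S (verts β)).dim) (n - β.dim) =
      -(starPr r Z n ≫ dc (Z.obj (starFace S ∅)) n (n - β.dim) ≫
      ((Z.map (homOfLE (starFace_mono S (Finset.empty_subset (verts β))))).f (n - β.dim)).f) := by
    by_cases hβ : β.dim = 0
    · rw [cubeTerm_of_le _ _ _ (starFace_mono S (Finset.empty_subset (verts β))),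
        incidence_starFace_empty hβ, neg_smul, one_smul, Preadditive.comp_neg, Preadditive.neg_comp,
        starPr]
      congr 1
      simp only [Category.assoc]
      rw [dc_trans' _ (by omega), dc_trans_assoc _ (by omega), ← dc_comm]
    · rw [cubeTerm_of_dim_ne _ hnm (by omega), comp_zero, zero_comp,
        dc_eq_zero (Z.obj (starFace S ∅)) (i := n) (by omega), zero_comp, comp_zero, neg_zero]
  have t3 : ∀ α : (single S).Idx, (proj r Z n (starFace S (verts α)) ≫
      cubeTerm Z n m (starFace S (verts α)) (starFace S (verts β))) ≫
        dc (Z.obj (starFace S (verts β))) (m - (starFace S (verts β)).dim) (n - β.dim) =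
      (starQr r Z n l ≫ proj r (starDiag Z) l α) ≫ cubeTerm (starDiag Z) l n α β := by
    intro α
    rw [Category.assoc, cubeTerm_starFace Z hln hnm, starQr_proj, Preadditive.comp_neg,
      Preadditive.neg_comp, Category.assoc]
  rw [t1, t2, Finset.sum_congr rfl fun α _ => t3 α]
  abel

lemma coneAcyclic_star_iff {Z : (single S.star).Idx ⥤ FiltComplex A}
    (hZ : ∀ α, starBot S ∉ verts α → IsZero (Z.obj α))
    (a : constDiag (single S) (Z.obj (starFace S ∅)) ⟶ starDiag Z)
    (ha : ∀ β, a.app β = Z.map (homOfLE (starFace_mono S (Finset.empty_subset (verts β))))) :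
    ConeAcyclic r (lamMap r (single S) (Z.obj (starFace S ∅)) ≫ sMap r a) ↔
      PageAcyclic r (rSimpleComplex r Z) :=
  coneAcyclic_iff_pageAcyclic _ (starPr r Z) (starQr r Z)
    (fun _ _ h _ x y => exists_starPr_starQr Z h x y)
    (fun _ _ _ h _ z => mem_starPr_starQr_iff hZ h z)
    (fun _ _ h => d_starPr Z h)
    (fun _ _ _ h h' => d_starQr hZ _ (fun n β => by
      rw [comp_sMap_proj, lamMap_proj, ha]) h h')

end Acyclic

/-! ### Finite products and saturation -/

/-- A functor inverting `W` factors through the localization. A class consisting of all morphisms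
inverted by a family of functors is therefore saturated. -/
lemma isIso_map_of_isIso_Q_map {C D : Type*} [Category* C] [Category* D] {W : MorphismProperty C}
    (F : C ⥤ D) (hF : W.IsInvertedBy F) {X Y : C} (f : X ⟶ Y) (hf : IsIso (W.Q.map f)) :
    IsIso (F.map f) :=
  (NatIso.isIso_map_iff (Localization.fac F hF W.Q) f).1
    (inferInstanceAs (IsIso ((Localization.lift F hF W.Q).map (W.Q.map f))))

lemma isIso_map_prod_map {C D : Type*} [Category* C] [Category* D] [HasBinaryProducts C]
    [HasBinaryProducts D] (F : C ⥤ D) [PreservesLimitsOfShape (Discrete WalkingPair) F]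
    {X X' Y Y' : C} (f : X ⟶ Y) (g : X' ⟶ Y') (hf : IsIso (F.map f)) (hg : IsIso (F.map g)) :
    IsIso (F.map (prod.map f g)) := by
  have h := prodComparison_natural F f g
  have : IsIso (F.map (prod.map f g) ≫ prodComparison F Y Y') := by
    rw [h]; infer_instance
  exact IsIso.of_isIso_comp_right _ (prodComparison F Y Y')

section Page

attribute [local instance] Abelian.hasFiniteBiproducts

variable {A : Type u} [Category.{v} A] [Abelian A]

/-- The product of a finite family of filtered objects. -/
def FiltObj.piFan {I : Type} [Fintype I] (X : I → FiltObj A) : Fan X :=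
  Fan.mk (P := (⟨⨁ fun i => (X i).X, fun p => directSum fun i => (X i).W p,
      fun _ _ h => directSum_mono fun i => (X i).mono h⟩ : FiltObj A))
    fun i => ⟨biproduct.π (fun i => (X i).X) i, fun p =>
      (directSum_factors (fun i => (X i).W p) _).1 (Subobject.factors_self _) i⟩

/-- `FiltObj.piFan` is a limit cone. -/
def FiltObj.isLimitPiFan {I : Type} [Fintype I] (X : I → FiltObj A) : IsLimit (piFan X) :=
  Fan.IsLimit.mk _ (fun s => ⟨biproduct.lift fun i => (s.proj i).f, fun p => by
      refine (directSum_factors (fun i => (X i).W p) _).2 fun i => ?_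
      have e : ((s.pt.W p).arrow ≫ biproduct.lift fun i => (s.proj i).f) ≫ biproduct.π _ i =
          (s.pt.W p).arrow ≫ (s.proj i).f :=
        (Category.assoc _ _ _).trans (congrArg (_ ≫ ·) (biproduct.lift_π _ _))
      exact e ▸ (s.proj i).mapsTo p⟩)
    (fun s i => FiltObj.hom_ext (biproduct.lift_π _ _))
    (fun s m hm => FiltObj.hom_ext (biproduct.hom_ext _ _ fun i =>
      (congrArg FiltObj.Hom.f (hm i)).trans
        (biproduct.lift_π (f := fun i => (X i).X) (fun i => (s.proj i).f) i).symm))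

instance : HasFiniteProducts (FiltObj A) where
  out n := ⟨fun F => by
    have : HasProduct (F.obj ∘ Discrete.mk) := ⟨⟨⟨_, FiltObj.isLimitPiFan _⟩⟩⟩
    exact hasLimit_of_iso Discrete.natIsoFunctor.symm⟩

instance : HasFiniteProducts (FiltComplex A) where
  out _ := inferInstance

instance : HasZeroObject (FiltComplex A) := hasZeroObject_of_hasTerminal_object

variable (A) in
/-- The cohomology of the page `E_r`. -/
abbrev pageHomology (r p n : ℤ) : FiltComplex A ⥤ A :=
  pageFunctor A r p ⋙ HomologicalComplex.homologyFunctor A (ComplexShape.up ℤ) n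

/-- The class is cut out by the functors `H^n(E_r)` with values in `A`, which settles saturation at
once and, by additivity, stability by products. -/
lemma pageQuasiIso_iff_isIso (r : ℕ) {K L : FiltComplex A} (f : K ⟶ L) :
    pageQuasiIso A r f ↔ ∀ p n : ℤ, IsIso ((pageHomology A r p n).map f) := by
  refine forall_congr' fun p => (quasiIso_iff _).trans (forall_congr' fun n => ?_)
  exact quasiIsoAt_iff_isIso_homologyMap _ _

lemma subquotientMap_add {X Y : A} {B Z : Subobject X} {B' Z' : Subobject Y} (h : B ≤ Z)
    (h' : B' ≤ Z') (f g k : X ⟶ Y) (hk : k = f + g) (hB : MapsTo B f B') (hZ : MapsTo Z f Z')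
    (gB : MapsTo B g B') (gZ : MapsTo Z g Z') (kB : MapsTo B k B') (kZ : MapsTo Z k Z') :
    subquotientMap h h' k kB kZ = subquotientMap h h' f hB hZ + subquotientMap h h' g gB gZ := by
  subst hk
  refine subquotient_hom_ext h ?_
  rw [Preadditive.comp_add, π_subquotientMap, π_subquotientMap, π_subquotientMap,
    ← Preadditive.add_comp]
  congr 1
  rw [← cancel_mono Z'.arrow, Preadditive.add_comp, hZ.lift_arrow, gZ.lift_arrow, kZ.lift_arrow,
    Preadditive.comp_add]

/-- Additivity is used in the form of preservation of finite products. -/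
instance (r p : ℤ) : (pageFunctor A r p).Additive where
  map_add {K L f g} := by
    ext n : 1
    exact subquotientMap_add _ _ _ _ _ rfl (hom_mapsTo_boundariesB f r _ n)
      (hom_mapsTo_cyclesZ f r _ n) (hom_mapsTo_boundariesB g r _ n) (hom_mapsTo_cyclesZ g r _ n)
      (hom_mapsTo_boundariesB (f + g) r _ n) (hom_mapsTo_cyclesZ (f + g) r _ n)

lemma pageQuasiIso_saturated (r : ℕ) {K L : FiltComplex A} (f : K ⟶ L)
    (hf : IsIso ((pageQuasiIso A r).Q.map f)) : pageQuasiIso A r f :=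
  (pageQuasiIso_iff_isIso r f).2 fun p n => isIso_map_of_isIso_Q_map (pageHomology A r p n)
    (fun _ _ g hg => (pageQuasiIso_iff_isIso r g).1 hg p n) f hf

lemma pageQuasiIso_prod_map (r : ℕ) {K K' L L' : FiltComplex A} (f : K ⟶ L) (g : K' ⟶ L')
    (hf : pageQuasiIso A r f) (hg : pageQuasiIso A r g) : pageQuasiIso A r (prod.map f g) := by
  refine (pageQuasiIso_iff_isIso r _).2 fun p n => ?_
  exact isIso_map_prod_map _ f g ((pageQuasiIso_iff_isIso r f).1 hf p n)
    ((pageQuasiIso_iff_isIso r g).1 hg p n)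

/-- Since finite products are biproducts here, this is what makes each `s_P` commute with finite
products. -/
instance (r : ℕ) (P : Cube) : (simpleAt (rSimple A r) P).Additive where
  map_add {X Y f g} := by
    refine hom_ext_proj (r := r) (X := Y) fun n α => (sMap_proj (r := r) (f + g) n α).trans ?_
    refine (Preadditive.comp_add _ _ _ _ _ _).trans (Eq.trans ?_ (Preadditive.add_comp _ _ _ _ _ _).symm)
    exact (congrArg₂ (· + ·) (sMap_proj (r := r) f n α) (sMap_proj (r := r) g n α)).symm

/-- Localizing the subcategory is a different operation, so saturation is proved again, with the
detecting functors restricted along the inclusion. -/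
lemma pageQuasiIsoPlus_saturated (r : ℕ) {K L : CochainComplex.Plus (FiltObj A)} (f : K ⟶ L)
    (hf : IsIso ((pageQuasiIsoPlus A r).Q.map f)) : pageQuasiIsoPlus A r f :=
  (pageQuasiIso_iff_isIso r f.hom).2 fun p n =>
    isIso_map_of_isIso_Q_map (CochainComplex.Plus.ι _ ⋙ pageHomology A r p n)
    (fun _ _ g hg => (pageQuasiIso_iff_isIso r g.hom).1 hg p n) f hf

instance : HasFiniteProducts (CochainComplex.Plus (FiltObj A)) where
  out _ := inferInstance

instance : HasZeroObject (CochainComplex.Plus (FiltObj A)) := hasZeroObject_of_hasTerminal_object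

lemma pageQuasiIsoPlus_prod_map (r : ℕ) {K K' L L' : CochainComplex.Plus (FiltObj A)}
    (f : K ⟶ L) (g : K' ⟶ L') (hf : pageQuasiIsoPlus A r f) (hg : pageQuasiIsoPlus A r g) :
    pageQuasiIsoPlus A r (prod.map f g) := by
  refine (pageQuasiIso_iff_isIso r _).2 fun p n => ?_
  exact isIso_map_prod_map (CochainComplex.Plus.ι _ ⋙ pageHomology A r p n) f g
    ((pageQuasiIso_iff_isIso r f.hom).1 hf p n) ((pageQuasiIso_iff_isIso r g.hom).1 hg p n)

instance (r : ℕ) (P : Cube) : (simpleAt (rSimplePlus A r) P).Additive where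
  map_add {X Y f g} := by
    refine InducedCategory.hom_ext ?_
    exact (simpleAt (rSimple A r) P).map_add
      (f := Functor.whiskerRight f (CochainComplex.Plus.ι _))
      (g := Functor.whiskerRight g (CochainComplex.Plus.ι _))

end Page

section Structure

attribute [local instance] Abelian.hasFiniteBiproducts

variable {A : Type u} [Category.{v} A] [Abelian A]

/-! ### The descent structure on filtered complexes -/

variable (A) in
/-- The natural transformation `s_P s_Q ⟶ s_(P × Q)`. -/
def muNat (r : ℕ) (P Q : Cube) : innerSimple (rSimple A r) P Q ⋙ simpleAt (rSimple A r) P ⟶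
    uncurryCube (FiltComplex A) P Q ⋙ simpleAt (rSimple A r) (P.prod Q) where
  -- The diagrams `inner r X` and `uncurried X` agree by definition with those formed by
  -- `innerSimple` and `uncurryCube`; the laws proved for the former apply without transport.
  app X := muMap (r := r) X
  naturality _ _ a := muMap_naturality a

variable (A) in
/-- The natural transformation from an object to the simple of the constant diagram. -/
def lamNat (r : ℕ) (P : Cube) :
    𝟭 (FiltComplex A) ⟶ Functor.const P.Idx ⋙ simpleAt (rSimple A r) P where
  app X := lamMap r P X
  naturality _ _ f := lamMap_naturality f

lemma muNat_restrict (r : ℕ) {P P' Q Q' : Cube} (u : P' ⟶ P) (w : Q' ⟶ Q)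
    (X : P.Idx ⥤ Q.Idx ⥤ FiltComplex A) :
    iterRestrict (rSimple A r) u w X ≫ (muNat A r P' Q').app (restrict₂ u w X) =
      (muNat A r P Q).app X ≫ prodRestrict (rSimple A r) u w X :=
  muMap_restrict_proj u w X _ fun _ => rfl

lemma muNat_assoc (r : ℕ) (P Q R : Cube) (X : P.Idx ⥤ Q.Idx ⥤ R.Idx ⥤ FiltComplex A) :
    (muNat A r P Q).app (X ⋙ innerSimple (rSimple A r) Q R) ≫
        (simpleAt (rSimple A r) (P.prod Q)).map (uncurryInner (rSimple A r) P Q R X).hom ≫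
        (muNat A r (P.prod Q) R).app ((uncurryCube (R.Idx ⥤ FiltComplex A) P Q).obj X) =
      (simpleAt (rSimple A r) P).map (X.whiskerLeft (muNat A r Q R)) ≫
        (muNat A r P (Q.prod R)).app (X ⋙ uncurryCube (FiltComplex A) Q R) ≫
        simpleRestrict (rSimple A r) (assoc P Q R) _ ≫
        (simpleAt (rSimple A r) ((P.prod Q).prod R)).map (uncurryAssoc P Q R X) :=
  muMap_assoc X (uncurryInner (rSimple A r) P Q R X).hom (fun _ => rfl) (uncurryAssoc P Q R X)
    fun _ => rfl

lemma lamNat_muNat (r : ℕ) (Q : Cube) (X : Q.Idx ⥤ FiltComplex A) :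
    (lamNat A r unit).app ((simpleAt (rSimple A r) Q).obj X) ≫
        (simpleAt (rSimple A r) unit).map
          (Functor.constComp _ X (simpleAt (rSimple A r) Q)).inv ≫
        (muNat A r unit Q).app ((Functor.const _).obj X) ≫
        simpleRestrict (rSimple A r) (leftUnit Q) _ ≫
        (simpleAt (rSimple A r) Q).map (uncurryLeftUnit Q X) = 𝟙 _ :=
  lamMap_muMap X (Functor.constComp _ X (simpleAt (rSimple A r) Q)).inv (fun _ => rfl)
    (uncurryLeftUnit Q X) fun _ => rfl

lemma muNat_lamNat (r : ℕ) (P : Cube) (X : P.Idx ⥤ FiltComplex A) :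
    (simpleAt (rSimple A r) P).map (X.whiskerLeft (lamNat A r unit)) ≫
        (muNat A r P unit).app (X ⋙ Functor.const _) ≫
        simpleRestrict (rSimple A r) (rightUnit P) _ ≫
        (simpleAt (rSimple A r) P).map (uncurryRightUnit P X) = 𝟙 _ :=
  muMap_lamMap X (X.whiskerLeft (lamNat A r unit)) (fun _ => rfl) (uncurryRightUnit P X)
    fun _ => rfl

lemma lamNat_prod (r : ℕ) (P Q : Cube) (X : FiltComplex A) :
    (lamNat A r P).app X ≫ (simpleAt (rSimple A r) P).map
        ((Functor.const P.Idx).map ((lamNat A r Q).app X) ≫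
        (Functor.constComp _ ((Functor.const Q.Idx).obj X) (simpleAt (rSimple A r) Q)).inv) ≫
        (muNat A r P Q).app ((Functor.const _).obj ((Functor.const _).obj X)) ≫
        (simpleAt (rSimple A r) (P.prod Q)).map (uncurryConst P Q X) =
      (lamNat A r (P.prod Q)).app X :=
  lamMap_prod X _ (fun _ => Category.comp_id _) (uncurryConst P Q X) fun _ => rfl

/-- Phrased for an arbitrary zero object and an arbitrary morphism from it, so that it also applies
to the image of the initial object of the bounded below subcategory, which need not be the chosen
initial object. -/
lemma lamNat_acyclic (r : ℕ) (S : CubeSet) (Z : (single S.star).Idx ⥤ FiltComplex A)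
    (hZ : ∀ α : (single S.star).Idx, (⊥ : WithBot S.carrier) ∉ α.set () → IsZero (Z.obj α))
    {I : FiltComplex A} (hI : IsZero I) (f : I ⟶ (simpleAt (rSimple A r) (single S.star)).obj Z) :
    pageQuasiIso A r ((lamNat A r (single S)).app (Z.obj (starFace S ∅)) ≫
        (simpleAt (rSimple A r) (single S)).map (starAugmentation S Z)) ↔ pageQuasiIso A r f :=
  (pageQuasiIso_iff r _).trans ((coneAcyclic_star_iff hZ (starAugmentation S Z) fun _ => rfl).trans
    ((coneAcyclic_iff_of_isZero hI f).symm.trans (pageQuasiIso_iff r f).symm))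

variable (A) in
/-- Filtered complexes, with the `E_r`-quasi-isomorphisms and the `r`-simple functor, form a
cohomological descent category. -/
def descentStructure (r : ℕ) :
    CohomologicalDescentStructure (rSimple A r) (pageQuasiIso A r) where
  saturated := pageQuasiIso_saturated r
  prod_map := pageQuasiIso_prod_map r
  preservesFiniteProducts _ := inferInstance
  exact a h := (pageQuasiIso_iff r _).2
    (coneAcyclic_sMap a fun α => (pageQuasiIso_iff r _).1 (h α))
  μ := muNat A r
  μ_mem _ _ X := (pageQuasiIso_iff r _).2 (coneAcyclic_muMap X)
  μ_restrict := muNat_restrict r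
  lam := lamNat A r
  lam_mem P X := (pageQuasiIso_iff r _).2 (coneAcyclic_lamMap P X)
  lam_restrict u X := lamMap_restrict u X
  μ_assoc := muNat_assoc r
  lam_μ := lamNat_muNat r
  μ_lam := muNat_lamNat r
  lam_prod := lamNat_prod r
  acyclic S Z hZ := lamNat_acyclic r S Z (fun α hα => (hZ α hα).elim IsInitial.isZero)
    initialIsInitial.isZero _

end Structure

section StructurePlus

attribute [local instance] Abelian.hasFiniteBiproducts

variable {A : Type u} [Category.{v} A] [Abelian A]

/-! ### The descent structure on bounded below filtered complexes -/

/-- The diagram of filtered complexes underlying a diagram of bounded below ones. -/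
abbrev forgetPlus {I : Type} [Category I] (X : I ⥤ CochainComplex.Plus (FiltObj A)) :
    I ⥤ FiltComplex A := X ⋙ CochainComplex.Plus.ι (FiltObj A)

/-- The functor of two variables with values in filtered complexes underlying one with values in
bounded below filtered complexes. -/
abbrev forgetPlus₂ {I J : Type} [Category I] [Category J]
    (X : I ⥤ J ⥤ CochainComplex.Plus (FiltObj A)) : I ⥤ J ⥤ FiltComplex A :=
  X ⋙ (Functor.whiskeringRight J _ _).obj (CochainComplex.Plus.ι (FiltObj A))

variable (A) in
/-- The natural transformation `s_P s_Q ⟶ s_(P × Q)`. -/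
def muNatPlus (r : ℕ) (P Q : Cube) :
    innerSimple (rSimplePlus A r) P Q ⋙ simpleAt (rSimplePlus A r) P ⟶
      uncurryCube (CochainComplex.Plus (FiltObj A)) P Q ⋙
        simpleAt (rSimplePlus A r) (P.prod Q) where
  app X := ObjectProperty.homMk ((muNat A r P Q).app (forgetPlus₂ X))
  naturality _ _ a := InducedCategory.hom_ext ((muNat A r P Q).naturality
    (Functor.whiskerRight a ((Functor.whiskeringRight _ _ _).obj (CochainComplex.Plus.ι _))))

variable (A) in
/-- The natural transformation from an object to the simple of the constant diagram. -/
def lamNatPlus (r : ℕ) (P : Cube) : 𝟭 (CochainComplex.Plus (FiltObj A)) ⟶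
    Functor.const P.Idx ⋙ simpleAt (rSimplePlus A r) P where
  app X := ObjectProperty.homMk ((lamNat A r P).app X.obj)
  naturality _ _ f := InducedCategory.hom_ext ((lamNat A r P).naturality f.hom)

/-- An equation of morphisms in a full subcategory is an equation in the ambient category, and the
simple functors correspond by definition. The other coherence laws descend in the same way. -/
lemma muNatPlus_restrict (r : ℕ) {P P' Q Q' : Cube} (u : P' ⟶ P) (w : Q' ⟶ Q)
    (X : P.Idx ⥤ Q.Idx ⥤ CochainComplex.Plus (FiltObj A)) :
    iterRestrict (rSimplePlus A r) u w X ≫ (muNatPlus A r P' Q').app (restrict₂ u w X) =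
      (muNatPlus A r P Q).app X ≫ prodRestrict (rSimplePlus A r) u w X :=
  InducedCategory.hom_ext (muNat_restrict r u w (forgetPlus₂ X))

lemma muNatPlus_assoc (r : ℕ) (P Q R : Cube)
    (X : P.Idx ⥤ Q.Idx ⥤ R.Idx ⥤ CochainComplex.Plus (FiltObj A)) :
    (muNatPlus A r P Q).app (X ⋙ innerSimple (rSimplePlus A r) Q R) ≫
        (simpleAt (rSimplePlus A r) (P.prod Q)).map
          (uncurryInner (rSimplePlus A r) P Q R X).hom ≫
        (muNatPlus A r (P.prod Q) R).app ((uncurryCube (R.Idx ⥤ _) P Q).obj X) =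
      (simpleAt (rSimplePlus A r) P).map (X.whiskerLeft (muNatPlus A r Q R)) ≫
        (muNatPlus A r P (Q.prod R)).app (X ⋙ uncurryCube _ Q R) ≫
        simpleRestrict (rSimplePlus A r) (assoc P Q R) _ ≫
        (simpleAt (rSimplePlus A r) ((P.prod Q).prod R)).map (uncurryAssoc P Q R X) :=
  InducedCategory.hom_ext (muNat_assoc r P Q R (X ⋙ (Functor.whiskeringRight _ _ _).obj
    ((Functor.whiskeringRight _ _ _).obj (CochainComplex.Plus.ι (FiltObj A)))))

lemma lamNatPlus_muNatPlus (r : ℕ) (Q : Cube) (X : Q.Idx ⥤ CochainComplex.Plus (FiltObj A)) :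
    (lamNatPlus A r unit).app ((simpleAt (rSimplePlus A r) Q).obj X) ≫
        (simpleAt (rSimplePlus A r) unit).map
          (Functor.constComp _ X (simpleAt (rSimplePlus A r) Q)).inv ≫
        (muNatPlus A r unit Q).app ((Functor.const _).obj X) ≫
        simpleRestrict (rSimplePlus A r) (leftUnit Q) _ ≫
        (simpleAt (rSimplePlus A r) Q).map (uncurryLeftUnit Q X) = 𝟙 _ :=
  InducedCategory.hom_ext (lamNat_muNat r Q (forgetPlus X))

lemma muNatPlus_lamNatPlus (r : ℕ) (P : Cube) (X : P.Idx ⥤ CochainComplex.Plus (FiltObj A)) :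
    (simpleAt (rSimplePlus A r) P).map (X.whiskerLeft (lamNatPlus A r unit)) ≫
        (muNatPlus A r P unit).app (X ⋙ Functor.const _) ≫
        simpleRestrict (rSimplePlus A r) (rightUnit P) _ ≫
        (simpleAt (rSimplePlus A r) P).map (uncurryRightUnit P X) = 𝟙 _ :=
  InducedCategory.hom_ext (muNat_lamNat r P (forgetPlus X))

lemma lamNatPlus_prod (r : ℕ) (P Q : Cube) (X : CochainComplex.Plus (FiltObj A)) :
    (lamNatPlus A r P).app X ≫ (simpleAt (rSimplePlus A r) P).map
        ((Functor.const P.Idx).map ((lamNatPlus A r Q).app X) ≫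
        (Functor.constComp _ ((Functor.const Q.Idx).obj X) (simpleAt (rSimplePlus A r) Q)).inv) ≫
        (muNatPlus A r P Q).app ((Functor.const _).obj ((Functor.const _).obj X)) ≫
        (simpleAt (rSimplePlus A r) (P.prod Q)).map (uncurryConst P Q X) =
      (lamNatPlus A r (P.prod Q)).app X :=
  InducedCategory.hom_ext (lamNat_prod r P Q X.obj)

variable (A) in
/-- Bounded below filtered complexes, with the `E_r`-quasi-isomorphisms and the `r`-simple functor,
form a cohomological descent category. -/
def descentStructurePlus (r : ℕ) :
    CohomologicalDescentStructure (rSimplePlus A r) (pageQuasiIsoPlus A r) where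
  saturated := pageQuasiIsoPlus_saturated r
  prod_map := pageQuasiIsoPlus_prod_map r
  preservesFiniteProducts _ := inferInstance
  exact a h := (descentStructure A r).exact (Functor.whiskerRight a (CochainComplex.Plus.ι _)) h
  μ := muNatPlus A r
  μ_mem P Q X := (descentStructure A r).μ_mem P Q (forgetPlus₂ X)
  μ_restrict := muNatPlus_restrict r
  lam := lamNatPlus A r
  lam_mem P X := (descentStructure A r).lam_mem P X.obj
  lam_restrict u X := InducedCategory.hom_ext ((descentStructure A r).lam_restrict u X.obj)
  μ_assoc := muNatPlus_assoc r
  lam_μ := lamNatPlus_muNatPlus r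
  μ_lam := muNatPlus_lamNatPlus r
  lam_prod := lamNatPlus_prod r
  acyclic S Z hZ := lamNat_acyclic r S (forgetPlus Z)
    (fun α hα => (hZ α hα).elim fun h => (CochainComplex.Plus.ι _).map_isZero h.isZero)
    ((CochainComplex.Plus.ι _).map_isZero initialIsInitial.isZero) _

end StructurePlus

end CubicalDescent

end

theorem mainTheorem3 {A : Type u} [CategoryTheory.Category.{v} A] [CategoryTheory.Abelian A]
    (r : ℕ) :
    Nonempty (CubicalDescent.CohomologicalDescentStructure
      (CubicalDescent.rSimple A r) (CubicalDescent.pageQuasiIso A r)) ∧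
    Nonempty (CubicalDescent.CohomologicalDescentStructure
      (CubicalDescent.rSimplePlus A r) (CubicalDescent.pageQuasiIsoPlus A r)) := by
  exact ⟨⟨CubicalDescent.descentStructure A r⟩, ⟨CubicalDescent.descentStructurePlus A r⟩⟩
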